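/- Let $N$ be a lattice of rank $r$, with $N_{\mathbb R}=N\otimes\mathbb R$, and let $M=\mathrm{Hom}_{\mathbb Z}(N,\mathbb Z)$ and $M_{\mathbb C}=M\otimes\mathbb C=\mathrm{Hom}_{\mathbb Z}(N,\mathbb C)$, with the pairing $m\cdot n$. Let $\Sigma$ be a complete rational polyhedral fan in $N_{\mathbb R}$, that is, a finite set of strongly convex rational polyhedral cones, closed under taking faces, any two of which meet in a common face, with union $N_{\mathbb R}$. Let $\deg\colon N\to\mathbb C$ be a function that is linear on every cone of $\Sigma$, and let $D\subset N$ be the set of primitive lattice generators of the one-dimensional cones of $\Sigma$. For $\tau\in\mathfrak H$ (the upper half-plane) put $q=e^{2\pi i\tau}$ and $q^{z}=e^{2\pi i\tau z}$. For $C\in\Sigma$ let $f_C(q,m)$ be the function obtained by analytic continuation in $(\tau,m)\in\mathfrak H\times M_{\mathbb C}$ of the series $\sum_{n\in C\cap N}q^{m\cdot n}e^{2\pi i\deg(n)}$ from the set where it converges absolutely, and let $$r(q,m)=\sum_{C\in\Sigma}(-1)^{\operatorname{codim}C}f_C(q,m).$$ Let $\mathbb C[N]^\Sigma=\bigoplus_{n\in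 N}\mathbb C\,y^n$ be the commutative ring with $y^{n_1}y^{n_2}=y^{n_1+n_2}$ if some cone of $\Sigma$ contains both $n_1$ and $n_2$, and $y^{n_1}y^{n_2}=0$ otherwise. It is a module over the polynomial ring $R=\mathbb C[y^d\mid d\in D]$, where the variable $y^d$ acts as multiplication by the element $y^d$; let $\mathbb C$ be the $R$-module on which all variables act as $0$. Grade $R$ and $\mathbb C[N]^\Sigma$ by $N\oplus\mathbb C$, with $y^d$ in degree $(d,\deg d)$ and $y^n$ in degree $(n,\deg n)$, and place $\mathbb C$ in degree $0$. Then $\mathrm{Tor}_i^R(\mathbb C[N]^\Sigma,\mathbb C)$ has an induced $N\oplus\mathbb C$-grading, namely the grading of the homology of $\mathbb C[N]^\Sigma\otimes_RP_\bullet$, where $P_\bullet\to\mathbb C$ is a graded projective resolution (such resolutions exist, and the statement holds for each of them). The spaces $\mathrm{Tor}_i^R(\mathbb C[N]^\Sigma,\mathbb C)$ are finite-dimensional and vanish for all large $i$. Let $q^{m\cdot\mathbf n}e^{2\pi i\,\mathbf{deg}}$ be the operator acting on the component of degree $(n,c)$ as the scalar $q^{m\cdot n}e^{2\pi ic}$.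 Then for all $\tau\in\mathfrak H$ and $m\in M_{\mathbb C}$ with $e^{2\pi i\deg(d)}q^{m\cdot d}\neq1$ for every $d\in D$, each $f_C(q,m)$ is defined (the continuation exists and its value is unique), and $$r(q,m)=\frac{\sum_i(-1)^i\,\mathrm{Trace}_{\mathrm{Tor}_i^R(\mathbb C[N]^\Sigma,\mathbb C)}\;q^{m\cdot\mathbf n}e^{2\pi i\,\mathbf{deg}}}{\prod_{d\in D}\bigl(1-e^{2\pi i\deg(d)}q^{m\cdot d}\bigr)}.$$ -/

import Mathlib

open CategoryTheory MonoidalCategory TensorProduct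
open scoped ModuleCat

universe u

noncomputable section

namespace ToricForms

variable {V : Type u} [NormedAddCommGroup V] [NormedSpace ℝ V]

/-- A complete rational polyhedral fan in the real vector space `V = N_ℝ`, for a lattice `N ⊆ V`:
a finite set of strongly convex rational polyhedral cones, closed under passing to faces, in which
any two cones meet in a common face, and whose union is `V`. -/
structure CompleteFan (N : Submodule ℤ V) where
  /-- The cones of the fan. -/
  cones : Finset (PointedCone ℝ V)
  rational : ∀ C ∈ cones, ∃ S : Set V, S.Finite ∧ S ⊆ (N : Set V) ∧ C = PointedCone.hull ℝ S
  salient : ∀ C ∈ cones, ∀ x : V, x ∈ C → -x ∈ C → x = 0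
  face_mem : ∀ C ∈ cones, ∀ E : PointedCone ℝ V, E.IsFaceOf C → E ∈ cones
  inter_isFaceOf : ∀ C ∈ cones, ∀ C' ∈ cones, (C ⊓ C').IsFaceOf C ∧ (C ⊓ C').IsFaceOf C'
  complete : ∀ x : V, ∃ C ∈ cones, x ∈ C

/-- The dimension of the linear subspace generated by a cone. -/
def coneDim (C : PointedCone ℝ V) : ℕ := Module.finrank ℝ (Submodule.span ℝ (C : Set V))

/-- The codimension of a cone in `V`. -/
def coneCodim (C : PointedCone ℝ V) : ℕ := Module.finrank ℝ V - coneDim C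

variable {N : Submodule ℤ V}

namespace CompleteFan

variable (F : CompleteFan N)

/-- The set `D` of generators of the one-dimensional cones of the fan: `d` is the generator of the
one-dimensional cone `C` if it generates the monoid `C ∩ N`. -/
def rayGens : Set N :=
  {d | ∃ C ∈ F.cones, coneDim C = 1 ∧ (d : V) ∈ C ∧ ∀ n : N, (n : V) ∈ C → ∃ k : ℕ, n = k • d}

/-- `deg : N → ℂ` is linear on each cone of the fan. -/
def IsDegreeFunction (deg : N → ℂ) : Prop :=
  ∀ C ∈ F.cones, ∃ l : V →ₗ[ℝ] ℂ, ∀ n : N, (n : V) ∈ C → deg n = l (n : V)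

theorem rayGens_finite : F.rayGens.Finite := by
  classical
  have hne : ∀ C : PointedCone ℝ V, coneDim C = 1 → C ∈ F.cones →
      ∃ n : N, (n : V) ∈ C ∧ n ≠ 0 := by
    intro C hC hCF
    by_contra! h
    obtain ⟨S, -, hSN, rfl⟩ := F.rational C hCF
    have hS : S ⊆ {0} := by
      intro s hs
      have := h ⟨s, hSN hs⟩ (Submodule.subset_span hs)
      simpa using congrArg Subtype.val this
    have hbot : PointedCone.hull ℝ S = ⊥ := Submodule.span_eq_bot.2 fun x hx => by simpa using hS hx
    rw [coneDim, hbot] at hC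
    have h0 : Submodule.span ℝ (((⊥ : PointedCone ℝ V)) : Set V) = ⊥ :=
      Submodule.span_eq_bot.2 fun x hx => hx
    rw [h0, finrank_bot] at hC
    exact zero_ne_one hC
  choose! g hg using
    (fun d (hd : d ∈ F.rayGens) => hd)
  refine Set.Finite.of_finite_image (f := g) (F.cones.finite_toSet.subset ?_) ?_
  · rintro _ ⟨d, hd, rfl⟩
    exact (hg d hd).1
  · intro d hd e he hde
    obtain ⟨h1, h2, h3, h4⟩ := hg d hd
    obtain ⟨e1, e2, e3, e4⟩ := hg e he
    obtain ⟨k, hk⟩ := h4 e (by rw [hde]; exact e3)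
    obtain ⟨j, hj⟩ := e4 d (by rw [← hde]; exact h3)
    obtain ⟨n, hn, hn0⟩ := hne _ h2 h1
    have hd0 : d ≠ 0 := by
      rintro rfl
      obtain ⟨i, hi⟩ := h4 n hn
      exact hn0 (by simpa using hi)
    have hjk : (j * k : ℕ) • d = 1 • d := by
      rw [mul_smul, ← hk, ← hj, one_smul]
    have hV : ((j * k : ℕ) : ℝ) • (d : V) = (1 : ℝ) • (d : V) := by
      have := congrArg (Subtype.val : N → V) hjk
      rw [Nat.cast_smul_eq_nsmul]
      simpa using this
    have hd0' : (d : V) ≠ 0 := by simpa using hd0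
    have h1' : ((j * k : ℕ) : ℝ) = 1 := smul_left_injective ℝ hd0' hV
    have hk1 : k = 1 := Nat.eq_one_of_mul_eq_one_left (by exact_mod_cast h1')
    rw [hk, hk1, one_smul]

/-! ### The deformed semigroup ring -/

/-- Two lattice points lie in a common cone of the fan. -/
def SameCone (a b : N) : Prop := ∃ C ∈ F.cones, (a : V) ∈ C ∧ (b : V) ∈ C

/-- The deformed semigroup ring `ℂ[N]^Σ`; as a vector space it has the basis `y^n`, `n ∈ N`. -/
def DeformedRing (_F : CompleteFan N) : Type u := N →₀ ℂ

namespace DeformedRing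

instance : AddCommGroup F.DeformedRing := inferInstanceAs (AddCommGroup (N →₀ ℂ))

instance : Module ℂ F.DeformedRing := inferInstanceAs (Module ℂ (N →₀ ℂ))

/-- The basis `(y^n)_{n ∈ N}` of `ℂ[N]^Σ`. -/
def y : Module.Basis N ℂ F.DeformedRing := Module.Basis.ofRepr (LinearEquiv.refl ℂ (N →₀ ℂ))

open Classical in
/-- The product `y^a y^b`: it is `y^(a+b)` if `a` and `b` lie in a common cone, and `0` otherwise. -/
def yMul (a b : N) : F.DeformedRing := if F.SameCone a b then y F (a + b) else 0

/-- The bilinear extension of `(y^a, y^b) ↦ y^a y^b`. -/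
def mulLin : F.DeformedRing →ₗ[ℂ] F.DeformedRing →ₗ[ℂ] F.DeformedRing :=
  (y F).constr ℂ fun a => (y F).constr ℂ fun b => yMul F a b

instance : Mul F.DeformedRing := ⟨fun x z => mulLin F x z⟩

instance : One F.DeformedRing := ⟨y F 0⟩

theorem mul_def (x z : F.DeformedRing) : x * z = mulLin F x z := rfl

theorem one_def : (1 : F.DeformedRing) = y F 0 := rfl

theorem y_mul_y (a b : N) : y F a * y F b = yMul F a b := by
  rw [mul_def, mulLin, Module.Basis.constr_basis, Module.Basis.constr_basis]

theorem sameCone_comm {a b : N} : F.SameCone a b ↔ F.SameCone b a :=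
  ⟨fun ⟨C, h, h1, h2⟩ => ⟨C, h, h2, h1⟩, fun ⟨C, h, h1, h2⟩ => ⟨C, h, h2, h1⟩⟩

theorem sameCone_zero (a : N) : F.SameCone 0 a := by
  obtain ⟨C, hC, ha⟩ := F.complete (a : V)
  exact ⟨C, hC, by simp, ha⟩

/-- Three lattice points lie in a common cone of the fan. -/
def SameCone₃ (a b c : N) : Prop := ∃ C ∈ F.cones, (a : V) ∈ C ∧ (b : V) ∈ C ∧ (c : V) ∈ C

theorem sameCone_assoc {a b c : N} :
    (F.SameCone a b ∧ F.SameCone (a + b) c) ↔ SameCone₃ F a b c := by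
  constructor
  · rintro ⟨⟨C, hC, ha, hb⟩, C', hC', hab, hc⟩
    have hf := (F.inter_isFaceOf C hC C' hC').1
    have hab' : (a : V) + (b : V) ∈ C ⊓ C' := ⟨C.add_mem ha hb, by simpa using hab⟩
    have ha' := hf.mem_of_add_mem_left ha hb hab'
    have hb' := hf.mem_of_add_mem_right ha hb hab'
    exact ⟨C', hC', ha'.2, hb'.2, hc⟩
  · rintro ⟨C, hC, ha, hb, hc⟩
    exact ⟨⟨C, hC, ha, hb⟩, C, hC, by simpa using C.add_mem ha hb, hc⟩

open Classical in
theorem y_mul_y_mul_y (a b c : N) : y F a * y F b * y F c =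
    if SameCone₃ F a b c then y F (a + b + c) else 0 := by
  rw [y_mul_y]
  simp only [← sameCone_assoc]
  by_cases h : F.SameCone a b
  · simp only [yMul, h, if_true, true_and]
    rw [y_mul_y, yMul]
  · simp only [yMul, h, if_false, false_and]
    simp [mul_def]

theorem y_mul_comm (a b : N) : y F a * y F b = y F b * y F a := by
  rw [y_mul_y, y_mul_y, yMul, yMul, add_comm a]
  by_cases h : F.SameCone a b
  · rw [if_pos h, if_pos ((sameCone_comm F).1 h)]
  · rw [if_neg h, if_neg fun h' => h ((sameCone_comm F).1 h')]

protected theorem mul_comm (x z : F.DeformedRing) : x * z = z * x := by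
  have : mulLin F = (mulLin F).flip :=
    (y F).ext fun a => (y F).ext fun b => y_mul_comm F a b
  exact congrArg (fun f => f x z) this

theorem y_mul_assoc (a b c : N) : y F a * y F b * y F c = y F a * (y F b * y F c) := by
  rw [DeformedRing.mul_comm F (y F a) (y F b * y F c), y_mul_y_mul_y, y_mul_y_mul_y]
  have h1 : SameCone₃ F a b c ↔ SameCone₃ F b c a :=
    exists_congr fun C => and_congr_right fun _ => by tauto
  have h2 : a + b + c = b + c + a := by abel
  rw [h2]
  by_cases h : SameCone₃ F a b c
  · rw [if_pos h, if_pos (h1.1 h)]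
  · rw [if_neg h, if_neg fun h' => h (h1.2 h')]

protected theorem mul_assoc (x z w : F.DeformedRing) : x * z * w = x * (z * w) := by
  have h1 (a b : N) (w : F.DeformedRing) : y F a * y F b * w = y F a * (y F b * w) := by
    have : mulLin F (y F a * y F b) = (mulLin F (y F a)).comp (mulLin F (y F b)) :=
      (y F).ext fun c => y_mul_assoc F a b c
    exact congrArg (fun f => f w) this
  have h2 (a : N) (z w : F.DeformedRing) : y F a * z * w = y F a * (z * w) := by
    have : ((mulLin F).flip w).comp (mulLin F (y F a)) =
        (mulLin F (y F a)).comp ((mulLin F).flip w) := (y F).ext fun b => h1 a b w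
    exact congrArg (fun f => f z) this
  have : ((mulLin F).flip w).comp ((mulLin F).flip z) = (mulLin F).flip (z * w) :=
    (y F).ext fun a => h2 a z w
  exact congrArg (fun f => f x) this

protected theorem one_mul (x : F.DeformedRing) : 1 * x = x := by
  have : mulLin F 1 = LinearMap.id := (y F).ext fun a => by
    rw [← mul_def, one_def, y_mul_y, yMul, if_pos (sameCone_zero F a), zero_add]; rfl
  exact congrArg (fun f => f x) this

instance : CommRing F.DeformedRing :=
  { (inferInstance : AddCommGroup F.DeformedRing) with
    mul := (· * ·)
    one := 1
    mul_assoc := DeformedRing.mul_assoc F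
    mul_comm := DeformedRing.mul_comm F
    one_mul := DeformedRing.one_mul F
    mul_one := fun x => (DeformedRing.mul_comm F x 1).trans (DeformedRing.one_mul F x)
    left_distrib := fun x z w => (mulLin F x).map_add z w
    right_distrib := fun x z w => (mulLin F).map_add₂ x z w
    zero_mul := fun x => (mulLin F).map_zero₂ x
    mul_zero := fun x => (mulLin F x).map_zero }

instance : Algebra ℂ F.DeformedRing :=
  Algebra.ofModule (fun c x z => (mulLin F).map_smul₂ c x z)
    (fun c x z => (mulLin F x).map_smul c z)

end DeformedRing

/-- The polynomial ring `R = ℂ[y^d ∣ d ∈ D]`. -/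
abbrev PolyRing : Type u := MvPolynomial F.rayGens ℂ

/-- The ring map `R → ℂ[N]^Σ` sending the variable `y^d` to the basis element `y^d`. -/
def polyMap : F.PolyRing →ₐ[ℂ] F.DeformedRing :=
  MvPolynomial.aeval fun d : F.rayGens => DeformedRing.y F d.1

/-- The action of `R` on `ℂ[N]^Σ`. -/
instance : Module F.PolyRing F.DeformedRing := Module.compHom _ F.polyMap.toRingHom

theorem X_smul_y (d : F.rayGens) (n : N) :
    (MvPolynomial.X d : F.PolyRing) • DeformedRing.y F n = DeformedRing.yMul F d.1 n := by
  change F.polyMap (MvPolynomial.X d) * DeformedRing.y F n = _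
  rw [polyMap, MvPolynomial.aeval_X, DeformedRing.y_mul_y]

/-- `ℂ[N]^Σ` as an `R`-module. -/
abbrev deformedModule : ModuleCat.{u} F.PolyRing := ModuleCat.of F.PolyRing F.DeformedRing

/-- `ℂ` as an `R`-module, on which every variable `y^d` acts as zero. -/
abbrev trivialModule : ModuleCat.{u} F.PolyRing :=
  (ModuleCat.restrictScalars (MvPolynomial.constantCoeff : F.PolyRing →+* ℂ)).obj
    (ModuleCat.of ℂ (ULift.{u} ℂ))

/-- The `R`-module `Tor_i^R(ℂ[N]^Σ, ℂ)`. -/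
abbrev tor (i : ℕ) : ModuleCat.{u} F.PolyRing :=
  ((Tor (ModuleCat.{u} F.PolyRing) i).obj F.deformedModule).obj F.trivialModule

/-! ### The grading by `N ⊕ ℂ` -/

variable (deg : N → ℂ)

/-- A family of subspaces is a grading by `N ⊕ ℂ` of the `R`-module `X`, where the variable
`y^d` of `R` has degree `(d, deg d)`. -/
structure IsGrading (X : ModuleCat.{u} F.PolyRing) (𝒢 : N × ℂ → Submodule ℂ X) : Prop where
  iSupIndep : iSupIndep 𝒢
  iSup_eq_top : ⨆ g, 𝒢 g = ⊤
  smul_mem : ∀ (d : F.rayGens) (g : N × ℂ), ∀ x ∈ 𝒢 g,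
    (MvPolynomial.X d : F.PolyRing) • x ∈ 𝒢 ((d.1, deg d.1) + g)

/-- The grading of `ℂ[N]^Σ`, in which `y^n` has degree `(n, deg n)`. -/
def deformedGrading (g : N × ℂ) : Submodule ℂ F.deformedModule :=
  Submodule.span ℂ {x | ∃ n : N, g = (n, deg n) ∧ x = DeformedRing.y F n}

/-- The degree `g` part of `ℂ[N]^Σ ⊗_R X`, for a graded `R`-module `X`. -/
def tensorGrading {X : ModuleCat.{u} F.PolyRing} (𝒢 : N × ℂ → Submodule ℂ X) (g : N × ℂ) :
    Submodule ℂ (F.deformedModule ⊗ X : ModuleCat.{u} F.PolyRing) :=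
  Submodule.span ℂ {t | ∃ g₁ g₂ : N × ℂ, g₁ + g₂ = g ∧
    ∃ a ∈ F.deformedGrading deg g₁, ∃ x ∈ 𝒢 g₂, t = a ⊗ₜ[F.PolyRing] x}

/-- A graded projective resolution of the `R`-module `ℂ` (placed in degree `0`): a projective
resolution, every term of which is graded, with homogeneous differentials and augmentation. -/
structure GradedResolution where
  /-- The underlying projective resolution. -/
  res : ProjectiveResolution F.trivialModule
  /-- The gradings of its terms. -/
  gr : ∀ i : ℕ, N × ℂ → Submodule ℂ (res.complex.X i)
  isGrading : ∀ i, F.IsGrading deg (res.complex.X i) (gr i)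
  d_mem : ∀ (i j : ℕ) (g : N × ℂ), ∀ x ∈ gr i g, (res.complex.d i j).hom x ∈ gr j g
  π_eq_zero : ∀ g : N × ℂ, g ≠ 0 → ∀ x ∈ gr 0 g, (res.π.f 0).hom x = 0

namespace GradedResolution

variable {F deg}
variable (P : F.GradedResolution deg)

/-- The complex `ℂ[N]^Σ ⊗_R P`, whose homology is `Tor^R(ℂ[N]^Σ, ℂ)`. -/
abbrev torComplex : ChainComplex (ModuleCat.{u} F.PolyRing) ℕ :=
  (((tensoringLeft (ModuleCat.{u} F.PolyRing)).obj F.deformedModule).mapHomologicalComplex _).obj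
    P.res.complex

/-- The degree `g` part of `ℂ[N]^Σ ⊗_R P_i`. -/
def torComplexGrading (i : ℕ) (g : N × ℂ) : Submodule ℂ (P.torComplex.X i) :=
  F.tensorGrading deg (P.gr i) g

/-- The map sending a cycle of `ℂ[N]^Σ ⊗_R P` to its class in `Tor_i^R(ℂ[N]^Σ, ℂ)`. -/
def torClass (i : ℕ) : P.torComplex.cycles i ⟶ F.tor i :=
  P.torComplex.homologyπ i ≫
    (P.res.isoLeftDerivedObj ((tensoringLeft (ModuleCat.{u} F.PolyRing)).obj F.deformedModule)
      i).inv

/-- The degree `g` part of `Tor_i^R(ℂ[N]^Σ, ℂ)`: the classes of the cycles of degree `g`. -/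
def torGrading (i : ℕ) (g : N × ℂ) : Submodule ℂ (F.tor i) :=
  ((P.torComplexGrading i g).comap ((P.torComplex.iCycles i).hom.restrictScalars ℂ)).map
    ((P.torClass i).hom.restrictScalars ℂ)

/-- The trace on `Tor_i^R(ℂ[N]^Σ, ℂ)` of the operator `q^(m·n) e^(2πi deg)`, which acts on the
part of degree `(n, c)` as the scalar `q^(m·n) e^(2πi c)`; here `q = e^(2πiτ)`. -/
def torTrace (i : ℕ) (τ : ℂ) (m : V →L[ℝ] ℂ) : ℂ :=
  ∑ᶠ g : N × ℂ, (Module.finrank ℂ (P.torGrading i g) : ℂ) *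
    (Complex.exp (2 * Real.pi * Complex.I * τ * m (g.1 : V)) *
      Complex.exp (2 * Real.pi * Complex.I * g.2))

end GradedResolution

end CompleteFan

/-! ### The cone sums

The space `M_ℂ = M ⊗ ℂ = Hom_ℤ(N, ℂ)` is realised as the complex vector space of real-linear maps
`V → ℂ`, and `H × M_ℂ` as a subset of `ℂ × M_ℂ`. -/

/-- The term `q^(m·n) e^(2πi deg n)`, where `p = (τ, m)` and `q = e^(2πiτ)`. -/
def coneTerm (deg : N → ℂ) (p : ℂ × (V →L[ℝ] ℂ)) (n : N) : ℂ :=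
  Complex.exp (2 * Real.pi * Complex.I * p.1 * p.2 (n : V)) *
    Complex.exp (2 * Real.pi * Complex.I * deg n)

/-- The domain `H × M_ℂ`. -/
def upperDomain (V : Type u) [NormedAddCommGroup V] [NormedSpace ℝ V] :
    Set (ℂ × (V →L[ℝ] ℂ)) := {p | 0 < p.1.im}

/-- The points of `H × M_ℂ` where the series over the lattice points of `C` converges
absolutely. -/
def convergenceDomain (deg : N → ℂ) (C : PointedCone ℝ V) : Set (ℂ × (V →L[ℝ] ℂ)) :=
  {p | p ∈ upperDomain V ∧ Summable fun n : {n : N // (n : V) ∈ C} => coneTerm deg p n.1}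

/-- `a` is the value at `p` of an analytic continuation of the series
`∑_{n ∈ C ∩ N} q^(m·n) e^(2πi deg n)` to a connected open subset of `H × M_ℂ` that contains `p` and
all points of absolute convergence. -/
def HasConeValue (deg : N → ℂ) (C : PointedCone ℝ V) (p : ℂ × (V →L[ℝ] ℂ)) (a : ℂ) : Prop :=
  ∃ (U : Set (ℂ × (V →L[ℝ] ℂ))) (f : ℂ × (V →L[ℝ] ℂ) → ℂ),
    IsOpen U ∧ IsPreconnected U ∧ U ⊆ upperDomain V ∧ convergenceDomain deg C ⊆ U ∧ p ∈ U ∧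
    AnalyticOnNhd ℂ f U ∧
    (∀ s ∈ convergenceDomain deg C,
      f s = ∑' n : {n : N // (n : V) ∈ C}, coneTerm deg s n.1) ∧
    f p = a

open Classical in
/-- The value `f_C(q, m)` of the analytically continued cone sum at `p = (τ, m)`. -/
def coneSum (deg : N → ℂ) (C : PointedCone ℝ V) (p : ℂ × (V →L[ℝ] ℂ)) : ℂ :=
  if h : ∃ a, HasConeValue deg C p a then h.choose else 0

/-- The alternating sum `r(q, m)` of the cone sums over the cones of the fan, at `p = (τ, m)`. -/
def alternatingConeSum (F : CompleteFan N) (deg : N → ℂ) (p : ℂ × (V →L[ℝ] ℂ)) : ℂ :=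
  ∑ C ∈ F.cones, (-1) ^ coneCodim C * coneSum deg C p

end ToricForms

end

noncomputable section

namespace ToricForms

/-! ### Finitely generated convex cones: Carathéodory's theorem and extreme rays. -/

section Cones

variable {V : Type u} [AddCommGroup V] [Module ℝ V]

/-! The denominators are cleared formally. Write e(z) for exp(2πiz) and let the Laurent polynomials
act on formal series over N. For a cone C the series of e(deg n) y^n over n in C becomes a Laurent
polynomial P_C after multiplication by Q_C, the product of 1 - e(deg d) y^d over the rays of C
(`exists_rayFactor_act_coneSeries`). Evaluated at the character n ↦ q^(m·n) this says f_C = P_C /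
Q_C wherever the series converges. The complement of the zeros of Q_C is connected, so the quotient
is a continuation, and the identity theorem makes its values unique (`hasConeValue_iff`).

The alternating sum is found coefficient by coefficient. At n it is e(deg n) times the sum of
(-1)^codim over the cones through n. That sum is 1 (`sum_neg_one_pow_coneCodim`): an open convex
neighbourhood of n is cut into cells by the relative interiors of the cones, and its Euler
characteristic with compact support is computed in two ways. So the alternating sum is the series of
e(deg n) y^n over all of N. Nothing is said about its convergence, but its product with the factors
of all rays is a Laurent polynomial T, and r(q, m) is the quotient of the values of T and of that
product (`exists_alternatingConeSum_eq`).

The coefficients of T are Euler characteristics. The Koszul complex of the variables is a graded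
free resolution of ℂ, and its tensor product with ℂ[N]^Σ has the basis y^n ⊗ e_S, where n and deg n
are increased by the sums of d and deg d over S. Expanding the product of the ray factors over
subsets S gives the same terms with the same signs: the coefficient of T at n is the sum over c of
e(c) times the Euler characteristic in degree (n, c) (`rayFactor_act_eq_sum_eulerChar`). Passing to
homology does not change it (`sum_finrank_torGrading`). Since ℂ[N]^Σ is finite over the Noetherian
ring R and the variables act as zero on Tor, Tor is finite-dimensional (`finite_tor`), so only
finitely many degrees matter and the sum over them is the alternating trace (`finsum_torTrace`).

The grading of Tor does not depend on the resolution, because the degree zero part of a comparison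
map of graded resolutions is again a comparison map (`torGrading_eq`). -/

theorem mem_hull_finset {T : Finset V} {x : V} :
    x ∈ PointedCone.hull ℝ (T : Set V) ↔
      ∃ a : V → ℝ, (∀ t ∈ T, 0 ≤ a t) ∧ ∑ t ∈ T, a t • t = x := by
  constructor
  · intro hx
    obtain ⟨f, -, hf⟩ := Submodule.mem_span_finset.1 hx
    exact ⟨fun t => (f t : ℝ), fun t _ => (f t).2, by simpa [NNReal.smul_def] using hf⟩
  · rintro ⟨a, ha, rfl⟩
    exact Submodule.sum_mem _ fun t ht =>
      PointedCone.smul_mem _ (ha t ht) (PointedCone.subset_hull ht)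

theorem mem_hull_singleton {s x : V} :
    x ∈ PointedCone.hull ℝ ({s} : Set V) ↔ ∃ a : ℝ, 0 ≤ a ∧ a • s = x := by
  constructor
  · intro hx
    obtain ⟨a, ha⟩ := Submodule.mem_span_singleton.1 hx
    exact ⟨a, a.2, ha⟩
  · rintro ⟨a, ha, rfl⟩
    exact PointedCone.smul_mem _ ha (PointedCone.subset_hull rfl)

/-- Carathéodory's theorem for cones. -/
theorem exists_linearIndepOn_mem_hull (S : Finset V) {x : V}
    (hx : x ∈ PointedCone.hull ℝ (S : Set V)) :
    ∃ T ⊆ S, LinearIndepOn ℝ id (T : Set V) ∧ x ∈ PointedCone.hull ℝ (T : Set V) := by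
  classical
  induction S using Finset.strongInduction with
  | H S ih =>
    by_cases hli : LinearIndepOn ℝ id (S : Set V)
    · exact ⟨S, subset_rfl, hli, hx⟩
    suffices h : ∃ T ⊂ S, x ∈ PointedCone.hull ℝ (T : Set V) by
      obtain ⟨T, hT, hxT⟩ := h
      obtain ⟨T', h1, h2, h3⟩ := ih T hT hxT
      exact ⟨T', h1.trans hT.1, h2, h3⟩
    obtain ⟨a, ha, rfl⟩ := mem_hull_finset.1 hx
    -- A nontrivial relation, negated if necessary so that some coefficient is positive.
    have hdep : ∃ c : V → ℝ, ∑ t ∈ S, c t • t = 0 ∧ ∃ t ∈ S, 0 < c t := by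
      rw [linearIndepOn_finset_iff] at hli
      push Not at hli
      obtain ⟨c, hc, t, ht, hct⟩ := hli
      rcases lt_or_gt_of_ne hct with h | h
      · exact ⟨fun t => -c t, by simpa using hc, t, ht, by simpa using h⟩
      · exact ⟨c, hc, t, ht, h⟩
    obtain ⟨c, hc, t₁, ht₁, hct₁⟩ := hdep
    -- The smallest ratio is the largest multiple of the relation that can be subtracted with all
    -- coefficients staying nonnegative; the coefficient of `t₀` becomes zero.
    obtain ⟨t₀, ht₀, hmin⟩ := Finset.exists_min_image (S.filter fun t => 0 < c t)
      (fun t => a t / c t) ⟨t₁, by simp [ht₁, hct₁]⟩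
    rw [Finset.mem_filter] at ht₀
    have hr : 0 ≤ a t₀ / c t₀ := div_nonneg (ha _ ht₀.1) ht₀.2.le
    refine ⟨S.erase t₀, Finset.erase_ssubset ht₀.1, mem_hull_finset.2
      ⟨fun t => a t - a t₀ / c t₀ * c t, fun t ht => ?_, ?_⟩⟩
    · have htS := Finset.mem_of_mem_erase ht
      rw [sub_nonneg]
      rcases lt_or_ge 0 (c t) with h | h
      · have := hmin t (by simp [htS, h])
        rwa [le_div_iff₀ h] at this
      · exact (mul_nonpos_of_nonneg_of_nonpos hr h).trans (ha t htS)
    · have h0 : (a t₀ - a t₀ / c t₀ * c t₀) • t₀ = 0 := by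
        rw [div_mul_cancel₀ _ ht₀.2.ne', sub_self, zero_smul]
      refine (Finset.sum_erase (f := fun t => (a t - a t₀ / c t₀ * c t) • t) S h0).trans ?_
      simp only [sub_smul, mul_smul, Finset.sum_sub_distrib, ← Finset.smul_sum, hc, smul_zero,
        sub_zero]

/-- A salient finitely generated cone is generated by its extreme rays. -/
theorem exists_extreme_generators (S : Finset V)
    (hsal : ∀ x : V, x ∈ PointedCone.hull ℝ (S : Set V) → -x ∈ PointedCone.hull ℝ (S : Set V) →
      x = 0) :
    ∃ T ⊆ S, PointedCone.hull ℝ (T : Set V) = PointedCone.hull ℝ (S : Set V) ∧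
      ∀ t ∈ T, t ≠ 0 ∧
        (PointedCone.hull ℝ ({t} : Set V)).IsFaceOf (PointedCone.hull ℝ (S : Set V)) := by
  classical
  induction S using Finset.strongInduction with
  | H S ih =>
    by_cases hred : ∃ t ∈ S, t ∈ PointedCone.hull ℝ ((S.erase t : Finset V) : Set V)
    · obtain ⟨t, ht, htS⟩ := hred
      have heq : PointedCone.hull ℝ ((S.erase t : Finset V) : Set V) =
          PointedCone.hull ℝ (S : Set V) := by
        refine le_antisymm (Submodule.span_mono (by simp)) (Submodule.span_le.2 fun s hs => ?_)
        by_cases hst : s = t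
        · exact hst ▸ htS
        · exact Submodule.subset_span (by simpa [hst] using hs)
      obtain ⟨T, h1, h2, h3⟩ := ih _ (Finset.erase_ssubset ht) (by rwa [heq])
      exact ⟨T, h1.trans (Finset.erase_subset _ _), h2.trans heq, by rwa [heq] at h3⟩
    push Not at hred
    refine ⟨S, subset_rfl, rfl, fun s hs => ⟨?_, ?_, ?_⟩⟩
    · rintro rfl
      exact hred 0 hs (zero_mem _)
    · exact Submodule.span_mono (by simpa using hs)
    intro x y r hx hy hr hxy
    obtain ⟨a, ha, rfl⟩ := mem_hull_finset.1 hx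
    obtain ⟨b, hb, rfl⟩ := mem_hull_finset.1 hy
    obtain ⟨c, hc, hcs⟩ := mem_hull_singleton.1 hxy
    -- All multiples of `s` are collected on the left. A positive coefficient there would make `s`
    -- redundant; with a nonpositive one the negative of each term on the right lies in the cone
    -- too, so salience makes every term vanish.
    have key : (c - r * a s - b s) • s = ∑ t ∈ S.erase s, (r * a t + b t) • t := by
      rw [← Finset.add_sum_erase _ _ hs, ← Finset.add_sum_erase _ _ hs] at hcs
      simp only [add_smul, mul_smul, sub_smul, Finset.sum_add_distrib, ← Finset.smul_sum]
      rw [hcs, smul_add]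
      abel
    have hmem : ∀ t ∈ S.erase s, (r * a t + b t) • t ∈ PointedCone.hull ℝ (S : Set V) := by
      intro t ht
      have htS := Finset.mem_of_mem_erase ht
      have := ha t htS
      have := hb t htS
      exact PointedCone.smul_mem _ (by positivity) (PointedCone.subset_hull htS)
    have hle : c - r * a s - b s ≤ 0 := by
      by_contra! hpos
      refine hred s hs (mem_hull_finset.2 ⟨fun t => (c - r * a s - b s)⁻¹ * (r * a t + b t),
        fun t ht => ?_, ?_⟩)
      · have htS := Finset.mem_of_mem_erase ht
        have := ha t htS
        have := hb t htS
        positivity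
      · simp only [mul_smul, ← Finset.smul_sum]
        rw [← key, smul_smul, inv_mul_cancel₀ hpos.ne', one_smul]
    have hzero : ∀ t ∈ S.erase s, (r * a t + b t) • t = 0 := by
      intro t ht
      refine hsal _ (hmem t ht) ?_
      have : -((r * a t + b t) • t) = (-(c - r * a s - b s)) • s +
          ∑ t' ∈ (S.erase s).erase t, (r * a t' + b t') • t' := by
        rw [neg_smul, key, ← Finset.add_sum_erase _ _ ht]
        abel
      rw [this]
      exact add_mem (PointedCone.smul_mem _ (by linarith) (PointedCone.subset_hull hs))
        (Submodule.sum_mem _ fun t' ht' => hmem t' (Finset.mem_of_mem_erase ht'))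
    refine mem_hull_singleton.2 ⟨a s, ha s hs, ?_⟩
    rw [← Finset.add_sum_erase _ _ hs, Finset.sum_eq_zero, add_zero]
    intro t ht
    have htS := Finset.mem_of_mem_erase ht
    have h0 : t ≠ 0 := by
      rintro rfl
      exact hred 0 htS (zero_mem _)
    have h1 := (smul_eq_zero.1 (hzero t ht)).resolve_right h0
    have h2 := ha t htS
    have h3 := hb t htS
    have h4 : r * a t = 0 := by nlinarith [mul_nonneg hr.le h2]
    rw [(mul_eq_zero.1 h4).resolve_left hr.ne', zero_smul]

end Cones

/-! ### Lattice points on a ray. -/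

section Lattice

variable {V : Type u} [NormedAddCommGroup V] [NormedSpace ℝ V] [FiniteDimensional ℝ V]
variable {N : Submodule ℤ V} [DiscreteTopology N]

theorem finite_lattice_inter_closedBall (r : ℝ) : {n : N | ‖(n : V)‖ ≤ r}.Finite := by
  have hcl : IsClosed (N : Set V) := by
    have : DiscreteTopology N.toAddSubgroup := ‹DiscreteTopology N›
    exact AddSubgroup.isClosed_of_discrete (H := N.toAddSubgroup)
  have h : ((N : Set V) ∩ Metric.closedBall 0 r).Finite := by
    have : DiscreteTopology (N : Set V) := ‹DiscreteTopology N›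
    rw [Set.inter_comm]
    exact Metric.finite_isBounded_inter_isClosed (isDiscrete_iff_discreteTopology.2 this)
      Metric.isBounded_closedBall hcl
  refine Set.Finite.of_finite_image (f := Subtype.val) (h.subset ?_) Subtype.val_injective.injOn
  rintro _ ⟨n, hn, rfl⟩
  exact ⟨n.2, by simpa using hn⟩

/-- By discreteness the ray has a shortest nonzero lattice vector `d`. Subtracting the integral part
of the multiple of `d` from another lattice point of the ray leaves a lattice vector shorter than
`d`, hence zero. -/
theorem exists_primitive_generator {s : N} (hs : s ≠ 0) :
    ∃ d : N, d ≠ 0 ∧ (∃ k : ℕ, s = k • d) ∧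
      (d : V) ∈ PointedCone.hull ℝ ({(s : V)} : Set V) ∧
      ∀ n : N, (n : V) ∈ PointedCone.hull ℝ ({(s : V)} : Set V) → ∃ k : ℕ, n = k • d := by
  have hs' : (s : V) ≠ 0 := by simpa using hs
  have hfin : {n : N | n ≠ 0 ∧ (n : V) ∈ PointedCone.hull ℝ ({(s : V)} : Set V) ∧
      ‖(n : V)‖ ≤ ‖(s : V)‖}.Finite :=
    (finite_lattice_inter_closedBall ‖(s : V)‖).subset fun n hn => hn.2.2
  obtain ⟨d, ⟨hd0, hdm, hdn⟩, hmin⟩ := hfin.exists_minimalFor (fun n : N => ‖(n : V)‖) _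
    ⟨s, hs, PointedCone.subset_hull rfl, le_rfl⟩
  obtain ⟨a, ha, had⟩ := mem_hull_singleton.1 hdm
  have hd0' : (d : V) ≠ 0 := by simpa using hd0
  have ha0 : 0 < a := lt_of_le_of_ne ha fun h => hd0' (by rw [← had, ← h, zero_smul])
  have hgen : ∀ n : N, (n : V) ∈ PointedCone.hull ℝ ({(s : V)} : Set V) → ∃ k : ℕ, n = k • d := by
    intro n hn
    obtain ⟨b, hb, hbn⟩ := mem_hull_singleton.1 hn
    have hbn' : (n : V) = (b / a) • (d : V) := by
      rw [← had, smul_smul, div_mul_cancel₀ _ ha0.ne', hbn]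
    have hba : 0 ≤ b / a := by positivity
    refine ⟨⌊b / a⌋₊, ?_⟩
    by_contra hne
    set n' : N := n - ⌊b / a⌋₊ • d with hn'
    have hn'V : (n' : V) = (b / a - ⌊b / a⌋₊) • (d : V) := by
      rw [hn', sub_smul, ← hbn', Nat.cast_smul_eq_nsmul]
      simp
    have h1 : 0 ≤ b / a - ⌊b / a⌋₊ := sub_nonneg.2 (Nat.floor_le hba)
    have h2 : b / a - ⌊b / a⌋₊ < 1 := by linarith [Nat.lt_floor_add_one (b / a)]
    have hlt : ‖(n' : V)‖ < ‖(d : V)‖ := by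
      rw [hn'V, norm_smul, Real.norm_of_nonneg h1]
      exact mul_lt_of_lt_one_left (norm_pos_iff.2 hd0') h2
    have := hmin (j := n') ⟨sub_ne_zero.2 hne, by
      rw [hn'V]; exact PointedCone.smul_mem _ h1 hdm, hlt.le.trans hdn⟩ hlt.le
    exact absurd hlt (not_lt.2 this)
  exact ⟨d, hd0, hgen s (PointedCone.subset_hull rfl), hdm, hgen⟩

end Lattice

/-! ### The rays of a cone of the fan, and its lattice points. -/

namespace CompleteFan

variable {V : Type u} [NormedAddCommGroup V] [NormedSpace ℝ V]
variable {N : Submodule ℤ V} (F : CompleteFan N)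

/-- The set of primitive generators of the rays, as a finset. -/
def rays : Finset N := F.rayGens_finite.toFinset

@[simp] theorem mem_rays {d : N} : d ∈ F.rays ↔ d ∈ F.rayGens := by simp [rays]

/-- The primitive generators of the rays of a cone. -/
def raysIn (C : PointedCone ℝ V) : Finset N := by
  classical exact F.rays.filter fun d => (d : V) ∈ C

theorem mem_raysIn {C : PointedCone ℝ V} {d : N} :
    d ∈ F.raysIn C ↔ d ∈ F.rayGens ∧ (d : V) ∈ C := by simp [raysIn]

theorem raysIn_subset (C : PointedCone ℝ V) : F.raysIn C ⊆ F.rays := fun _ hd =>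
  F.mem_rays.2 (F.mem_raysIn.1 hd).1

theorem ne_zero_of_mem_rayGens {d : N} (hd : d ∈ F.rayGens) : d ≠ 0 := by
  rintro rfl
  obtain ⟨C, hC, h1, -, h⟩ := hd
  obtain ⟨S, -, hSN, rfl⟩ := F.rational C hC
  have hS : S ⊆ {0} := by
    intro s hs
    obtain ⟨k, hk⟩ := h ⟨s, hSN hs⟩ (Submodule.subset_span hs)
    simpa using congrArg Subtype.val hk
  have hbot : PointedCone.hull ℝ S = ⊥ := Submodule.span_eq_bot.2 fun x hx => by simpa using hS hx
  rw [coneDim, hbot] at h1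
  have h0 : Submodule.span ℝ (((⊥ : PointedCone ℝ V)) : Set V) = ⊥ :=
    Submodule.span_eq_bot.2 fun x hx => hx
  rw [h0, finrank_bot] at h1
  exact zero_ne_one h1

/-- Salience keeps the origin out of the convex hull of the ray generators, so a functional
separates the two strictly. It is used to find parameters at which the cone series converges. -/
theorem exists_pos_on_rays {C : PointedCone ℝ V} (hC : C ∈ F.cones) :
    ∃ s : V →L[ℝ] ℝ, ∀ d ∈ F.raysIn C, 0 < s d := by
  classical
  set T : Finset V := (F.raysIn C).image (↑) with hT
  have h0 : (0 : V) ∉ convexHull ℝ (T : Set V) := by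
    intro h
    rw [Finset.mem_convexHull'] at h
    obtain ⟨w, hw0, hw1, hw⟩ := h
    have hTC : ∀ t ∈ T, t ∈ C ∧ t ≠ 0 := by
      intro t ht
      obtain ⟨d, hd, rfl⟩ := Finset.mem_image.1 ht
      exact ⟨(F.mem_raysIn.1 hd).2, by simpa using F.ne_zero_of_mem_rayGens (F.mem_raysIn.1 hd).1⟩
    have hz : ∀ t ∈ T, w t = 0 := by
      intro t ht
      have hm : ∀ t ∈ T, w t • t ∈ C := fun t ht =>
        PointedCone.smul_mem _ (hw0 t ht) (hTC t ht).1
      have := F.salient C hC (w t • t) (hm t ht) (by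
        rw [← Finset.add_sum_erase _ _ ht] at hw
        rw [neg_eq_of_add_eq_zero_right hw]
        exact Submodule.sum_mem _ fun t' ht' => hm t' (Finset.mem_of_mem_erase ht'))
      exact (smul_eq_zero.1 this).resolve_right (hTC t ht).2
    rw [Finset.sum_eq_zero hz] at hw1
    exact zero_ne_one hw1
  obtain ⟨f, r, h1, h2⟩ := geometric_hahn_banach_point_closed (convex_convexHull ℝ (T : Set V))
    (T.finite_toSet.isCompact_convexHull (𝕜 := ℝ)).isClosed h0
  refine ⟨f, fun d hd => ?_⟩
  have := h2 d (subset_convexHull ℝ _ (by simpa [hT] using hd))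
  simp only [map_zero] at h1
  linarith

section Discrete

variable [FiniteDimensional ℝ V] [DiscreteTopology N]

/-- The extreme rays of `C` are faces, hence cones of the fan, so each contributes its primitive
generator to D. -/
theorem exists_rays_generate {C : PointedCone ℝ V} (hC : C ∈ F.cones) :
    PointedCone.hull ℝ ((↑) '' (F.raysIn C : Set N) : Set V) = C := by
  refine le_antisymm (Submodule.span_le.2 ?_) ?_
  · rintro _ ⟨d, hd, rfl⟩
    exact (F.mem_raysIn.1 hd).2
  obtain ⟨S, hS, hSN, hCS⟩ := F.rational C hC
  lift S to Finset V using hS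
  subst hCS
  obtain ⟨T, hTS, hT, hface⟩ := exists_extreme_generators S (F.salient _ hC)
  rw [← hT]
  refine Submodule.span_le.2 fun t ht => ?_
  obtain ⟨ht0, htf⟩ := hface t ht
  have hE := F.face_mem _ hC _ htf
  obtain ⟨d, hd0, ⟨k, hk⟩, hd, hgen⟩ := exists_primitive_generator (N := N)
    (s := ⟨t, hSN (hTS ht)⟩) (by simpa [Subtype.ext_iff] using ht0)
  have hdim : coneDim (PointedCone.hull ℝ ({t} : Set V)) = 1 := by
    have : Submodule.span ℝ ((PointedCone.hull ℝ ({t} : Set V) : PointedCone ℝ V) : Set V) =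
        Submodule.span ℝ {t} := by
      refine le_antisymm (Submodule.span_le.2 ?_) (Submodule.span_mono PointedCone.subset_hull)
      exact PointedCone.hull_le_span (R := ℝ) {t}
    rw [coneDim, this, finrank_span_singleton ht0]
  have hdm : d ∈ F.raysIn (PointedCone.hull ℝ (S : Set V)) :=
    F.mem_raysIn.2 ⟨⟨_, hE, hdim, hd, hgen⟩, htf.le hd⟩
  rw [hT]
  have htk : t = (k : ℝ) • (d : V) := by
    rw [Nat.cast_smul_eq_nsmul]
    simpa using congrArg Subtype.val hk
  rw [htk]
  exact PointedCone.smul_mem _ (Nat.cast_nonneg k) (PointedCone.subset_hull ⟨d, hdm, rfl⟩)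

theorem mem_cone_iff {C : PointedCone ℝ V} (hC : C ∈ F.cones) {x : V} :
    x ∈ C ↔ ∃ a : N → ℝ, (∀ d, 0 ≤ a d) ∧ ∑ d ∈ F.raysIn C, a d • (d : V) = x := by
  constructor
  · intro hx
    rw [← F.exists_rays_generate hC] at hx
    obtain ⟨f, hf⟩ := (Submodule.mem_span_image_finset_iff_exists_fun' _).1 hx
    exact ⟨fun d => (f d : ℝ), fun d => (f d).2, by simpa [NNReal.smul_def] using hf⟩
  · rintro ⟨a, ha, rfl⟩
    exact Submodule.sum_mem _ fun d hd => PointedCone.smul_mem _ (ha d) (F.mem_raysIn.1 hd).2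

/-- Removing the integral parts of the coefficients on the rays leaves a lattice point in a bounded
region. The decomposition need not be unique when the cone is not simplicial. -/
theorem exists_finite_remainders {C : PointedCone ℝ V} (hC : C ∈ F.cones) :
    ∃ B : Finset N, (∀ b ∈ B, (b : V) ∈ C) ∧ ∀ n : N, (n : V) ∈ C →
      ∃ b ∈ B, ∃ a : N → ℕ, n = b + ∑ d ∈ F.raysIn C, a d • d := by
  have hfin : {n : N | (n : V) ∈ C ∧ ‖(n : V)‖ ≤ ∑ d ∈ F.raysIn C, ‖(d : V)‖}.Finite :=
    (finite_lattice_inter_closedBall _).subset fun n hn => hn.2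
  refine ⟨hfin.toFinset, fun b hb => ((Set.Finite.mem_toFinset _).1 hb).1, fun n hn => ?_⟩
  obtain ⟨c, hc, hcn⟩ := (F.mem_cone_iff hC).1 hn
  have hV : ((n - ∑ d ∈ F.raysIn C, ⌊c d⌋₊ • d : N) : V) =
      ∑ d ∈ F.raysIn C, (c d - ⌊c d⌋₊) • (d : V) := by
    simp [sub_smul, hcn, Nat.cast_smul_eq_nsmul]
  have h0 : ∀ d, 0 ≤ c d - ⌊c d⌋₊ := fun d => sub_nonneg.2 (Nat.floor_le (hc d))
  refine ⟨n - ∑ d ∈ F.raysIn C, ⌊c d⌋₊ • d, ?_, fun d => ⌊c d⌋₊, by abel⟩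
  rw [Set.Finite.mem_toFinset]
  refine ⟨(F.mem_cone_iff hC).2 ⟨_, h0, hV.symm⟩, ?_⟩
  rw [hV]
  refine (norm_sum_le _ _).trans (Finset.sum_le_sum fun d _ => ?_)
  rw [norm_smul, Real.norm_of_nonneg (h0 d)]
  exact mul_le_of_le_one_left (norm_nonneg _) (by linarith [Nat.lt_floor_add_one (c d)])

end Discrete

end CompleteFan

/-! ### The Euler characteristic with compact support of relatively open convex sets. -/

section EulerCharacteristic

variable {V : Type u} [AddCommGroup V] [Module ℝ V]

/-- `f` is a relatively open convex set, with directions `W`. -/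
structure IsRelOpen (W : Submodule ℝ V) (f : Set V) : Prop where
  convex : Convex ℝ f
  sub_mem : ∀ x ∈ f, ∀ y ∈ f, y - x ∈ W
  exists_add_smul_mem : ∀ x ∈ f, ∀ w ∈ W, ∃ ε : ℝ, 0 < ε ∧ x + ε • w ∈ f

namespace IsRelOpen

variable {W W' : Submodule ℝ V} {f g : Set V}

theorem exists_forall_add_smul_mem (h : IsRelOpen W f) {x w : V} (hx : x ∈ f) (hw : w ∈ W) :
    ∃ ε : ℝ, 0 < ε ∧ ∀ t : ℝ, 0 < t → t ≤ ε → x + t • w ∈ f := by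
  obtain ⟨ε, hε, hm⟩ := h.exists_add_smul_mem x hx w hw
  refine ⟨ε, hε, fun t ht htε => ?_⟩
  have := h.convex.add_smul_mem hx hm (t := t / ε) ⟨by positivity, (div_le_one hε).2 htε⟩
  rwa [smul_smul, div_mul_cancel₀ _ hε.ne'] at this

theorem inter (h : IsRelOpen W f) (h' : IsRelOpen W' g) : IsRelOpen (W ⊓ W') (f ∩ g) where
  convex := h.convex.inter h'.convex
  sub_mem x hx y hy := ⟨h.sub_mem x hx.1 y hy.1, h'.sub_mem x hx.2 y hy.2⟩
  exists_add_smul_mem x hx w hw := by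
    obtain ⟨ε, hε, h1⟩ := h.exists_forall_add_smul_mem hx.1 hw.1
    obtain ⟨ε', hε', h2⟩ := h'.exists_forall_add_smul_mem hx.2 hw.2
    exact ⟨min ε ε', lt_min hε hε', h1 _ (lt_min hε hε') (min_le_left _ _),
      h2 _ (lt_min hε hε') (min_le_right _ _)⟩

theorem univ : IsRelOpen (⊤ : Submodule ℝ V) Set.univ :=
  ⟨convex_univ, fun _ _ _ _ => trivial, fun _ _ _ _ => ⟨1, one_pos, trivial⟩⟩

theorem pos (ℓ : V →ₗ[ℝ] ℝ) : IsRelOpen (⊤ : Submodule ℝ V) {x | 0 < ℓ x} where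
  convex := (convex_Ioi (0 : ℝ)).linear_preimage ℓ
  sub_mem _ _ _ _ := trivial
  exists_add_smul_mem x hx w _ := by
    have hx' : 0 < ℓ x := hx
    have hp : 0 < |ℓ w| + 1 := by positivity
    refine ⟨ℓ x / (|ℓ w| + 1), by positivity, ?_⟩
    have h2 : ℓ x / (|ℓ w| + 1) * (|ℓ w| + 1) = ℓ x := div_mul_cancel₀ _ hp.ne'
    have h3 : 0 < ℓ x / (|ℓ w| + 1) := by positivity
    have h4 := neg_abs_le (ℓ w)
    simp only [Set.mem_ofPred_eq, map_add, map_smul, smul_eq_mul]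
    nlinarith

theorem zero (ℓ : V →ₗ[ℝ] ℝ) : IsRelOpen (LinearMap.ker ℓ) {x | ℓ x = 0} where
  convex := (convex_singleton (0 : ℝ)).linear_preimage ℓ
  sub_mem x hx y hy := by
    simp only [Set.mem_ofPred_eq] at hx hy
    simp [hx, hy]
  exists_add_smul_mem x hx w hw := by
    refine ⟨1, one_pos, ?_⟩
    simp only [Set.mem_ofPred_eq, LinearMap.mem_ker] at hx hw
    simp [hx, hw]

theorem inter_pos (h : IsRelOpen W f) (ℓ : V →ₗ[ℝ] ℝ) : IsRelOpen W (f ∩ {x | 0 < ℓ x}) := by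
  simpa using h.inter (pos ℓ)

theorem inter_neg (h : IsRelOpen W f) (ℓ : V →ₗ[ℝ] ℝ) : IsRelOpen W (f ∩ {x | ℓ x < 0}) := by
  simpa using h.inter_pos (-ℓ)

theorem inter_zero (h : IsRelOpen W f) (ℓ : V →ₗ[ℝ] ℝ) :
    IsRelOpen (W ⊓ LinearMap.ker ℓ) (f ∩ {x | ℓ x = 0}) := h.inter (zero ℓ)

theorem directions_le (h : IsRelOpen W f) (h' : IsRelOpen W' f) (hf : f.Nonempty) : W ≤ W' := by
  obtain ⟨x, hx⟩ := hf
  intro w hw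
  obtain ⟨ε, hε, hm⟩ := h.exists_add_smul_mem x hx w hw
  have := h'.sub_mem x hx _ hm
  rw [add_sub_cancel_left] at this
  exact (Submodule.smul_mem_iff _ hε.ne').1 this

theorem directions_eq (h : IsRelOpen W f) (h' : IsRelOpen W' f) (hf : f.Nonempty) : W = W' :=
  le_antisymm (h.directions_le h' hf) (h'.directions_le h hf)

end IsRelOpen

open Classical in
/-- The Euler characteristic with compact support of a relatively open convex set. -/
def cellEuler (W : Submodule ℝ V) (f : Set V) : ℤ :=
  if f.Nonempty then (-1) ^ Module.finrank ℝ W else 0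

theorem cellEuler_of_nonempty {W : Submodule ℝ V} {f : Set V} (h : f.Nonempty) :
    cellEuler W f = (-1) ^ Module.finrank ℝ W := if_pos h

theorem cellEuler_empty (W : Submodule ℝ V) : cellEuler W ∅ = 0 := if_neg (by simp)

theorem finrank_inf_ker [FiniteDimensional ℝ V] (W : Submodule ℝ V) (ℓ : V →ₗ[ℝ] ℝ)
    (h : ¬ W ≤ LinearMap.ker ℓ) :
    Module.finrank ℝ W = Module.finrank ℝ (W ⊓ LinearMap.ker ℓ : Submodule ℝ V) + 1 := by
  have hr := LinearMap.finrank_range_add_finrank_ker (ℓ.domRestrict W)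
  have hker : Module.finrank ℝ (LinearMap.ker (ℓ.domRestrict W)) =
      Module.finrank ℝ (W ⊓ LinearMap.ker ℓ : Submodule ℝ V) := by
    rw [LinearMap.ker_domRestrict, ← Submodule.map_comap_subtype]
    exact (Submodule.equivMapOfInjective _ W.subtype_injective _).finrank_eq
  have hsurj : LinearMap.range (ℓ.domRestrict W) = ⊤ := by
    rw [LinearMap.range_eq_top]
    refine LinearMap.surjective_iff_ne_zero.2 fun h0 => h fun w hw => ?_
    exact congrArg (fun g => g ⟨w, hw⟩) h0
  rw [hsurj, finrank_top, Module.finrank_self, hker] at hr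
  omega

/-- If `ℓ` is nonconstant on `f` with a zero there, it cuts `f`, of dimension k, into two cells of
dimension k and one of dimension k - 1, and 2(-1)^k + (-1)^(k-1) = (-1)^k. If it is constant or has
no zero on a nonempty `f`, exactly one piece is nonempty, and that piece is `f`. -/
theorem cellEuler_split [FiniteDimensional ℝ V] {W : Submodule ℝ V} {f : Set V}
    (h : IsRelOpen W f) (ℓ : V →ₗ[ℝ] ℝ) :
    cellEuler W f = cellEuler W (f ∩ {x | 0 < ℓ x}) +
      cellEuler (W ⊓ LinearMap.ker ℓ) (f ∩ {x | ℓ x = 0}) + cellEuler W (f ∩ {x | ℓ x < 0}) := by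
  rcases f.eq_empty_or_nonempty with rfl | ⟨x, hx⟩
  · simp [cellEuler_empty]
  by_cases hW : W ≤ LinearMap.ker ℓ
  · have hconst : ∀ y ∈ f, ℓ y = ℓ x := by
      intro y hy
      have := hW (h.sub_mem x hx y hy)
      rwa [LinearMap.mem_ker, map_sub, sub_eq_zero] at this
    rw [inf_eq_left.2 hW]
    rcases lt_trichotomy (ℓ x) 0 with h0 | h0 | h0
    · rw [show f ∩ {x | 0 < ℓ x} = ∅ from Set.eq_empty_of_forall_notMem fun y hy => by
          have := hconst y hy.1; have := hy.2; simp only [Set.mem_ofPred_eq] at this; linarith,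
        show f ∩ {x | ℓ x = 0} = ∅ from Set.eq_empty_of_forall_notMem fun y hy => by
          have := hconst y hy.1; have := hy.2; simp only [Set.mem_ofPred_eq] at this; linarith,
        show f ∩ {x | ℓ x < 0} = f from Set.inter_eq_left.2 fun y hy => by
          simp only [Set.mem_ofPred_eq, hconst y hy, h0]]
      simp [cellEuler_empty]
    · rw [show f ∩ {x | 0 < ℓ x} = ∅ from Set.eq_empty_of_forall_notMem fun y hy => by
          have := hconst y hy.1; have := hy.2; simp only [Set.mem_ofPred_eq] at this; linarith,
        show f ∩ {x | ℓ x < 0} = ∅ from Set.eq_empty_of_forall_notMem fun y hy => by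
          have := hconst y hy.1; have := hy.2; simp only [Set.mem_ofPred_eq] at this; linarith,
        show f ∩ {x | ℓ x = 0} = f from Set.inter_eq_left.2 fun y hy => by
          simp only [Set.mem_ofPred_eq, hconst y hy, h0]]
      simp [cellEuler_empty]
    · rw [show f ∩ {x | ℓ x = 0} = ∅ from Set.eq_empty_of_forall_notMem fun y hy => by
          have := hconst y hy.1; have := hy.2; simp only [Set.mem_ofPred_eq] at this; linarith,
        show f ∩ {x | ℓ x < 0} = ∅ from Set.eq_empty_of_forall_notMem fun y hy => by
          have := hconst y hy.1; have := hy.2; simp only [Set.mem_ofPred_eq] at this; linarith,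
        show f ∩ {x | 0 < ℓ x} = f from Set.inter_eq_left.2 fun y hy => by
          simp only [Set.mem_ofPred_eq, hconst y hy, h0]]
      simp [cellEuler_empty]
  obtain ⟨w, hw, hℓw⟩ : ∃ w ∈ W, 0 < ℓ w := by
    obtain ⟨w, hw, hne⟩ := SetLike.not_le_iff_exists.1 hW
    rcases lt_or_gt_of_ne (show ℓ w ≠ 0 from hne) with h0 | h0
    · exact ⟨-w, neg_mem hw, by simpa using h0⟩
    · exact ⟨w, hw, h0⟩
  have hdim := finrank_inf_ker W ℓ hW
  rw [cellEuler_of_nonempty (f := f) ⟨x, hx⟩]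
  by_cases hz : ∃ y ∈ f, ℓ y = 0
  · obtain ⟨y, hy, hy0⟩ := hz
    have hp : (f ∩ {x | 0 < ℓ x}).Nonempty := by
      obtain ⟨ε, hε, hm⟩ := h.exists_add_smul_mem y hy w hw
      exact ⟨_, hm, by simp only [Set.mem_ofPred_eq, map_add, map_smul, smul_eq_mul, hy0]; positivity⟩
    have hn : (f ∩ {x | ℓ x < 0}).Nonempty := by
      obtain ⟨ε, hε, hm⟩ := h.exists_add_smul_mem y hy (-w) (neg_mem hw)
      refine ⟨_, hm, ?_⟩
      have := mul_pos hε hℓw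
      simp only [Set.mem_ofPred_eq, map_add, map_smul, map_neg, smul_eq_mul, hy0]
      linarith
    rw [cellEuler_of_nonempty hp, cellEuler_of_nonempty hn,
      cellEuler_of_nonempty (f := f ∩ {x | ℓ x = 0}) ⟨y, hy, hy0⟩,
      hdim]
    ring
  · push Not at hz
    have hcross : ∀ a ∈ f, ∀ b ∈ f, 0 < ℓ a → ¬ ℓ b < 0 := by
      intro a ha b hb hpa hnb
      have hd : 0 < ℓ a - ℓ b := by linarith
      -- The point of the segment from `b` to `a` at which `ℓ` vanishes.
      refine hz (b + (-ℓ b / (ℓ a - ℓ b)) • (a - b)) ?_ ?_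
      · exact h.convex.add_smul_sub_mem hb ha
          ⟨div_nonneg (by linarith) hd.le, (div_le_one hd).2 (by linarith)⟩
      · simp only [map_add, map_smul, map_sub, smul_eq_mul]
        field_simp
        ring
    rw [show f ∩ {x | ℓ x = 0} = ∅ from Set.eq_empty_of_forall_notMem fun y hy => hz y hy.1 hy.2,
      cellEuler_empty]
    rcases lt_or_gt_of_ne (hz x hx) with h0 | h0
    · rw [show f ∩ {x | 0 < ℓ x} = ∅ from Set.eq_empty_of_forall_notMem fun y hy =>
        hcross y hy.1 x hx hy.2 h0, cellEuler_empty,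
        cellEuler_of_nonempty (f := f ∩ {x | ℓ x < 0}) ⟨x, hx, h0⟩]
      ring
    · rw [show f ∩ {x | ℓ x < 0} = ∅ from Set.eq_empty_of_forall_notMem fun y hy =>
        hcross x hx y hy.1 h0 hy.2, cellEuler_empty,
        cellEuler_of_nonempty (f := f ∩ {x | 0 < ℓ x}) ⟨x, hx, h0⟩]
      ring

/-- Additivity of the Euler characteristic for partitions whose cells are cut out by the signs of
finitely many linear forms. -/
theorem sum_cellEuler [FiniteDimensional ℝ V] {ι : Type*} (s : Finset ι)
    (Λ : List (V →ₗ[ℝ] ℝ)) (W : Submodule ℝ V) (f : Set V)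
    (Wi : ι → Submodule ℝ V) (fi : ι → Set V) (hf : IsRelOpen W f)
    (hfi : ∀ i ∈ s, IsRelOpen (Wi i) (fi i)) (hsub : ∀ i ∈ s, fi i ⊆ f)
    (hpart : ∀ x ∈ f, ∃! i, i ∈ s ∧ x ∈ fi i)
    (hΛ : ∀ x ∈ f, ∀ y ∈ f, (∀ ℓ ∈ Λ, SignType.sign (ℓ x) = SignType.sign (ℓ y)) →
      ∀ i ∈ s, x ∈ fi i → y ∈ fi i) :
    ∑ i ∈ s, cellEuler (Wi i) (fi i) = cellEuler W f := by
  -- Both sides are additive under cutting by the first form, and on each of the three pieces the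
  -- remaining forms suffice. With no forms left, a nonempty cell is all of `f`.
  induction Λ generalizing W f Wi fi with
  | nil =>
    rcases f.eq_empty_or_nonempty with rfl | ⟨x, hx⟩
    · rw [cellEuler_empty]
      refine Finset.sum_eq_zero fun i hi => ?_
      rw [Set.subset_empty_iff.1 (hsub i hi), cellEuler_empty]
    · obtain ⟨i, ⟨hi, hxi⟩, huniq⟩ := hpart x hx
      have hfif : fi i = f := (hsub i hi).antisymm fun y hy => hΛ x hx y hy (by simp) i hi hxi
      rw [Finset.sum_eq_single_of_mem i hi, hfif,
        IsRelOpen.directions_eq (W := Wi i) (W' := W) (f := f) (by simpa only [hfif] using hfi i hi) hf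
          ⟨x, hx⟩]
      intro j hj hji
      rw [show fi j = ∅ from Set.eq_empty_of_forall_notMem fun y hy =>
        hji (huniq j ⟨hj, hΛ y (hsub j hj hy) x hx (by simp) j hj hy⟩), cellEuler_empty]
  | cons ℓ Λ ih =>
    have key : ∀ (g : Set V) (σ : SignType), (∀ x ∈ g, SignType.sign (ℓ x) = σ) →
        (∀ x ∈ f ∩ g, ∃! i, i ∈ s ∧ x ∈ fi i ∩ g) ∧
        (∀ x ∈ f ∩ g, ∀ y ∈ f ∩ g, (∀ ℓ ∈ Λ, SignType.sign (ℓ x) = SignType.sign (ℓ y)) →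
          ∀ i ∈ s, x ∈ fi i ∩ g → y ∈ fi i ∩ g) := by
      intro g σ hg
      refine ⟨fun x hx => ?_, fun x hx y hy hxy i hi hxi => ⟨?_, hy.2⟩⟩
      · obtain ⟨i, ⟨hi, hxi⟩, hu⟩ := hpart x hx.1
        exact ⟨i, ⟨hi, hxi, hx.2⟩, fun j hj => hu j ⟨hj.1, hj.2.1⟩⟩
      · refine hΛ x hx.1 y hy.1 ?_ i hi hxi.1
        rintro ℓ' hℓ'
        rcases List.mem_cons.1 hℓ' with rfl | h'
        · rw [hg x hx.2, hg y hy.2]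
        · exact hxy ℓ' h'
    rw [cellEuler_split hf ℓ, Finset.sum_congr rfl fun i hi => cellEuler_split (hfi i hi) ℓ,
      Finset.sum_add_distrib, Finset.sum_add_distrib]
    obtain ⟨p1, p2⟩ := key {x | 0 < ℓ x} 1 fun x hx => sign_pos hx
    obtain ⟨z1, z2⟩ := key {x | ℓ x = 0} 0 fun x hx => sign_eq_zero_iff.2 hx
    obtain ⟨n1, n2⟩ := key {x | ℓ x < 0} (-1) fun x hx => sign_neg hx
    rw [ih _ _ _ _ (hf.inter_pos ℓ) (fun i hi => (hfi i hi).inter_pos ℓ)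
        (fun i hi => Set.inter_subset_inter_left _ (hsub i hi)) p1 p2,
      ih _ _ _ _ (hf.inter_zero ℓ) (fun i hi => (hfi i hi).inter_zero ℓ)
        (fun i hi => Set.inter_subset_inter_left _ (hsub i hi)) z1 z2,
      ih _ _ _ _ (hf.inter_neg ℓ) (fun i hi => (hfi i hi).inter_neg ℓ)
        (fun i hi => Set.inter_subset_inter_left _ (hsub i hi)) n1 n2]

/-- Membership in a simplicial cone is controlled by the signs of finitely many linear forms. -/
theorem exists_forms_of_linearIndepOn [FiniteDimensional ℝ V] {T : Set V}
    (hT : LinearIndepOn ℝ id T) :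
    ∃ Λ : Finset (V →ₗ[ℝ] ℝ), ∀ x y : V,
      (∀ ℓ ∈ Λ, (0 < ℓ x → 0 < ℓ y) ∧ (ℓ x < 0 → ℓ y < 0)) →
      y ∈ PointedCone.hull ℝ T → x ∈ PointedCone.hull ℝ T := by
  classical
  let b := Module.Basis.extend hT
  have : Finite (hT.extend (Set.subset_univ T)) := Module.Finite.finite_basis b
  have : Fintype (hT.extend (Set.subset_univ T)) := Fintype.ofFinite _
  -- The forms are the coordinates for a basis that extends `T`: the cone is the set where all
  -- coordinates are nonnegative and those outside `T` vanish.
  refine ⟨Finset.univ.image b.coord, fun x y hxy hy => ?_⟩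
  have hsign : ∀ i, 0 ≤ b.coord i y ∧ ((i : V) ∉ T → b.coord i y = 0) := by
    intro i
    clear hxy
    induction hy using Submodule.span_induction with
    | mem t ht =>
      have hbt : b ⟨t, hT.subset_extend _ ht⟩ = t := Module.Basis.extend_apply_self hT _
      rw [← hbt, Module.Basis.coord_apply, Module.Basis.repr_self, Finsupp.single_apply]
      split_ifs with h
      · exact ⟨zero_le_one, fun hi => absurd (h ▸ ht) hi⟩
      · exact ⟨le_rfl, fun _ => rfl⟩
    | zero => simp
    | add u v _ _ hu hv =>
      rw [map_add]
      exact ⟨add_nonneg hu.1 hv.1, fun hi => by rw [hu.2 hi, hv.2 hi, add_zero]⟩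
    | smul a u _ hu =>
      rw [show a • u = (a : ℝ) • u from rfl, map_smul, smul_eq_mul]
      exact ⟨mul_nonneg a.2 hu.1, fun hi => by rw [hu.2 hi, mul_zero]⟩
  rw [← b.sum_repr x]
  refine Submodule.sum_mem _ fun i _ => ?_
  obtain ⟨h1, h2⟩ := hxy (b.coord i) (by simp)
  obtain ⟨h3, h4⟩ := hsign i
  have h5 : 0 ≤ b.repr x i := by
    by_contra! h
    exact absurd (h2 h) (not_lt.2 h3)
  by_cases hi : (i : V) ∈ T
  · refine PointedCone.smul_mem _ h5 (PointedCone.subset_hull ?_)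
    rwa [Module.Basis.extend_apply_self]
  · have h6 : b.repr x i = 0 := by
      refine le_antisymm (not_lt.1 fun h => ?_) h5
      have := h1 h
      rw [h4 hi] at this
      exact lt_irrefl _ this
    rw [h6, zero_smul]
    exact zero_mem _

/-- Membership in the cones generated by subsets of a finite set is controlled by the signs of
finitely many linear forms. -/
theorem exists_forms_of_hull [FiniteDimensional ℝ V] (S : Finset V) :
    ∃ Λ : Finset (V →ₗ[ℝ] ℝ), ∀ T ⊆ S, ∀ x y : V,
      (∀ ℓ ∈ Λ, (0 < ℓ x → 0 < ℓ y) ∧ (ℓ x < 0 → ℓ y < 0)) →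
      y ∈ PointedCone.hull ℝ (T : Set V) → x ∈ PointedCone.hull ℝ (T : Set V) := by
  classical
  choose! Λ hΛ using fun (T : Finset V) (hT : LinearIndepOn ℝ id (T : Set V)) =>
    exists_forms_of_linearIndepOn hT
  refine ⟨S.powerset.biUnion Λ, fun T hTS x y hxy hy => ?_⟩
  -- By Carathéodory's theorem `y` lies in a simplicial subcone, so the forms of the independent
  -- subsets of `S` are enough.
  obtain ⟨T', hT', hli, hy'⟩ := exists_linearIndepOn_mem_hull T hy
  refine Submodule.span_mono (Finset.coe_subset.2 hT') (hΛ T' hli x y (fun ℓ hℓ => hxy ℓ ?_) hy')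
  exact Finset.mem_biUnion.2 ⟨T', Finset.mem_powerset.2 (hT'.trans hTS), hℓ⟩

end EulerCharacteristic

/-! ### Relative interiors of the cones and the Euler relation of the fan. -/

namespace CompleteFan

variable {V : Type u} [NormedAddCommGroup V] [NormedSpace ℝ V]
variable {N : Submodule ℤ V} (F : CompleteFan N)

/-- The points of a cone that lie in no smaller cone of the fan. -/
def relInterior (C : PointedCone ℝ V) : Set V := {x | x ∈ C ∧ ∀ E ∈ F.cones, x ∈ E → C ≤ E}

/-- The intersection of two cones of the fan is a face, hence again in the fan, so a minimal cone
through `x` lies in all others. The relative interiors therefore partition the space. -/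
theorem exists_minimal_cone (x : V) : ∃! C, C ∈ F.cones ∧ x ∈ F.relInterior C := by
  classical
  have hne : (F.cones.filter fun C => x ∈ C).Nonempty := by
    obtain ⟨C, hC, hx⟩ := F.complete x
    exact ⟨C, by simp [hC, hx]⟩
  obtain ⟨C, hCm, hmin⟩ := Finset.exists_minimal hne
  obtain ⟨hC, hxC⟩ := Finset.mem_filter.1 hCm
  have hle : ∀ E ∈ F.cones, x ∈ E → C ≤ E := by
    intro E hE hxE
    have hm : C ⊓ E ∈ F.cones := F.face_mem C hC _ (F.inter_isFaceOf C hC E hE).1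
    exact (hmin (y := C ⊓ E) (by simp [hm, hxC, hxE]) inf_le_left).trans inf_le_right
  refine ⟨C, ⟨hC, hxC, hle⟩, fun C' hC' => ?_⟩
  exact le_antisymm (hC'.2.2 C hC hxC) (hle C' hC'.1 hC'.2.1)

theorem le_of_add_mem {C E : PointedCone ℝ V} (hC : C ∈ F.cones) (hE : E ∈ F.cones) {x y : V}
    (hx : x ∈ C) (hy : y ∈ F.relInterior C) (h : x + y ∈ E) : C ≤ E := by
  refine hy.2 E hE ?_
  have hf := (F.inter_isFaceOf C hC E hE).1
  exact (hf.mem_of_add_mem_right hx hy.1 ⟨C.add_mem hx hy.1, h⟩).2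

theorem add_mem_relInterior {C : PointedCone ℝ V} (hC : C ∈ F.cones) {x y : V}
    (hx : x ∈ C) (hy : y ∈ F.relInterior C) : x + y ∈ F.relInterior C :=
  ⟨C.add_mem hx hy.1, fun _ hE h => F.le_of_add_mem hC hE hx hy h⟩

theorem smul_mem_relInterior {C : PointedCone ℝ V} {x : V} {r : ℝ} (hr : 0 < r)
    (hx : x ∈ F.relInterior C) : r • x ∈ F.relInterior C :=
  ⟨PointedCone.smul_mem _ hr.le hx.1, fun E hE h => hx.2 E hE ((PointedCone.smul_mem_iff _ hr).1 h)⟩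

/-- The vectors of `C` of which some positive multiple can be subtracted from `x` inside `C` form a
face. It contains `x`, and the only face containing a point of the relative interior is `C`. -/
theorem exists_sub_smul_mem {C : PointedCone ℝ V} (hC : C ∈ F.cones) {x y : V}
    (hx : x ∈ F.relInterior C) (hy : y ∈ C) : ∃ ε : ℝ, 0 < ε ∧ x - ε • y ∈ C := by
  let E : PointedCone ℝ V :=
    { carrier := {y | y ∈ C ∧ ∃ ε : ℝ, 0 < ε ∧ x - ε • y ∈ C}
      zero_mem' := ⟨zero_mem _, 1, one_pos, by simpa using hx.1⟩
      add_mem' := by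
        rintro y z ⟨hy, ε, hε, hyε⟩ ⟨hz, δ, hδ, hzδ⟩
        -- This step makes the new point a convex combination of `x - ε • y` and `x - δ • z`.
        refine ⟨add_mem hy hz, ε * δ / (ε + δ), by positivity, ?_⟩
        have : x - (ε * δ / (ε + δ)) • (y + z) =
            (δ / (ε + δ)) • (x - ε • y) + (ε / (ε + δ)) • (x - δ • z) := by
          have h1 : x = (δ / (ε + δ) + ε / (ε + δ)) • x := by
            rw [← add_div, add_comm δ, div_self (by positivity), one_smul]
          nth_rewrite 1 [h1]
          module
        rw [this]
        exact add_mem (PointedCone.smul_mem _ (by positivity) hyε)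
          (PointedCone.smul_mem _ (by positivity) hzδ)
      smul_mem' := by
        rintro c y ⟨hy, ε, hε, hyε⟩
        refine ⟨Submodule.smul_mem C c hy, ?_⟩
        rcases eq_or_lt_of_le c.2 with h0 | h0
        · have : c = 0 := Subtype.ext h0.symm
          exact ⟨1, one_pos, by simpa [this] using hx.1⟩
        · have h0' : 0 < (c : ℝ) := h0
          refine ⟨ε / c, by positivity, ?_⟩
          rwa [show c • y = (c : ℝ) • y from rfl, smul_smul, div_mul_cancel₀ _ h0'.ne'] }
  have hEC : E.IsFaceOf C := by
    refine PointedCone.IsFaceOf.of_mem_of_add_mem_left (fun y hy => hy.1) ?_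
    rintro y z hy hz ⟨-, ε, hε, h⟩
    refine ⟨hy, ε, hε, ?_⟩
    have : x - ε • y = (x - ε • (y + z)) + ε • z := by module
    rw [this]
    exact add_mem h (PointedCone.smul_mem _ hε.le hz)
  have hxE : x ∈ E := ⟨hx.1, 1, one_pos, by simp⟩
  exact (hx.2 E (F.face_mem C hC E hEC) hxE hy).2

theorem relInterior_isRelOpen {C : PointedCone ℝ V} (hC : C ∈ F.cones) :
    IsRelOpen (Submodule.span ℝ (C : Set V)) (F.relInterior C) where
  convex := by
    refine convex_iff_forall_pos.2 fun x hx y hy a b ha hb _ => ?_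
    exact F.add_mem_relInterior hC (PointedCone.smul_mem _ ha.le hx.1)
      (F.smul_mem_relInterior hb hy)
  sub_mem x hx y hy := sub_mem (Submodule.subset_span hy.1) (Submodule.subset_span hx.1)
  exists_add_smul_mem := by
    intro x hx w hw
    have hw' : ∃ y ∈ C, ∃ z ∈ C, w = y - z := by
      induction hw using Submodule.span_induction with
      | mem y hy => exact ⟨y, hy, 0, zero_mem _, by simp⟩
      | zero => exact ⟨0, zero_mem _, 0, zero_mem _, by simp⟩
      | add u v _ _ hu hv =>
        obtain ⟨y, hy, z, hz, rfl⟩ := hu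
        obtain ⟨y', hy', z', hz', rfl⟩ := hv
        exact ⟨y + y', add_mem hy hy', z + z', add_mem hz hz', by abel⟩
      | smul a u _ hu =>
        obtain ⟨y, hy, z, hz, rfl⟩ := hu
        rcases le_total 0 a with ha | ha
        · exact ⟨a • y, PointedCone.smul_mem _ ha hy, a • z, PointedCone.smul_mem _ ha hz,
            smul_sub _ _ _⟩
        · exact ⟨(-a) • z, PointedCone.smul_mem _ (neg_nonneg.2 ha) hz, (-a) • y,
            PointedCone.smul_mem _ (neg_nonneg.2 ha) hy, by module⟩
    obtain ⟨y, hy, z, hz, rfl⟩ := hw'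
    obtain ⟨ε, hε, hm⟩ := F.exists_sub_smul_mem hC hx hz
    -- One half of `x` absorbs the subtraction of `z`; the other half keeps the sum in the relative
    -- interior.
    refine ⟨ε / 2, by positivity, ?_⟩
    have : x + (ε / 2) • (y - z) = ((ε / 2) • y + (1 / 2 : ℝ) • (x - ε • z)) + (1 / 2 : ℝ) • x := by
      module
    rw [this]
    exact F.add_mem_relInterior hC (add_mem (PointedCone.smul_mem _ (by positivity) hy)
      (PointedCone.smul_mem _ (by norm_num) hm)) (F.smul_mem_relInterior (by norm_num) hx)

/-- The sum of the generators works: a cone of the fan containing it meets `C` in a face, which must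
contain every summand. -/
theorem relInterior_nonempty {C : PointedCone ℝ V} (hC : C ∈ F.cones) :
    (F.relInterior C).Nonempty := by
  obtain ⟨S, hS, hSN, rfl⟩ := F.rational C hC
  lift S to Finset V using hS
  have hS : ∀ s ∈ S, s ∈ PointedCone.hull ℝ (S : Set V) := fun s hs => PointedCone.subset_hull hs
  refine ⟨∑ s ∈ S, s, Submodule.sum_mem _ hS, fun E hE hm => Submodule.span_le.2 fun s hs => ?_⟩
  have hf := (F.inter_isFaceOf _ hC E hE).1
  classical
  rw [← Finset.add_sum_erase _ _ hs] at hm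
  have hr : ∑ s ∈ S.erase s, s ∈ PointedCone.hull ℝ (S : Set V) :=
    Submodule.sum_mem _ fun t ht => hS t (Finset.mem_of_mem_erase ht)
  exact (hf.mem_of_add_mem_left (hS s hs) hr ⟨add_mem (hS s hs) hr, hm⟩).2

variable [FiniteDimensional ℝ V]

/-- The Euler relation for the cones of a complete fan that contain a given point. -/
theorem sum_neg_one_pow_coneCodim (x : V) [DecidablePred fun C : PointedCone ℝ V => x ∈ C] :
    ∑ C ∈ F.cones with x ∈ C, (-1 : ℤ) ^ coneCodim C = 1 := by
  classical
  obtain ⟨Λ, hΛ⟩ : ∃ Λ : Finset (V →ₗ[ℝ] ℝ), ∀ C ∈ F.cones, ∀ x y : V,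
      (∀ ℓ ∈ Λ, (0 < ℓ x → 0 < ℓ y) ∧ (ℓ x < 0 → ℓ y < 0)) → y ∈ C → x ∈ C := by
    choose! S hS hSN hCS using F.rational
    choose! Λ hΛ using fun (T : Finset V) => exists_forms_of_hull T
    refine ⟨F.cones.attach.biUnion fun C => Λ (hS C C.2).toFinset, fun C hC x y hxy hy => ?_⟩
    rw [hCS C hC] at hy ⊢
    have := hΛ (hS C hC).toFinset _ subset_rfl x y (fun ℓ hℓ => hxy ℓ
      (Finset.mem_biUnion.2 ⟨⟨C, hC⟩, Finset.mem_attach _ _, hℓ⟩))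
    simp only [Set.Finite.coe_toFinset] at this
    exact this hy
  -- An open convex set around `x` that meets only the cones through `x`. The relative interiors of
  -- these cones cut it into cells.
  let B : Set V := {y | ∀ ℓ ∈ Λ, (0 < ℓ x → 0 < ℓ y) ∧ (ℓ x < 0 → ℓ y < 0)}
  have hxB : x ∈ B := fun ℓ _ => ⟨id, id⟩
  have hB : IsRelOpen ⊤ B := by
    have : ∀ Λ' : Finset (V →ₗ[ℝ] ℝ), IsRelOpen (⊤ : Submodule ℝ V)
        {y | ∀ ℓ ∈ Λ', (0 < ℓ x → 0 < ℓ y) ∧ (ℓ x < 0 → ℓ y < 0)} := by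
      intro Λ'
      induction Λ' using Finset.induction_on with
      | empty => simpa [Set.ofPred_true] using IsRelOpen.univ
      | insert ℓ Λ' _ ih =>
        rcases lt_trichotomy (ℓ x) 0 with h | h | h
        · convert ih.inter_neg ℓ using 1
          ext y
          simp [h, h.not_gt, and_comm]
        · convert ih using 1
          ext y
          simp [h]
        · convert ih.inter_pos ℓ using 1
          ext y
          simp [h, h.not_gt, and_comm]
    exact this Λ
  have hsum := sum_cellEuler F.cones Λ.toList ⊤ B (fun C => Submodule.span ℝ (C : Set V))
    (fun C => B ∩ F.relInterior C) hB
    (fun C hC => by simpa using hB.inter (F.relInterior_isRelOpen hC))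
    (fun C _ => Set.inter_subset_left)
    (fun y hy => by
      obtain ⟨C, ⟨hC, hyC⟩, hu⟩ := F.exists_minimal_cone y
      exact ⟨C, ⟨hC, hy, hyC⟩, fun C' hC' => hu C' ⟨hC'.1, hC'.2.2⟩⟩)
    (fun y hy z hz hyz C hC hyC => by
      have hs : ∀ ℓ ∈ Λ, SignType.sign (ℓ y) = SignType.sign (ℓ z) := by simpa using hyz
      have hiff : ∀ E ∈ F.cones, y ∈ E ↔ z ∈ E := by
        intro E hE
        refine ⟨hΛ E hE z y fun ℓ hℓ => ?_, hΛ E hE y z fun ℓ hℓ => ?_⟩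
        · rw [← sign_eq_one_iff, ← sign_eq_one_iff, ← sign_eq_neg_one_iff, ← sign_eq_neg_one_iff,
            hs ℓ hℓ]
          exact ⟨id, id⟩
        · rw [← sign_eq_one_iff, ← sign_eq_one_iff, ← sign_eq_neg_one_iff, ← sign_eq_neg_one_iff,
            hs ℓ hℓ]
          exact ⟨id, id⟩
      exact ⟨hz, (hiff C hC).1 hyC.2.1, fun E hE hzE => hyC.2.2 E hE ((hiff E hE).2 hzE)⟩)
  rw [cellEuler_of_nonempty ⟨x, hxB⟩, finrank_top] at hsum
  have hterm : ∀ C ∈ F.cones, cellEuler (Submodule.span ℝ (C : Set V)) (B ∩ F.relInterior C) =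
      if x ∈ C then (-1) ^ coneDim C else 0 := by
    intro C hC
    split_ifs with hxC
    · refine cellEuler_of_nonempty ?_
      obtain ⟨y, hy⟩ := F.relInterior_nonempty hC
      obtain ⟨ε, hε, hm⟩ := hB.exists_add_smul_mem x hxB y trivial
      exact ⟨_, hm, F.add_mem_relInterior hC hxC (F.smul_mem_relInterior hε hy)⟩
    · rw [show B ∩ F.relInterior C = ∅ from Set.eq_empty_of_forall_notMem fun y hy =>
        hxC (hΛ C hC x y hy.1 hy.2.1), cellEuler_empty]
  rw [Finset.sum_congr rfl hterm, ← Finset.sum_filter] at hsum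
  -- Dimensions turn into codimensions at the cost of the sign of the whole space, which is also the
  -- Euler characteristic of `B`; the two signs cancel.
  have hcodim : ∀ C : PointedCone ℝ V, (-1 : ℤ) ^ coneCodim C =
      (-1) ^ Module.finrank ℝ V * (-1) ^ coneDim C := by
    intro C
    have hle : coneDim C ≤ Module.finrank ℝ V := Submodule.finrank_le _
    rw [coneCodim, ← pow_add]
    refine neg_one_pow_congr ?_
    simp only [Nat.even_sub hle, Nat.even_add]
  simp only [hcodim, ← Finset.mul_sum]
  rw [hsum, ← mul_pow]
  simp

end CompleteFan

/-! ### Formal series as a module over Laurent polynomials. -/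

section FormalSeries

variable {G : Type u} [AddCommGroup G]

/-- Translation of a formal series by a group element. -/
def seriesShift (g : G) : Module.End ℂ (G → ℂ) where
  toFun φ n := φ (n - g)
  map_add' _ _ := rfl
  map_smul' _ _ := rfl

/-- The action of Laurent polynomials on formal series by multiplication. -/
def seriesAct : AddMonoidAlgebra ℂ G →ₐ[ℂ] Module.End ℂ (G → ℂ) :=
  AddMonoidAlgebra.lift ℂ (Module.End ℂ (G → ℂ)) G
    { toFun := fun g => seriesShift g.toAdd
      map_one' := by ext φ n; simp [seriesShift]
      map_mul' := fun g h => by ext φ n; simp [seriesShift, sub_sub] }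

theorem seriesAct_single (g : G) (c : ℂ) (φ : G → ℂ) (n : G) :
    seriesAct (AddMonoidAlgebra.single g c) φ n = c * φ (n - g) := by
  simp [seriesAct, seriesShift]

theorem seriesAct_coeff (p r : AddMonoidAlgebra ℂ G) :
    seriesAct p (fun n => r.coeff n) = fun n => (p * r).coeff n := by
  induction p using AddMonoidAlgebra.induction_linear with
  | zero => ext n; simp
  | add p p' hp hp' => ext n; simp [hp, hp', add_mul]
  | single g c =>
    ext n
    rw [seriesAct_single, AddMonoidAlgebra.coeff_single_mul_apply, neg_add_eq_sub]

/-- Evaluation of Laurent polynomials at a character. -/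
def evalChar (χ : Multiplicative G →* ℂ) : AddMonoidAlgebra ℂ G →ₐ[ℂ] ℂ :=
  AddMonoidAlgebra.lift ℂ ℂ G χ

theorem evalChar_single (χ : Multiplicative G →* ℂ) (g : G) (c : ℂ) :
    evalChar χ (AddMonoidAlgebra.single g c) = c * χ (Multiplicative.ofAdd g) := by
  simp [evalChar]

theorem evalChar_eq_sum (χ : Multiplicative G →* ℂ) (p : AddMonoidAlgebra ℂ G) (s : Finset G)
    (hs : ∀ n ∉ s, p.coeff n = 0) :
    evalChar χ p = ∑ n ∈ s, p.coeff n * χ (Multiplicative.ofAdd n) := by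
  rw [evalChar, AddMonoidAlgebra.lift_apply, Finsupp.sum]
  simp only [smul_eq_mul]
  refine Finset.sum_subset (fun n hn => ?_) (fun n _ hn => by simp [Finsupp.notMem_support_iff.1 hn])
  by_contra h
  exact Finsupp.mem_support_iff.1 hn (hs n h)

/-- A monomial shifts the series; reindexing the sum gives back the value of the character at the
shift as a factor. -/
theorem hasSum_seriesAct (χ : Multiplicative G →* ℂ) (p : AddMonoidAlgebra ℂ G) {φ : G → ℂ} {s : ℂ}
    (h : HasSum (fun n => φ n * χ (Multiplicative.ofAdd n)) s) :
    HasSum (fun n => seriesAct p φ n * χ (Multiplicative.ofAdd n)) (evalChar χ p * s) := by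
  induction p using AddMonoidAlgebra.induction_linear with
  | zero => simp
  | add p p' hp hp' => simpa [add_mul] using hp.add hp'
  | single g c =>
    rw [evalChar_single]
    have h' := ((Equiv.subRight g).hasSum_iff.2 h).mul_left (c * χ (Multiplicative.ofAdd g))
    rw [HasSum] at h' ⊢
    refine h'.congr fun t => Finset.sum_congr rfl fun n _ => ?_
    have hn : χ (Multiplicative.ofAdd n) =
        χ (Multiplicative.ofAdd g) * χ (Multiplicative.ofAdd (n - g)) := by
      rw [← map_mul, ← ofAdd_add, add_sub_cancel]
    rw [seriesAct_single, hn]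
    simp only [Function.comp_apply, Equiv.subRight_apply]
    ring

/-- Here a formal identity becomes numerical: wherever the series converges, its sum is governed by
the values of two Laurent polynomials. -/
theorem evalChar_mul_eq {χ : Multiplicative G →* ℂ} {p r : AddMonoidAlgebra ℂ G} {φ : G → ℂ}
    {s : ℂ} (h : HasSum (fun n => φ n * χ (Multiplicative.ofAdd n)) s)
    (hp : seriesAct p φ = fun n => r.coeff n) : evalChar χ p * s = evalChar χ r := by
  have h1 := hasSum_seriesAct χ p h
  rw [hp] at h1
  rw [evalChar_eq_sum χ r r.coeff.support fun n hn => Finsupp.notMem_support_iff.1 hn]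
  exact h1.unique (hasSum_sum_of_ne_finset_zero fun n hn => by
    simp [Finsupp.notMem_support_iff.1 hn])

/-- The product `∏_{d ∈ S} (1 - c_d y^d)`. -/
def koszulFactor (c : G → ℂ) (S : Finset G) : AddMonoidAlgebra ℂ G :=
  ∏ d ∈ S, (1 - AddMonoidAlgebra.single d (c d))

theorem koszulFactor_eq_sum (c : G → ℂ) (S : Finset G) :
    koszulFactor c S = ∑ T ∈ S.powerset,
      AddMonoidAlgebra.single (∑ d ∈ T, d) ((-1) ^ T.card * ∏ d ∈ T, c d) := by
  classical
  have h1 : ∀ T : Finset G, ∏ d ∈ T, AddMonoidAlgebra.single d (-c d) =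
      AddMonoidAlgebra.single (∑ d ∈ T, d) ((-1) ^ T.card * ∏ d ∈ T, c d) := by
    intro T
    induction T using Finset.induction_on with
    | empty => simp [AddMonoidAlgebra.one_def]
    | insert d T hd ih =>
      rw [Finset.prod_insert hd, ih, AddMonoidAlgebra.single_mul_single, Finset.sum_insert hd,
        Finset.card_insert_of_notMem hd, Finset.prod_insert hd]
      congr 1
      ring
  simp only [koszulFactor, sub_eq_add_neg, ← AddMonoidAlgebra.single_neg]
  rw [Finset.prod_one_add]
  exact Finset.sum_congr rfl fun T _ => h1 T

theorem seriesAct_koszulFactor (c : G → ℂ) (S : Finset G) (φ : G → ℂ) (n : G) :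
    seriesAct (koszulFactor c S) φ n =
      ∑ T ∈ S.powerset, (-1) ^ T.card * (∏ d ∈ T, c d) * φ (n - ∑ d ∈ T, d) := by
  rw [koszulFactor_eq_sum, map_sum, LinearMap.sum_apply, Finset.sum_apply]
  exact Finset.sum_congr rfl fun T _ => seriesAct_single _ _ _ _

theorem evalChar_koszulFactor (χ : Multiplicative G →* ℂ) (c : G → ℂ) (S : Finset G) :
    evalChar χ (koszulFactor c S) = ∏ d ∈ S, (1 - c d * χ (Multiplicative.ofAdd d)) := by
  simp [koszulFactor, evalChar_single]

/-- In the expansion over subsets the term of each `T` without `d` cancels against that of `T` with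
`d` added. -/
theorem seriesAct_koszulFactor_eq_zero (c : G → ℂ) (S : Finset G) (φ : G → ℂ) (n : G) {d : G}
    (hd : d ∈ S) (h : ∀ T ⊆ S, φ (n - ∑ d ∈ T, d) = c d * φ (n - ∑ d ∈ T, d - d)) :
    seriesAct (koszulFactor c S) φ n = 0 := by
  classical
  rw [seriesAct_koszulFactor, ← Finset.insert_erase hd,
    Finset.sum_powerset_insert (Finset.notMem_erase d S), ← Finset.sum_add_distrib]
  refine Finset.sum_eq_zero fun T hT => ?_
  rw [Finset.mem_powerset] at hT
  have hdT : d ∉ T := fun h' => Finset.notMem_erase d S (hT h')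
  rw [Finset.card_insert_of_notMem hdT, Finset.prod_insert hdT, Finset.sum_insert hdT,
    h T (hT.trans (Finset.erase_subset _ _)), add_comm d, ← sub_sub]
  ring

end FormalSeries

/-- An upward closed set of exponent vectors has generators of bounded exponents. -/
theorem exists_bound_of_isUpperSet {ι : Type*} [Finite ι] [DecidableEq ι] {I : Set (ι → ℕ)}
    (hI : IsUpperSet I) :
    ∃ K : ℕ, ∀ a ∈ I, ∀ i, K < a i → a - Pi.single i 1 ∈ I := by
  -- Dickson's lemma. `K` then bounds all coordinates of the finitely many minimal elements, so a
  -- larger coordinate can be lowered while staying above one of them.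
  have hfin : {a | Minimal (· ∈ I) a}.Finite :=
    WellQuasiOrderedLE.finite_of_isAntichain (setOfPred_minimal_antichain _)
  have := Fintype.ofFinite ι
  refine ⟨hfin.toFinset.sup fun a => Finset.univ.sup a, fun a ha i hi => ?_⟩
  obtain ⟨b, hba, hb⟩ := exists_minimal_le_of_wellFoundedLT (· ∈ I) a ha
  refine hI ?_ hb.prop
  have hbi : b i < a i := lt_of_le_of_lt ((Finset.le_sup (f := b) (Finset.mem_univ i)).trans
    (Finset.le_sup (f := fun a => Finset.univ.sup a) (hfin.mem_toFinset.2 hb))) hi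
  intro j
  by_cases hj : j = i
  · subst hj
    simp only [Pi.sub_apply, Pi.single_eq_same]
    omega
  · simpa [hj] using hba j

/-- The exponential `e^(2πiz)`. -/
def expTwoPiI (z : ℂ) : ℂ := Complex.exp (2 * Real.pi * Complex.I * z)

theorem expTwoPiI_add (z w : ℂ) : expTwoPiI (z + w) = expTwoPiI z * expTwoPiI w := by
  rw [expTwoPiI, mul_add, Complex.exp_add]; rfl

theorem expTwoPiI_zero : expTwoPiI 0 = 1 := by simp [expTwoPiI]

theorem expTwoPiI_sum {ι : Type*} (s : Finset ι) (z : ι → ℂ) :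
    expTwoPiI (∑ i ∈ s, z i) = ∏ i ∈ s, expTwoPiI (z i) := by
  rw [expTwoPiI, Finset.mul_sum, Complex.exp_sum]; rfl

/-! ### Rationality of the generating series of a cone. -/

namespace CompleteFan

variable {V : Type u} [NormedAddCommGroup V] [NormedSpace ℝ V]
variable {N : Submodule ℤ V} (F : CompleteFan N) (deg : N → ℂ)

open Classical in
/-- The formal series `∑_{n ∈ C ∩ N} e^(2πi deg n) y^n`. -/
def coneSeries (C : PointedCone ℝ V) (n : N) : ℂ := if (n : V) ∈ C then expTwoPiI (deg n) else 0

/-- The product `∏_{d ∈ S} (1 - e^(2πi deg d) y^d)`. -/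
def rayFactor (S : Finset N) : AddMonoidAlgebra ℂ N := koszulFactor (fun d => expTwoPiI (deg d)) S

variable {F deg}

theorem IsDegreeFunction.deg_add (hdeg : F.IsDegreeFunction deg) {C : PointedCone ℝ V}
    (hC : C ∈ F.cones) {a b : N} (ha : (a : V) ∈ C) (hb : (b : V) ∈ C) :
    deg (a + b) = deg a + deg b := by
  obtain ⟨l, hl⟩ := hdeg C hC
  rw [hl _ ha, hl _ hb, hl _ (by simpa using C.add_mem ha hb)]
  simp

variable [FiniteDimensional ℝ V]

/-- The alternating sum of the series of the cones is the series of all lattice points. -/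
theorem sum_coneSeries (n : N) :
    ∑ C ∈ F.cones, (-1) ^ coneCodim C * coneSeries deg C n = expTwoPiI (deg n) := by
  classical
  have h := congrArg (Int.cast : ℤ → ℂ) (F.sum_neg_one_pow_coneCodim (n : V))
  push_cast at h
  simp only [coneSeries, mul_ite, mul_zero]
  rw [← Finset.sum_filter, ← Finset.sum_mul, h, one_mul]

variable [DiscreteTopology N]

/-- Only finite support has to be shown, and no triangulation is needed. Write a lattice point of
`C` as a remainder plus multiples of the rays. By `exists_bound_of_isUpperSet`, once the multiple of
some ray `d` is large, subtracting `d` once more does not affect which of the points n - ∑ T lie in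
`C`; additivity of `deg` on `C` then makes the terms cancel in pairs. -/
theorem exists_rayFactor_act_coneSeries (hdeg : F.IsDegreeFunction deg) {C : PointedCone ℝ V}
    (hC : C ∈ F.cones) : ∃ P : AddMonoidAlgebra ℂ N,
      seriesAct (rayFactor deg (F.raysIn C)) (coneSeries deg C) = fun n => P.coeff n := by
  classical
  set S := F.raysIn C with hS
  suffices h : (Function.support (seriesAct (rayFactor deg S) (coneSeries deg C))).Finite by
    exact ⟨.ofCoeff (Finsupp.ofSupportFinite _ h), rfl⟩
  obtain ⟨B, hBC, hB⟩ := F.exists_finite_remainders hC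
  let pt (b : N) (a : S → ℕ) : N := b + ∑ d : S, a d • (d : N)
  have hSC : ∀ d ∈ S, (d : V) ∈ C := fun d hd => (F.mem_raysIn.1 hd).2
  -- Adding ray generators never leaves the cone, which makes the exponents an upward closed set.
  have hup : ∀ (b : N) (T : Finset N),
      IsUpperSet {a : S → ℕ | ((pt b a - ∑ d ∈ T, d : N) : V) ∈ C} := by
    intro b T a a' haa' ha
    have : pt b a' - ∑ d ∈ T, d = (pt b a - ∑ d ∈ T, d) + ∑ d : S, (a' d - a d) • (d : N) := by
      have : ∑ d : S, a' d • (d : N) = ∑ d : S, a d • (d : N) + ∑ d : S, (a' d - a d) • (d : N) := by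
        rw [← Finset.sum_add_distrib]
        refine Finset.sum_congr rfl fun d _ => ?_
        rw [← add_smul, Nat.add_sub_cancel' (haa' d)]
      simp only [pt, this]
      abel
    simp only [Set.mem_ofPred_eq] at ha ⊢
    rw [this]
    refine C.add_mem ha ?_
    simp only [AddSubmonoidClass.coe_finsetSum, Submodule.coe_smul_of_tower]
    refine Submodule.sum_mem _ fun d _ => ?_
    rw [← Nat.cast_smul_eq_nsmul ℝ]
    exact PointedCone.smul_mem _ (Nat.cast_nonneg _) (hSC d d.2)
  choose K hK using fun b T => exists_bound_of_isUpperSet (hup b T)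
  let K' := B.sup fun b => S.powerset.sup fun T => K b T
  refine (Finset.finite_toSet ((B ×ˢ Fintype.piFinset fun _ : S => Finset.range (K' + 1)).image
    fun x => pt x.1 x.2)).subset fun n hn => ?_
  by_contra hnot
  refine hn ?_
  by_cases hnC : (n : V) ∈ C
  · obtain ⟨b, hb, a, hna⟩ := hB n hnC
    rw [← hS, ← Finset.sum_coe_sort] at hna
    have hna' : n = pt b fun d => a d := hna
    obtain ⟨d, hd⟩ : ∃ d : S, K' < a d := by
      by_contra! hle
      refine hnot (Finset.mem_coe.2 (Finset.mem_image.2 ⟨(b, fun d => a d), ?_, hna'.symm⟩))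
      simp [hb, hle]
    refine seriesAct_koszulFactor_eq_zero _ _ _ _ d.2 fun T hT => ?_
    have key : ((n - ∑ d ∈ T, d : N) : V) ∈ C → ((n - ∑ d ∈ T, d - d : N) : V) ∈ C := by
      intro hm
      have hKd : K b T < a d := lt_of_le_of_lt
        ((Finset.le_sup (f := fun T => K b T) (Finset.mem_powerset.2 hT)).trans
          (Finset.le_sup (f := fun b => S.powerset.sup fun T => K b T) hb)) hd
      have := hK b T (fun d => a d) (by rwa [hna'] at hm) d hKd
      have hsplit : (fun d : S => a d) = ((fun d : S => a d) - Pi.single d 1) + Pi.single d 1 := by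
        funext j
        by_cases hj : j = d
        · subst hj; simp; omega
        · simp [hj]
      have hpt : n = pt b ((fun d : S => a d) - Pi.single d 1) + d := by
        rw [hna']
        nth_rewrite 1 [hsplit]
        simp only [pt, Pi.add_apply, add_smul, Finset.sum_add_distrib, add_assoc]
        congr 2
        rw [Finset.sum_eq_single d] <;> simp +contextual
      have hn' : n - ∑ d ∈ T, d - d = pt b ((fun d : S => a d) - Pi.single d 1) - ∑ d ∈ T, d := by
        rw [hpt]
        abel
      rw [hn']
      exact this
    by_cases hm : ((n - ∑ d ∈ T, d : N) : V) ∈ C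
    · have hm' := key hm
      rw [coneSeries, coneSeries, if_pos hm, if_pos hm', ← expTwoPiI_add,
        ← hdeg.deg_add hC (hSC d d.2) hm', add_sub_cancel]
    · rw [coneSeries, coneSeries, if_neg hm, if_neg, mul_zero]
      intro hm'
      refine hm ?_
      have := C.add_mem hm' (hSC d d.2)
      simpa using this
  -- Outside `C` every term vanishes, since adding rays of `C` to a point of `C` stays in `C`.
  · rw [rayFactor, seriesAct_koszulFactor]
    refine Finset.sum_eq_zero fun T hT => ?_
    rw [coneSeries, if_neg, mul_zero]
    intro hm
    refine hnC ?_
    have := C.add_mem hm (Submodule.sum_mem C fun d (hd : d ∈ T) => hSC d (Finset.mem_powerset.1 hT hd))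
    simpa using this

end CompleteFan

/-! ### Geometric series and the exponential function. -/

theorem summable_prod_pow {ι : Type*} [Fintype ι] {z : ι → ℂ} (hz : ∀ i, ‖z i‖ < 1) :
    Summable fun a : ι → ℕ => ∏ i, z i ^ a i := by
  classical
  refine Summable.of_norm (summable_of_sum_le (c := ∏ i, (1 - ‖z i‖)⁻¹)
    (fun a => norm_nonneg _) fun s => ?_)
  obtain ⟨K, hK⟩ : ∃ K : ℕ, ∀ a ∈ s, ∀ i, a i < K := by
    refine ⟨(s.sup fun a => Finset.univ.sup a) + 1, fun a ha i => Nat.lt_succ_of_le ?_⟩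
    exact (Finset.le_sup (f := a) (Finset.mem_univ i)).trans
      (Finset.le_sup (f := fun a : ι → ℕ => Finset.univ.sup a) ha)
  calc ∑ a ∈ s, ‖∏ i, z i ^ a i‖
      ≤ ∑ a ∈ Fintype.piFinset fun _ : ι => Finset.range K, ‖∏ i, z i ^ a i‖ :=
        Finset.sum_le_sum_of_subset_of_nonneg
          (fun a ha => Fintype.mem_piFinset.2 fun i => Finset.mem_range.2 (hK a ha i))
          fun _ _ _ => norm_nonneg _
    _ = ∏ i, ∑ k ∈ Finset.range K, ‖z i‖ ^ k := by
        simp only [norm_prod, norm_pow]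
        exact (Finset.prod_univ_sum _ _).symm
    _ ≤ ∏ i, (1 - ‖z i‖)⁻¹ := by
        refine Finset.prod_le_prod (fun i _ => Finset.sum_nonneg fun k _ => by positivity)
          fun i _ => ?_
        rw [← tsum_geometric_of_lt_one (norm_nonneg _) (hz i)]
        exact (summable_geometric_of_lt_one (norm_nonneg _) (hz i)).sum_le_tsum _
          fun k _ => by positivity

theorem expTwoPiI_nsmul (k : ℕ) (z : ℂ) : expTwoPiI (k * z) = expTwoPiI z ^ k := by
  rw [expTwoPiI, expTwoPiI, ← Complex.exp_nat_mul]
  ring_nf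

theorem norm_expTwoPiI (z : ℂ) : ‖expTwoPiI z‖ = Real.exp (-(2 * Real.pi * z.im)) := by
  rw [expTwoPiI, Complex.norm_exp]
  congr 1
  simp

theorem expTwoPiI_eq_one_iff {z : ℂ} : expTwoPiI z = 1 ↔ ∃ k : ℤ, z = k := by
  rw [expTwoPiI, Complex.exp_eq_one_iff]
  refine exists_congr fun k => ?_
  rw [mul_comm]
  exact mul_left_inj' Complex.two_pi_I_ne_zero

theorem continuous_expTwoPiI : Continuous expTwoPiI := by
  unfold expTwoPiI
  fun_prop

/-! ### Characters of the lattice and the domain of continuation. -/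

variable {V : Type u} [NormedAddCommGroup V] [NormedSpace ℝ V]
variable {N : Submodule ℤ V}

/-- The character `n ↦ e^(2πi μ(n))` of the lattice. -/
def latticeChar (N : Submodule ℤ V) (μ : V →L[ℝ] ℂ) : Multiplicative N →* ℂ where
  toFun n := expTwoPiI (μ (n.toAdd : V))
  map_one' := by simp [expTwoPiI_zero]
  map_mul' a b := by simp [expTwoPiI_add]

theorem latticeChar_apply (μ : V →L[ℝ] ℂ) (n : N) :
    latticeChar N μ (Multiplicative.ofAdd n) = expTwoPiI (μ (n : V)) := rfl

theorem coneTerm_eq (deg : N → ℂ) (τ : ℂ) (m : V →L[ℝ] ℂ) (n : N) :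
    coneTerm deg (τ, m) n =
      expTwoPiI (deg n) * latticeChar N (τ • m) (Multiplicative.ofAdd n) := by
  rw [latticeChar_apply, coneTerm, mul_comm]
  simp [expTwoPiI, mul_assoc]

/-- Evaluation at a vector, as a complex-linear form. -/
def evalAt (v : V) : (V →L[ℝ] ℂ) →L[ℂ] ℂ :=
  LinearMap.mkContinuous
    { toFun := fun m => m v
      map_add' := fun _ _ => rfl
      map_smul' := fun _ _ => rfl } ‖v‖ fun m => by
    rw [mul_comm]
    exact m.le_opNorm v

theorem continuous_char_apply (v : V) (c : ℂ) :
    Continuous fun p : ℂ × (V →L[ℝ] ℂ) => expTwoPiI ((p.1 • p.2) v + c) := by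
  refine continuous_expTwoPiI.comp (Continuous.add ?_ continuous_const)
  exact continuous_fst.smul ((evalAt v).continuous.comp continuous_snd)

theorem analyticOnNhd_evalChar (P : AddMonoidAlgebra ℂ N) (U : Set (ℂ × (V →L[ℝ] ℂ))) :
    AnalyticOnNhd ℂ (fun p => evalChar (latticeChar N (p.1 • p.2)) P) U := by
  have h : (fun p : ℂ × (V →L[ℝ] ℂ) => evalChar (latticeChar N (p.1 • p.2)) P) = fun p =>
      ∑ n ∈ P.coeff.support, P.coeff n *
        Complex.exp (2 * Real.pi * Complex.I * (p.1 * evalAt (n : V) p.2)) := by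
    funext p
    rw [evalChar_eq_sum _ P P.coeff.support fun n hn => Finsupp.notMem_support_iff.1 hn]
    rfl
  rw [h]
  intro p _
  refine Finset.analyticAt_fun_sum _ fun n _ => ?_
  refine analyticAt_const.mul (AnalyticAt.cexp (analyticAt_const.mul (analyticAt_fst.mul ?_)))
  exact ((evalAt (n : V)).analyticAt _).comp analyticAt_snd

/-- The complement in `M_ℂ` of finitely many families of hyperplanes `μ(d) + c_d ∈ ℤ`. -/
theorem isPreconnected_expTwoPiI_ne_one (S : Finset V) (c : V → ℂ) :
    IsPreconnected {μ : V →L[ℝ] ℂ | ∀ d ∈ S, expTwoPiI (μ d + c d) ≠ 1} := by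
  refine isPreconnected_of_forall_pair fun μ hμ ν hν => ?_
  -- Each condition excludes at most one point for each integer on the complex line through `μ` and
  -- `ν`, and the complement of a countable set in ℂ is connected.
  let L : ℂ → (V →L[ℝ] ℂ) := fun t => μ + t • (ν - μ)
  have hL : Continuous L := by fun_prop
  let bad : Set ℂ := {t | ∃ d ∈ S, expTwoPiI (L t d + c d) = 1}
  have hbad : bad.Countable := by
    have : bad ⊆ ⋃ d ∈ (S : Set V), ⋃ k : ℤ, {t | L t d + c d = k ∧ ν d ≠ μ d} := by
      rintro t ⟨d, hd, ht⟩
      obtain ⟨k, hk⟩ := expTwoPiI_eq_one_iff.1 ht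
      simp only [Set.mem_iUnion]
      refine ⟨d, hd, k, hk, fun h => hμ d hd ?_⟩
      simpa [L, h] using ht
    refine Set.Countable.mono this (S.countable_toSet.biUnion fun d _ => Set.countable_iUnion
      fun k => Set.Subsingleton.countable ?_)
    rintro t ⟨ht, hne⟩ t' ⟨ht', -⟩
    have h := ht.trans ht'.symm
    simp only [L, _root_.add_apply, _root_.smul_apply,
      _root_.sub_apply, smul_eq_mul, add_left_inj, add_right_inj] at h
    exact mul_right_cancel₀ (sub_ne_zero.2 hne) h
  have hconn : IsPreconnected badᶜ :=
    (hbad.isPathConnected_compl_of_one_lt_rank (by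
      rw [Complex.rank_real_complex]; norm_num)).isConnected.isPreconnected
  refine ⟨L '' badᶜ, ?_, ⟨0, ?_, by ext v; simp [L]⟩, ⟨1, ?_, by ext v; simp [L]⟩, hconn.image L hL.continuousOn⟩
  · rintro _ ⟨t, ht, rfl⟩ d hd h
    exact ht ⟨d, hd, h⟩
  · rintro ⟨d, hd, h⟩
    exact hμ d hd (by simpa [L] using h)
  · rintro ⟨d, hd, h⟩
    exact hν d hd (by simpa [L] using h)

/-- In the coordinates (τ, τm) the conditions no longer involve τ, so the domain is the image of a
product of connected sets. -/
theorem isPreconnected_coneDomain (S : Finset V) (c : V → ℂ) :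
    IsPreconnected {p : ℂ × (V →L[ℝ] ℂ) | p ∈ upperDomain V ∧
      ∀ d ∈ S, expTwoPiI ((p.1 • p.2) d + c d) ≠ 1} := by
  have hH : IsPreconnected {τ : ℂ | 0 < τ.im} := (convex_halfSpace_im_gt 0).isPreconnected
  have h := (hH.prod (isPreconnected_expTwoPiI_ne_one S c)).image
    (fun p => (p.1, p.1⁻¹ • p.2)) (by
      refine continuousOn_fst.prodMk (ContinuousOn.smul (continuousOn_fst.inv₀ ?_) continuousOn_snd)
      rintro p ⟨hp, -⟩ h0
      simp [h0] at hp)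
  convert h using 1
  ext ⟨τ, m⟩
  constructor
  · rintro ⟨hτ, hm⟩
    have hτ' : 0 < τ.im := hτ
    have hτ0 : τ ≠ 0 := by rintro rfl; simp at hτ'
    exact ⟨(τ, τ • m), ⟨hτ', hm⟩, by simp [smul_smul, inv_mul_cancel₀ hτ0]⟩
  · rintro ⟨⟨τ', μ⟩, ⟨hτ, hm⟩, h⟩
    simp only [Prod.mk.injEq] at h
    obtain ⟨rfl, rfl⟩ := h
    have hτ' : 0 < τ'.im := hτ
    have hτ0 : τ' ≠ 0 := by rintro rfl; simp at hτ'
    refine ⟨hτ', ?_⟩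
    simpa [smul_smul, mul_inv_cancel₀ hτ0] using hm

theorem isOpen_coneDomain (S : Finset V) (c : V → ℂ) :
    IsOpen {p : ℂ × (V →L[ℝ] ℂ) | p ∈ upperDomain V ∧
      ∀ d ∈ S, expTwoPiI ((p.1 • p.2) d + c d) ≠ 1} := by
  refine IsOpen.inter (isOpen_lt continuous_const (Complex.continuous_im.comp continuous_fst)) ?_
  have : {p : ℂ × (V →L[ℝ] ℂ) | ∀ d ∈ S, expTwoPiI ((p.1 • p.2) d + c d) ≠ 1} =
      ⋂ d ∈ S, {p : ℂ × (V →L[ℝ] ℂ) | expTwoPiI ((p.1 • p.2) d + c d) ≠ 1} := by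
    ext; simp
  change IsOpen {p : ℂ × (V →L[ℝ] ℂ) | ∀ d ∈ S, expTwoPiI ((p.1 • p.2) d + c d) ≠ 1}
  rw [this]
  exact isOpen_biInter_finset fun d _ => isOpen_ne_fun (continuous_char_apply d _) continuous_const

/-! ### Convergence and continuation of the cone sums. -/

namespace CompleteFan

variable {F : CompleteFan N} {deg : N → ℂ}

theorem tsum_coneTerm_eq (C : PointedCone ℝ V) (τ : ℂ) (m : V →L[ℝ] ℂ) :
    (fun n => coneSeries deg C n * latticeChar N (τ • m) (Multiplicative.ofAdd n)) =
      Set.indicator {n : N | (n : V) ∈ C} (coneTerm deg (τ, m)) := by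
  classical
  funext n
  rw [coneSeries, Set.indicator_apply, coneTerm_eq, ite_mul, zero_mul]
  rfl

theorem hasSum_of_mem_convergenceDomain {C : PointedCone ℝ V} {p : ℂ × (V →L[ℝ] ℂ)}
    (hp : p ∈ convergenceDomain deg C) :
    HasSum (fun n => coneSeries deg C n * latticeChar N (p.1 • p.2) (Multiplicative.ofAdd n))
      (∑' n : {n : N // (n : V) ∈ C}, coneTerm deg p n.1) := by
  rw [tsum_coneTerm_eq]
  exact (hasSum_subtype_iff_indicator (s := {n : N | (n : V) ∈ C})).1 hp.2.hasSum

theorem IsDegreeFunction.deg_nsmul (hdeg : F.IsDegreeFunction deg) {C : PointedCone ℝ V}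
    (hC : C ∈ F.cones) {a : N} (ha : (a : V) ∈ C) (k : ℕ) : deg (k • a) = k * deg a := by
  obtain ⟨l, hl⟩ := hdeg C hC
  have hk : ((k • a : N) : V) ∈ C := by
    have := PointedCone.smul_mem C (Nat.cast_nonneg (α := ℝ) k) ha
    simpa [Nat.cast_smul_eq_nsmul] using this
  rw [hl _ ha, hl _ hk]
  simp

/-- Otherwise the terms at all multiples of `d` would equal 1, contradicting summability. So the
domain of convergence avoids the poles of the quotient. -/
theorem expTwoPiI_ne_one_of_mem_convergenceDomain (hdeg : F.IsDegreeFunction deg)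
    {C : PointedCone ℝ V} (hC : C ∈ F.cones) {p : ℂ × (V →L[ℝ] ℂ)}
    (hp : p ∈ convergenceDomain deg C) {d : N} (hd : d ∈ F.raysIn C) :
    expTwoPiI ((p.1 • p.2) (d : V) + deg d) ≠ 1 := by
  intro h1
  obtain ⟨hdr, hdC⟩ := F.mem_raysIn.1 hd
  have hd0 : (d : V) ≠ 0 := by simpa using F.ne_zero_of_mem_rayGens hdr
  have hkC : ∀ k : ℕ, ((k • d : N) : V) ∈ C := by
    intro k
    have := PointedCone.smul_mem C (Nat.cast_nonneg (α := ℝ) k) hdC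
    simpa [Nat.cast_smul_eq_nsmul] using this
  have hinj : Function.Injective fun k : ℕ => (⟨k • d, hkC k⟩ : {n : N // (n : V) ∈ C}) := by
    intro k k' hkk
    have h2 : (k • d : N) = k' • d := congrArg Subtype.val hkk
    have h3 : (k : ℝ) • (d : V) = (k' : ℝ) • (d : V) := by
      rw [Nat.cast_smul_eq_nsmul, Nat.cast_smul_eq_nsmul]
      exact congrArg Subtype.val h2
    exact_mod_cast smul_left_injective ℝ hd0 h3
  have hs := hp.2.comp_injective hinj
  have hone : ((fun n : {n : N // (n : V) ∈ C} => coneTerm deg p n.1) ∘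
      fun k : ℕ => (⟨k • d, hkC k⟩ : {n : N // (n : V) ∈ C})) = fun _ => (1 : ℂ) := by
    funext k
    obtain ⟨τ, m⟩ := p
    simp only [Function.comp_apply]
    rw [coneTerm_eq, latticeChar_apply, hdeg.deg_nsmul hC hdC, ← expTwoPiI_add]
    have : (k * deg d + (τ • m) ((k • d : N) : V)) = k * ((τ • m) (d : V) + deg d) := by
      simp; ring
    rw [this, expTwoPiI_nsmul, h1, one_pow]
  rw [hone] at hs
  exact one_ne_zero ((summable_const_iff _).1 hs)

theorem IsDegreeFunction.exists_coneTerm_eq (hdeg : F.IsDegreeFunction deg)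
    {C : PointedCone ℝ V} (hC : C ∈ F.cones) (τ : ℂ) (m : V →L[ℝ] ℂ) :
    ∃ ψ : V →ₗ[ℝ] ℂ, (∀ n : N, (n : V) ∈ C → coneTerm deg (τ, m) n = expTwoPiI (ψ (n : V))) ∧
      ∀ n : N, (n : V) ∈ C → ψ (n : V) = (τ • m) (n : V) + deg n := by
  obtain ⟨l, hl⟩ := hdeg C hC
  refine ⟨l + (τ • m : V →L[ℝ] ℂ), fun n hn => ?_, fun n hn => ?_⟩
  · rw [coneTerm_eq, latticeChar_apply, ← expTwoPiI_add, hl n hn]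
    rfl
  · rw [hl n hn, add_comm]
    rfl

theorem expTwoPiI_linear_sum (ψ : V →ₗ[ℝ] ℂ) (S : Finset N) (b : N) (a : S → ℕ) :
    expTwoPiI (ψ ((b + ∑ d : S, a d • (d : N) : N) : V)) =
      expTwoPiI (ψ (b : V)) * ∏ d : S, expTwoPiI (ψ ((d : N) : V)) ^ a d := by
  have h : ψ ((b + ∑ d : S, a d • (d : N) : N) : V) =
      ψ (b : V) + ∑ d : S, (a d : ℂ) * ψ ((d : N) : V) := by
    simp
  rw [h, expTwoPiI_add, expTwoPiI_sum]
  simp only [expTwoPiI_nsmul]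

variable [FiniteDimensional ℝ V] [DiscreteTopology N]

/-- Choosing one decomposition for each lattice point embeds the series in the product of a finite
family with a product of geometric series. -/
theorem mem_convergenceDomain (hdeg : F.IsDegreeFunction deg) {C : PointedCone ℝ V}
    (hC : C ∈ F.cones) {p : ℂ × (V →L[ℝ] ℂ)} (hp : p ∈ upperDomain V)
    (hlt : ∀ d ∈ F.raysIn C, ‖expTwoPiI ((p.1 • p.2) (d : V) + deg d)‖ < 1) :
    p ∈ convergenceDomain deg C := by
  refine ⟨hp, ?_⟩
  obtain ⟨τ, m⟩ := p
  obtain ⟨ψ, hψ, hψ'⟩ := hdeg.exists_coneTerm_eq hC τ m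
  obtain ⟨B, hBC, hB⟩ := F.exists_finite_remainders hC
  have hz : ∀ d : F.raysIn C, ‖expTwoPiI (ψ ((d : N) : V))‖ < 1 := fun d => by
    rw [hψ' _ (F.mem_raysIn.1 d.2).2]
    exact hlt d d.2
  let f : B → ℂ := fun b => expTwoPiI (ψ ((b : N) : V))
  let g : (F.raysIn C → ℕ) → ℂ := fun a =>
    ∏ d : F.raysIn C, expTwoPiI (ψ ((d : N) : V)) ^ a d
  have hf : Summable fun b => ‖f b‖ := (hasSum_fintype _).summable
  have hg : Summable fun a => ‖g a‖ := (summable_prod_pow hz).norm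
  have hsum : Summable fun x : B × (F.raysIn C → ℕ) => f x.1 * g x.2 :=
    summable_mul_of_summable_norm hf hg
  have hB' : ∀ n : {n : N // (n : V) ∈ C}, ∃ x : B × (F.raysIn C → ℕ),
      n.1 = (x.1 : N) + ∑ d : F.raysIn C, x.2 d • (d : N) := by
    intro n
    obtain ⟨b, hb, a, h⟩ := hB n.1 n.2
    refine ⟨(⟨b, hb⟩, fun d => a d), h.trans ?_⟩
    rw [Finset.sum_coe_sort (F.raysIn C) fun d => a d • d]
  choose x hx using hB'
  have hinj : Function.Injective x := fun n n' h => Subtype.ext (by rw [hx n, hx n', h])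
  refine (hsum.comp_injective hinj).congr fun n => ?_
  rw [hψ n.1 n.2, hx n, expTwoPiI_linear_sum]
  rfl

/-- The starting point for the identity theorem. At τ = i the parameter is chosen so that τm = -l +
i s, where `deg` is `l` on the cone and `s` is positive on its rays; the ray factors have norm
e^(-2πs(d)) < 1, which is an open condition. -/
theorem exists_mem_nhds_convergenceDomain (hdeg : F.IsDegreeFunction deg) {C : PointedCone ℝ V}
    (hC : C ∈ F.cones) : ∃ p, convergenceDomain deg C ∈ nhds p := by
  obtain ⟨s, hs⟩ := F.exists_pos_on_rays hC
  obtain ⟨l, hl⟩ := hdeg C hC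
  let μ : V →L[ℝ] ℂ := -l.toContinuousLinearMap + Complex.I • (Complex.ofRealCLM.comp s)
  let U : Set (ℂ × (V →L[ℝ] ℂ)) := {p | p ∈ upperDomain V ∧
    ∀ d ∈ F.raysIn C, ‖expTwoPiI ((p.1 • p.2) (d : V) + deg d)‖ < 1}
  have hU : IsOpen U := by
    refine IsOpen.inter (isOpen_lt continuous_const (Complex.continuous_im.comp continuous_fst)) ?_
    have : {p : ℂ × (V →L[ℝ] ℂ) |
        ∀ d ∈ F.raysIn C, ‖expTwoPiI ((p.1 • p.2) (d : V) + deg d)‖ < 1} =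
        ⋂ d ∈ F.raysIn C, {p : ℂ × (V →L[ℝ] ℂ) |
          ‖expTwoPiI ((p.1 • p.2) (d : V) + deg d)‖ < 1} := by
      ext; simp
    change IsOpen {p : ℂ × (V →L[ℝ] ℂ) |
        ∀ d ∈ F.raysIn C, ‖expTwoPiI ((p.1 • p.2) (d : V) + deg d)‖ < 1}
    rw [this]
    exact isOpen_biInter_finset fun d _ =>
      isOpen_lt (continuous_char_apply (d : V) _).norm continuous_const
  refine ⟨(Complex.I, (-Complex.I) • μ), Filter.mem_of_superset (hU.mem_nhds ⟨?_, ?_⟩)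
    fun p hp => mem_convergenceDomain hdeg hC hp.1 hp.2⟩
  · simp [upperDomain]
  · intro d hd
    rw [norm_expTwoPiI, Real.exp_lt_one_iff, hl d (F.mem_raysIn.1 hd).2]
    have := hs d hd
    have hpi := Real.pi_pos
    simp [μ, smul_smul]
    positivity

/-- The continued cone sum is the quotient of the two Laurent polynomials that express the
rationality of the generating series. -/
theorem hasConeValue_iff (hdeg : F.IsDegreeFunction deg) {C : PointedCone ℝ V}
    (hC : C ∈ F.cones) {P : AddMonoidAlgebra ℂ N}
    (hP : seriesAct (rayFactor deg (F.raysIn C)) (coneSeries deg C) = fun n => P.coeff n)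
    {p : ℂ × (V →L[ℝ] ℂ)} (hp : p ∈ upperDomain V)
    (hne : ∀ d ∈ F.raysIn C, expTwoPiI ((p.1 • p.2) (d : V) + deg d) ≠ 1) (a : ℂ) :
    HasConeValue deg C p a ↔ a = evalChar (latticeChar N (p.1 • p.2)) P /
      evalChar (latticeChar N (p.1 • p.2)) (rayFactor deg (F.raysIn C)) := by
  classical
  set Q := rayFactor deg (F.raysIn C) with hQ
  have hQ0 : ∀ s : ℂ × (V →L[ℝ] ℂ),
      (∀ d ∈ F.raysIn C, expTwoPiI ((s.1 • s.2) (d : V) + deg d) ≠ 1) →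
      evalChar (latticeChar N (s.1 • s.2)) Q ≠ 0 := by
    intro s hs
    rw [hQ, rayFactor, evalChar_koszulFactor, Finset.prod_ne_zero_iff]
    intro d hd
    rw [latticeChar_apply, ← expTwoPiI_add, add_comm, sub_ne_zero]
    exact (hs d hd).symm
  have hconv : ∀ s ∈ convergenceDomain deg C, evalChar (latticeChar N (s.1 • s.2)) Q *
      (∑' n : {n : N // (n : V) ∈ C}, coneTerm deg s n.1) =
      evalChar (latticeChar N (s.1 • s.2)) P := fun s hs =>
    evalChar_mul_eq (hasSum_of_mem_convergenceDomain hs) hP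
  constructor
  · rintro ⟨U, f, hUo, hUc, -, hcU, hpU, hf, hfs, rfl⟩
    obtain ⟨p₀, hp₀⟩ := exists_mem_nhds_convergenceDomain hdeg hC
    -- The identity theorem applies to the product with the denominator, so it does not matter
    -- whether the given domain contains zeros of `Q`.
    have hEq := ((analyticOnNhd_evalChar Q U).mul hf).eqOn_of_preconnected_of_eventuallyEq
      (analyticOnNhd_evalChar P U) hUc (hcU (mem_of_mem_nhds hp₀))
      (Filter.eventually_of_mem hp₀ fun s hs => by
        simpa only [hfs s hs] using hconv s hs)
    rw [eq_div_iff (hQ0 p hne), mul_comm]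
    exact hEq hpU
  · rintro rfl
    -- `deg` is extended by zero only because the domain is described by vectors of `V`; the value
    -- off `N` plays no role.
    let c : V → ℂ := fun v => if h : v ∈ N then deg ⟨v, h⟩ else 0
    let S : Finset V := (F.raysIn C).image (↑)
    let U := {p : ℂ × (V →L[ℝ] ℂ) | p ∈ upperDomain V ∧
      ∀ d ∈ S, expTwoPiI ((p.1 • p.2) d + c d) ≠ 1}
    have hU : ∀ s, s ∈ U ↔ s ∈ upperDomain V ∧
        ∀ d ∈ F.raysIn C, expTwoPiI ((s.1 • s.2) (d : V) + deg d) ≠ 1 := by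
      intro s
      refine and_congr_right fun _ => ?_
      simp only [S, Finset.forall_mem_image]
      refine forall₂_congr fun d _ => ?_
      simp [c]
    refine ⟨U, fun s => evalChar (latticeChar N (s.1 • s.2)) P /
      evalChar (latticeChar N (s.1 • s.2)) Q, isOpen_coneDomain S c, isPreconnected_coneDomain S c,
      fun s hs => hs.1, fun s hs => (hU s).2 ⟨hs.1, fun d hd =>
        expTwoPiI_ne_one_of_mem_convergenceDomain hdeg hC hs hd⟩, (hU p).2 ⟨hp, hne⟩,
      (analyticOnNhd_evalChar P U).div (analyticOnNhd_evalChar Q U)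
        fun s hs => hQ0 s ((hU s).1 hs).2, fun s hs => ?_, rfl⟩
    have h0 := hQ0 s fun d hd => expTwoPiI_ne_one_of_mem_convergenceDomain hdeg hC hs hd
    simp only [← hconv s hs]
    exact mul_div_cancel_left₀ _ h0

theorem existsUnique_hasConeValue (hdeg : F.IsDegreeFunction deg) {C : PointedCone ℝ V}
    (hC : C ∈ F.cones) {p : ℂ × (V →L[ℝ] ℂ)} (hp : p ∈ upperDomain V)
    (hne : ∀ d ∈ F.raysIn C, expTwoPiI ((p.1 • p.2) (d : V) + deg d) ≠ 1) :
    ∃! a : ℂ, HasConeValue deg C p a := by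
  obtain ⟨P, hP⟩ := exists_rayFactor_act_coneSeries hdeg hC
  exact ⟨_, (hasConeValue_iff hdeg hC hP hp hne _).2 rfl,
    fun b hb => (hasConeValue_iff hdeg hC hP hp hne b).1 hb⟩

theorem coneSum_eq (hdeg : F.IsDegreeFunction deg) {C : PointedCone ℝ V}
    (hC : C ∈ F.cones) {P : AddMonoidAlgebra ℂ N}
    (hP : seriesAct (rayFactor deg (F.raysIn C)) (coneSeries deg C) = fun n => P.coeff n)
    {p : ℂ × (V →L[ℝ] ℂ)} (hp : p ∈ upperDomain V)
    (hne : ∀ d ∈ F.raysIn C, expTwoPiI ((p.1 • p.2) (d : V) + deg d) ≠ 1) :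
    coneSum deg C p = evalChar (latticeChar N (p.1 • p.2)) P /
      evalChar (latticeChar N (p.1 • p.2)) (rayFactor deg (F.raysIn C)) := by
  have h : ∃ a, HasConeValue deg C p a := (existsUnique_hasConeValue hdeg hC hp hne).exists
  rw [coneSum, dif_pos h]
  exact (hasConeValue_iff hdeg hC hP hp hne _).1 h.choose_spec

/-- The alternating sum of the cone sums is the quotient of a Laurent polynomial by the product
over the rays. -/
theorem exists_alternatingConeSum_eq (hdeg : F.IsDegreeFunction deg) :
    ∃ T : AddMonoidAlgebra ℂ N,
      (seriesAct (rayFactor deg F.rays) (fun n => expTwoPiI (deg n)) = fun n => T.coeff n) ∧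
      ∀ p : ℂ × (V →L[ℝ] ℂ), p ∈ upperDomain V →
        (∀ d ∈ F.rays, expTwoPiI ((p.1 • p.2) (d : V) + deg d) ≠ 1) →
        alternatingConeSum F deg p = evalChar (latticeChar N (p.1 • p.2)) T /
          evalChar (latticeChar N (p.1 • p.2)) (rayFactor deg F.rays) := by
  classical
  choose! P hP using fun C (hC : C ∈ F.cones) => exists_rayFactor_act_coneSeries hdeg hC
  have hfac : ∀ C, rayFactor deg (F.rays \ F.raysIn C) * rayFactor deg (F.raysIn C) =
      rayFactor deg F.rays := fun C => Finset.prod_sdiff (F.raysIn_subset C)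
  -- The fractions are brought to a common denominator by the factors of the rays outside each cone.
  refine ⟨∑ C ∈ F.cones, ((-1 : ℂ) ^ coneCodim C) • (rayFactor deg (F.rays \ F.raysIn C) * P C),
    ?_, ?_⟩
  · have h1 : (fun n : N => expTwoPiI (deg n)) =
        ∑ C ∈ F.cones, ((-1 : ℂ) ^ coneCodim C) • coneSeries deg C := by
      funext n
      rw [← sum_coneSeries (F := F) (deg := deg) n]
      simp
    rw [h1, map_sum]
    have h2 : ∀ C ∈ F.cones, seriesAct (rayFactor deg F.rays)
        (((-1 : ℂ) ^ coneCodim C) • coneSeries deg C) = fun n =>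
          (((-1 : ℂ) ^ coneCodim C) • (rayFactor deg (F.rays \ F.raysIn C) * P C)).coeff n := by
      intro C hC
      rw [map_smul, ← hfac C, map_mul, Module.End.mul_apply, hP C hC, seriesAct_coeff]
      rfl
    rw [Finset.sum_congr rfl h2]
    funext n
    simp [AddMonoidAlgebra.coeff_sum]
  · intro p hp hne
    have hQ0 : ∀ S ⊆ F.rays, evalChar (latticeChar N (p.1 • p.2)) (rayFactor deg S) ≠ 0 := by
      intro S hS
      rw [rayFactor, evalChar_koszulFactor, Finset.prod_ne_zero_iff]
      intro d hd
      rw [latticeChar_apply, ← expTwoPiI_add, add_comm, sub_ne_zero]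
      exact (hne d (hS hd)).symm
    rw [alternatingConeSum, map_sum, Finset.sum_div]
    refine Finset.sum_congr rfl fun C hC => ?_
    rw [coneSum_eq hdeg hC (hP C hC) hp fun d hd => hne d (F.raysIn_subset C hd), ← hfac C]
    rw [map_smul, map_mul, map_mul, smul_eq_mul]
    have h1 := hQ0 _ (F.raysIn_subset C)
    have h2 := hQ0 (F.rays \ F.raysIn C) Finset.sdiff_subset
    field_simp

end CompleteFan

/-! ### Gradings of complex vector spaces. -/

section Gradings

variable {Γ X Y : Type*} [AddCommGroup X] [Module ℂ X] [AddCommGroup Y] [Module ℂ Y]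

theorem linearMap_ext_of_iSup {𝒳 : Γ → Submodule ℂ X} (htop : ⨆ g, 𝒳 g = ⊤) {φ ψ : X →ₗ[ℂ] Y}
    (h : ∀ g, ∀ x ∈ 𝒳 g, φ x = ψ x) : φ = ψ := by
  refine LinearMap.ext fun x => ?_
  have hle : ⨆ g, 𝒳 g ≤ LinearMap.eqLocus φ ψ := iSup_le fun g x hx => h g x hx
  exact hle (htop ▸ Submodule.mem_top)

theorem exists_linearMap_glue {𝒳 : Γ → Submodule ℂ X} (hind : iSupIndep 𝒳) (htop : ⨆ g, 𝒳 g = ⊤)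
    (φ : Γ → X →ₗ[ℂ] Y) : ∃ ψ : X →ₗ[ℂ] Y, ∀ g, ∀ x ∈ 𝒳 g, ψ x = φ g x := by
  classical
  have hint := DirectSum.isInternal_submodule_of_iSupIndep_of_iSup_eq_top hind htop
  let := hint.chooseDecomposition
  refine ⟨(DirectSum.toModule ℂ Γ Y fun g => (φ g).comp (𝒳 g).subtype) ∘ₗ
    (DirectSum.decomposeLinearEquiv 𝒳).toLinearMap, fun g x hx => ?_⟩
  simp only [LinearMap.comp_apply, LinearEquiv.coe_coe]
  rw [show x = ((⟨x, hx⟩ : 𝒳 g) : X) from rfl, DirectSum.decomposeLinearEquiv_apply_coe,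
    DirectSum.toModule_lof]
  rfl

/-- The projections to the pieces of a grading. -/
theorem exists_grading_projections {𝒳 : Γ → Submodule ℂ X} (hind : iSupIndep 𝒳)
    (htop : ⨆ g, 𝒳 g = ⊤) : ∃ p : Γ → X →ₗ[ℂ] X, (∀ g x, p g x ∈ 𝒳 g) ∧
      (∀ g, ∀ x ∈ 𝒳 g, p g x = x) ∧ ∀ g h, g ≠ h → ∀ x ∈ 𝒳 h, p g x = 0 := by
  classical
  choose p hp using fun g => exists_linearMap_glue hind htop fun h =>
    if g = h then LinearMap.id else (0 : X →ₗ[ℂ] X)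
  have h1 : ∀ g, ∀ x ∈ 𝒳 g, p g x = x := fun g x hx => by rw [hp g g x hx, if_pos rfl]; rfl
  have h2 : ∀ g h, g ≠ h → ∀ x ∈ 𝒳 h, p g x = 0 := fun g h hgh x hx => by
    rw [hp g h x hx, if_neg hgh]; rfl
  refine ⟨p, fun g x => ?_, h1, h2⟩
  have hle : ⨆ h, 𝒳 h ≤ (𝒳 g).comap (p g) := by
    refine iSup_le fun h x hx => ?_
    rw [Submodule.mem_comap]
    by_cases hgh : g = h
    · subst hgh
      rwa [h1 g x hx]
    · rw [h2 g h hgh x hx]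
      exact zero_mem _
  exact hle (htop ▸ Submodule.mem_top)

/-- The grading defined by a basis whose vectors have degrees. -/
def basisGrading {ι : Type*} (b : Module.Basis ι ℂ X) (δ : ι → Γ) (g : Γ) : Submodule ℂ X :=
  Submodule.span ℂ (b '' {i | δ i = g})

theorem basisGrading_iSup {ι : Type*} (b : Module.Basis ι ℂ X) (δ : ι → Γ) :
    ⨆ g, basisGrading b δ g = ⊤ := by
  rw [eq_top_iff, ← b.span_eq, Submodule.span_le]
  rintro _ ⟨i, rfl⟩
  exact Submodule.mem_iSup_of_mem (δ i) (Submodule.subset_span ⟨i, rfl, rfl⟩)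

theorem basisGrading_iSupIndep {ι : Type*} (b : Module.Basis ι ℂ X) (δ : ι → Γ) :
    iSupIndep (basisGrading b δ) := by
  intro g
  have hle : ⨆ h, ⨆ (_ : h ≠ g), basisGrading b δ h ≤ Submodule.span ℂ (b '' {i | δ i ≠ g}) := by
    refine iSup₂_le fun h hh => Submodule.span_mono (Set.image_mono ?_)
    rintro i rfl
    exact hh
  refine Disjoint.mono_right hle ?_
  refine b.linearIndependent.disjoint_span_image ?_
  exact Set.disjoint_left.2 fun i hi hi' => hi' hi

theorem finrank_basisGrading {ι : Type*} (b : Module.Basis ι ℂ X) (δ : ι → Γ) (g : Γ) :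
    Module.finrank ℂ (basisGrading b δ g) = {i | δ i = g}.ncard := by
  have hli : LinearIndependent ℂ fun i : {i | δ i = g} => b i :=
    b.linearIndependent.comp _ Subtype.val_injective
  rw [basisGrading, Set.image_eq_range, Module.finrank_eq_nat_card_basis (Module.Basis.span hli)]
  rfl

end Gradings

/-! ### Cycles and homology classes in complexes of modules. -/

section Homology

variable {R : Type u} [Ring R] (K : ChainComplex (ModuleCat.{u} R) ℕ)

theorem iCycles_injective (i : ℕ) : Function.Injective (K.iCycles i) :=
  (ModuleCat.mono_iff_injective _).1 inferInstance

theorem homologyπ_surjective (i : ℕ) : Function.Surjective (K.homologyπ i) :=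
  (ModuleCat.epi_iff_surjective _).1 inferInstance

theorem exists_iCycles_eq {i : ℕ} {x : K.X i}
    (hx : K.d i ((ComplexShape.down ℕ).next i) x = 0) : ∃ z, K.iCycles i z = x :=
  (ShortComplex.moduleCat_exact_iff _).1 (ShortComplex.exact_of_f_is_kernel
    (ShortComplex.mk _ _ (K.iCycles_d i _)) (K.cyclesIsKernel i _ rfl)) x hx

theorem d_iCycles (i j : ℕ) (z : K.cycles i) : K.d i j (K.iCycles i z) = 0 := by
  rw [← ConcreteCategory.comp_apply, K.iCycles_d]
  rfl

theorem homologyπ_eq_zero_iff {i : ℕ} {z : K.cycles i} :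
    K.homologyπ i z = 0 ↔ ∃ w, K.d (i + 1) i w = K.iCycles i z := by
  have hcomp : ∀ w, K.iCycles i (K.toCycles (i + 1) i w) = K.d (i + 1) i w := fun w => by
    rw [← ConcreteCategory.comp_apply, K.toCycles_i]
  constructor
  · intro hz
    obtain ⟨w, hw⟩ := (ShortComplex.moduleCat_exact_iff _).1 (ShortComplex.exact_of_g_is_cokernel
      (ShortComplex.mk _ _ (K.toCycles_comp_homologyπ (i + 1) i))
      (K.homologyIsCokernel (i + 1) i (by simp))) z hz
    exact ⟨w, by rw [← hcomp]; exact congrArg _ hw⟩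
  · rintro ⟨w, hw⟩
    rw [← hcomp] at hw
    rw [← iCycles_injective K i hw, ← ConcreteCategory.comp_apply, K.toCycles_comp_homologyπ]
    rfl

end Homology

/-! ### Independence of the grading of Tor from the resolution. -/

namespace CompleteFan

variable {V : Type u} [NormedAddCommGroup V] [NormedSpace ℝ V]
variable {N : Submodule ℤ V} {F : CompleteFan N} {deg : N → ℂ}

theorem linear_of_commute_X {X Y : ModuleCat.{u} F.PolyRing} (φ : X →ₗ[ℂ] Y)
    (h : ∀ (d : F.rayGens) (x : X), φ ((MvPolynomial.X d : F.PolyRing) • x) =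
      (MvPolynomial.X d : F.PolyRing) • φ x) (r : F.PolyRing) (x : X) : φ (r • x) = r • φ x := by
  induction r using MvPolynomial.induction_on generalizing x with
  | C c => exact map_smul φ c x
  | add p q hp hq => rw [add_smul, map_add, hp, hq, add_smul]
  | mul_X p d hp => rw [mul_smul, hp, h, mul_smul]

/-- The degree zero part of a linear map between graded modules. -/
theorem exists_degreeZero_part {X Y : ModuleCat.{u} F.PolyRing}
    {𝒳 : N × ℂ → Submodule ℂ X} {𝒴 : N × ℂ → Submodule ℂ Y} (hX : F.IsGrading deg X 𝒳)
    (hY : F.IsGrading deg Y 𝒴) {p : N × ℂ → Y →ₗ[ℂ] Y}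
    (hp1 : ∀ g, ∀ y ∈ 𝒴 g, p g y = y) (hp2 : ∀ g h, g ≠ h → ∀ y ∈ 𝒴 h, p g y = 0)
    (f : X ⟶ Y) : ∃ f₀ : X ⟶ Y, ∀ g, ∀ x ∈ 𝒳 g, f₀ x = p g (f x) := by
  obtain ⟨φ, hφ⟩ := exists_linearMap_glue hX.iSupIndep hX.iSup_eq_top
    fun g => (p g).comp (f.hom.restrictScalars ℂ)
  have hpX : ∀ (d : F.rayGens) (g : N × ℂ) (y : Y),
      p ((d.1, deg d.1) + g) ((MvPolynomial.X d : F.PolyRing) • y) =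
        (MvPolynomial.X d : F.PolyRing) • p g y := by
    intro d g y
    let μ : Y →ₗ[ℂ] Y := Algebra.lsmul ℂ ℂ Y (MvPolynomial.X d : F.PolyRing)
    have : (p ((d.1, deg d.1) + g)).comp μ = μ.comp (p g) := by
      refine linearMap_ext_of_iSup hY.iSup_eq_top fun h y hy => ?_
      have hm := hY.smul_mem d h y hy
      simp only [LinearMap.comp_apply]
      by_cases hgh : g = h
      · subst hgh
        rw [hp1 _ y hy]
        exact hp1 _ _ hm
      · rw [hp2 _ _ hgh y hy, map_zero]
        exact hp2 _ _ (fun h' => hgh (add_left_cancel h')) _ hm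
    exact congrArg (fun ψ => ψ y) this
  have hX' : ∀ (d : F.rayGens) (x : X), φ ((MvPolynomial.X d : F.PolyRing) • x) =
      (MvPolynomial.X d : F.PolyRing) • φ x := by
    intro d x
    let μX : X →ₗ[ℂ] X := Algebra.lsmul ℂ ℂ X (MvPolynomial.X d : F.PolyRing)
    let μY : Y →ₗ[ℂ] Y := Algebra.lsmul ℂ ℂ Y (MvPolynomial.X d : F.PolyRing)
    have : φ.comp μX = μY.comp φ := by
      refine linearMap_ext_of_iSup hX.iSup_eq_top fun g x hx => ?_
      have hm := hX.smul_mem d g x hx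
      change φ ((MvPolynomial.X d : F.PolyRing) • x) = (MvPolynomial.X d : F.PolyRing) • φ x
      rw [hφ _ _ hm, hφ _ _ hx]
      simp only [LinearMap.comp_apply, LinearMap.restrictScalars_apply, map_smul]
      exact hpX d g _
    exact congrArg (fun ψ => ψ x) this
  exact ⟨ModuleCat.ofHom
    { toFun := φ
      map_add' := map_add φ
      map_smul' := linear_of_commute_X φ hX' }, fun g x hx => hφ g x hx⟩

/-- The functor `Tor_i^R(ℂ[N]^Σ, -)`. -/
abbrev torFunctor (F : CompleteFan N) (i : ℕ) : ModuleCat.{u} F.PolyRing ⥤ ModuleCat.{u} F.PolyRing :=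
  ((tensoringLeft (ModuleCat.{u} F.PolyRing)).obj F.deformedModule).leftDerived i

namespace GradedResolution

/-- Two graded resolutions are related by a homogeneous chain map that lifts the identity. -/
theorem exists_graded_lift (P Q : F.GradedResolution deg) :
    ∃ φ : P.res.complex ⟶ Q.res.complex, φ.f 0 ≫ Q.res.π.f 0 = P.res.π.f 0 ∧
      ∀ i g, ∀ x ∈ P.gr i g, φ.f i x ∈ Q.gr i g := by
  -- An arbitrary lift is replaced by its degree zero part. Differentials and augmentations are
  -- homogeneous, so this is still a chain map over the identity.
  let f := ProjectiveResolution.lift (𝟙 F.trivialModule) P.res Q.res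
  choose p hp0 hp1 hp2 using fun i => exists_grading_projections (Q.isGrading i).iSupIndep
    (Q.isGrading i).iSup_eq_top
  choose f₀ hf₀ using fun i => exists_degreeZero_part (P.isGrading i) (Q.isGrading i)
    (hp1 i) (hp2 i) (f.f i)
  have hdp : ∀ i j g (y : Q.res.complex.X i),
      p j g (Q.res.complex.d i j y) = Q.res.complex.d i j (p i g y) := by
    intro i j g y
    have : (p j g).comp ((Q.res.complex.d i j).hom.restrictScalars ℂ) =
        ((Q.res.complex.d i j).hom.restrictScalars ℂ).comp (p i g) := by
      refine linearMap_ext_of_iSup (Q.isGrading i).iSup_eq_top fun h y hy => ?_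
      have hm := Q.d_mem i j h y hy
      simp only [LinearMap.comp_apply, LinearMap.restrictScalars_apply]
      by_cases hgh : g = h
      · subst hgh
        rw [hp1 i _ y hy]
        exact hp1 j _ _ hm
      · rw [hp2 i _ _ hgh y hy, map_zero]
        exact hp2 j _ _ hgh _ hm
    exact congrArg (fun ψ => ψ y) this
  have hext : ∀ {i : ℕ} {Y : ModuleCat.{u} F.PolyRing} (a b : P.res.complex.X i ⟶ Y),
      (∀ g, ∀ x ∈ P.gr i g, a x = b x) → a = b := by
    intro i Y a b h
    refine ModuleCat.hom_ext (LinearMap.ext fun x => ?_)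
    exact congrArg (fun ψ => ψ x) (linearMap_ext_of_iSup (P.isGrading i).iSup_eq_top
      (φ := a.hom.restrictScalars ℂ) (ψ := b.hom.restrictScalars ℂ) h)
  refine ⟨{ f := f₀, comm' := fun i j _ => hext _ _ fun g x hx => ?_ }, ?_, fun i g x hx => ?_⟩
  · have hm := P.d_mem i j g x hx
    have hcomm : f.f j (P.res.complex.d i j x) = Q.res.complex.d i j (f.f i x) := by
      rw [← ConcreteCategory.comp_apply, ← ConcreteCategory.comp_apply, f.comm]
    rw [ConcreteCategory.comp_apply, ConcreteCategory.comp_apply, hf₀ i g x hx, ← hdp, ← hcomm]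
    exact (hf₀ j g _ hm).symm
  · refine hext _ _ fun g x hx => ?_
    have hcomm : Q.res.π.f 0 (f.f 0 x) = P.res.π.f 0 x := by
      have : f.f 0 ≫ Q.res.π.f 0 = P.res.π.f 0 :=
        (ProjectiveResolution.lift_commutes_zero (𝟙 F.trivialModule) P.res Q.res).trans
          (Category.comp_id _)
      exact congrArg (fun ψ => ψ.hom x) this
    rw [ConcreteCategory.comp_apply]
    change Q.res.π.f 0 (f₀ 0 x) = _
    rw [hf₀ 0 g x hx]
    by_cases hg : g = 0
    · subst hg
      rw [← hcomm]
      have : ((Q.res.π.f 0).hom.restrictScalars ℂ).comp (p 0 0) =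
          (Q.res.π.f 0).hom.restrictScalars ℂ := by
        refine linearMap_ext_of_iSup (Q.isGrading 0).iSup_eq_top fun h y hy => ?_
        simp only [LinearMap.comp_apply, LinearMap.restrictScalars_apply]
        by_cases hh : h = 0
        · subst hh
          rw [hp1 0 _ y hy]
        · rw [hp2 0 _ _ (Ne.symm hh) y hy, map_zero]
          exact (Q.π_eq_zero h hh y hy).symm
      exact congrArg (fun ψ => ψ (f.f 0 x)) this
    · exact (Q.π_eq_zero g hg _ (hp0 0 g _)).trans (P.π_eq_zero g hg x hx).symm
  · change f₀ i x ∈ _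
    rw [hf₀ i g x hx]
    exact hp0 i g _

theorem torClass_apply (P : F.GradedResolution deg) (i : ℕ) (z : P.torComplex.cycles i) :
    P.torClass i z = (P.res.isoLeftDerivedObj ((tensoringLeft (ModuleCat.{u} F.PolyRing)).obj
      F.deformedModule) i).inv (P.torComplex.homologyπ i z) := rfl

/-- The map of complexes `ℂ[N]^Σ ⊗ P ⟶ ℂ[N]^Σ ⊗ Q` induced by a map `P ⟶ Q`. -/
def torComplexMap {P Q : F.GradedResolution deg} (φ : P.res.complex ⟶ Q.res.complex) :
    P.torComplex ⟶ Q.torComplex :=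
  (((tensoringLeft (ModuleCat.{u} F.PolyRing)).obj F.deformedModule).mapHomologicalComplex
    (ComplexShape.down ℕ)).map φ

theorem iCycles_cyclesMap {P Q : F.GradedResolution deg} (φ : P.res.complex ⟶ Q.res.complex)
    (i : ℕ) (z : P.torComplex.cycles i) :
    Q.torComplex.iCycles i (HomologicalComplex.cyclesMap (torComplexMap φ) i z) =
      (torComplexMap φ).f i (P.torComplex.iCycles i z) :=
  congrArg (fun ψ => ψ.hom z) (HomologicalComplex.cyclesMap_i (torComplexMap φ) i)

/-- It is applied with `f` the identity, to compare resolutions, and with `f` zero, to see that the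
variables annihilate Tor. -/
theorem torClass_naturality {P Q : F.GradedResolution deg} (φ : P.res.complex ⟶ Q.res.complex)
    (f : F.trivialModule ⟶ F.trivialModule) (hφ : φ.f 0 ≫ Q.res.π.f 0 = P.res.π.f 0 ≫ f) (i : ℕ)
    (z : P.torComplex.cycles i) :
    Q.torClass i (HomologicalComplex.cyclesMap (torComplexMap φ) i z) =
      (F.torFunctor i).map f (P.torClass i z) := by
  have h1 := ProjectiveResolution.isoLeftDerivedObj_inv_naturality f P.res Q.res φ hφ
    ((tensoringLeft (ModuleCat.{u} F.PolyRing)).obj F.deformedModule) i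
  have h2 := congrArg (fun ψ => ψ.hom (P.torComplex.homologyπ i z)) h1
  have h3 := congrArg (fun ψ => ψ.hom z)
    (HomologicalComplex.homologyπ_naturality (torComplexMap φ) i)
  rw [torClass_apply, torClass_apply]
  exact ((congrArg _ h3).symm).trans h2.symm

/-- A homogeneous lift of the identity sends cycles of degree `g` to cycles of degree `g` and does
not move their classes. -/
theorem torGrading_le (P Q : F.GradedResolution deg) (i : ℕ) (g : N × ℂ) :
    P.torGrading i g ≤ Q.torGrading i g := by
  obtain ⟨φ, hφ0, hφ⟩ := exists_graded_lift P Q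
  rintro _ ⟨z, hz, rfl⟩
  refine ⟨HomologicalComplex.cyclesMap (torComplexMap φ) i z, ?_, ?_⟩
  · have hz' : P.torComplex.iCycles i z ∈ P.torComplexGrading i g := hz
    change Q.torComplex.iCycles i (HomologicalComplex.cyclesMap (torComplexMap φ) i z) ∈
      Q.torComplexGrading i g
    rw [iCycles_cyclesMap]
    have hle : P.torComplexGrading i g ≤
        (Q.torComplexGrading i g).comap (((torComplexMap φ).f i).hom.restrictScalars ℂ) := by
      refine Submodule.span_le.2 ?_
      rintro _ ⟨g₁, g₂, hg, a, ha, x, hx, rfl⟩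
      exact Submodule.subset_span ⟨g₁, g₂, hg, a, ha, _, hφ i g₂ x hx, rfl⟩
    exact hle hz'
  · have h := torClass_naturality φ (𝟙 _) (hφ0.trans (Category.comp_id _).symm) i z
    have hid : (F.torFunctor i).map (𝟙 F.trivialModule) = 𝟙 _ := CategoryTheory.Functor.map_id _ _
    exact h.trans (congrArg (fun ψ => ψ.hom (P.torClass i z)) hid)

theorem torGrading_eq (P Q : F.GradedResolution deg) (i : ℕ) : P.torGrading i = Q.torGrading i :=
  funext fun g => le_antisymm (torGrading_le P Q i g) (torGrading_le Q P i g)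

theorem torClass_surjective (P : F.GradedResolution deg) (i : ℕ) :
    Function.Surjective (P.torClass i) := by
  intro t
  let e := P.res.isoLeftDerivedObj
    ((tensoringLeft (ModuleCat.{u} F.PolyRing)).obj F.deformedModule) i
  obtain ⟨z, hz⟩ := homologyπ_surjective P.torComplex i (e.hom t)
  refine ⟨z, ?_⟩
  rw [torClass_apply, hz]
  exact congrArg (fun ψ => ψ.hom t) e.hom_inv_id

theorem torClass_eq_zero_iff (P : F.GradedResolution deg) {i : ℕ} {z : P.torComplex.cycles i} :
    P.torClass i z = 0 ↔ ∃ w, P.torComplex.d (i + 1) i w = P.torComplex.iCycles i z := by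
  rw [← homologyπ_eq_zero_iff, torClass_apply]
  let e := P.res.isoLeftDerivedObj
    ((tensoringLeft (ModuleCat.{u} F.PolyRing)).obj F.deformedModule) i
  constructor
  · intro h
    have h2 := congrArg (fun t => e.hom t) h
    have h3 : ∀ y, e.hom (e.inv y) = y := fun y => congrArg (fun ψ => ψ.hom y) e.inv_hom_id
    exact (h3 _).symm.trans (h2.trans (map_zero e.hom.hom))
  · intro h
    exact (congrArg _ h).trans (map_zero e.inv.hom)

/-- The variables act as zero on `Tor`. -/
theorem X_smul_tor (P : F.GradedResolution deg) (i : ℕ) (d : F.rayGens) (t : F.tor i) :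
    (MvPolynomial.X d : F.PolyRing) • t = 0 := by
  obtain ⟨z, rfl⟩ := P.torClass_surjective i t
  -- Multiplication by the variable and the zero map are both chain maps over the zero endomorphism
  -- of ℂ, so they induce the same map on Tor.
  let φ : P.res.complex ⟶ P.res.complex :=
    { f := fun j => ModuleCat.ofHom (LinearMap.lsmul F.PolyRing _ (MvPolynomial.X d : F.PolyRing))
      comm' := fun j k _ => ModuleCat.hom_ext (LinearMap.ext fun x =>
        (map_smul (P.res.complex.d j k).hom (MvPolynomial.X d : F.PolyRing) x)) }
  have hφ : φ.f 0 ≫ P.res.π.f 0 = P.res.π.f 0 ≫ (0 : F.trivialModule ⟶ F.trivialModule) := by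
    refine ModuleCat.hom_ext (LinearMap.ext fun x => ?_)
    have h1 : ∀ y : F.trivialModule, (MvPolynomial.X d : F.PolyRing) • y = 0 := fun y => by
      change MvPolynomial.constantCoeff (MvPolynomial.X d : F.PolyRing) • y = 0
      rw [MvPolynomial.constantCoeff_X, zero_smul]
    exact (map_smul (P.res.π.f 0).hom (MvPolynomial.X d : F.PolyRing) x).trans (h1 _)
  have h := torClass_naturality φ 0 hφ i z
  have hT : ((torComplexMap φ).f i).hom =
      LinearMap.lsmul F.PolyRing _ (MvPolynomial.X d : F.PolyRing) :=
    TensorProduct.ext' fun a x => TensorProduct.tmul_smul (MvPolynomial.X d : F.PolyRing) a x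
  have hz : HomologicalComplex.cyclesMap (torComplexMap φ) i z =
      (MvPolynomial.X d : F.PolyRing) • z := by
    refine iCycles_injective _ i ?_
    rw [iCycles_cyclesMap, map_smul]
    exact congrArg (fun ψ => ψ (P.torComplex.iCycles i z)) hT
  have h' := torClass_naturality (P := P) (Q := P) 0 0
    (Limits.zero_comp.trans Limits.comp_zero.symm : _ = P.res.π.f 0 ≫ (0 : F.trivialModule ⟶ F.trivialModule)) i z
  have hT0 : ((torComplexMap (0 : P.res.complex ⟶ P.res.complex)).f i).hom = 0 :=
    TensorProduct.ext' fun a x => TensorProduct.tmul_zero _ a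
  have hz0 : HomologicalComplex.cyclesMap (torComplexMap (0 : P.res.complex ⟶ P.res.complex)) i z =
      0 := by
    refine iCycles_injective _ i ?_
    rw [iCycles_cyclesMap, map_zero]
    exact congrArg (fun ψ => ψ (P.torComplex.iCycles i z)) hT0
  rw [hz, map_smul, ← h', hz0, map_zero] at h
  exact h

end GradedResolution

end CompleteFan

/-! ### The Koszul complex of a polynomial ring and its contracting homotopy. -/

section Koszul

/-- The basis vector `x^a e_S` of the Koszul complex. -/
def koszulVec {σ : Type*} (k : Type*) [CommRing k] (a : σ →₀ ℕ) (S : Finset σ) : Finset σ →₀ MvPolynomial σ k :=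
  Finsupp.single S (MvPolynomial.monomial a 1)

theorem koszul_hom_ext {σ k Y : Type*} [CommRing k] [AddCommGroup Y] [Module k Y]
    {φ ψ : (Finset σ →₀ MvPolynomial σ k) →ₗ[k] Y}
    (h : ∀ a S, φ (koszulVec k a S) = ψ (koszulVec k a S)) : φ = ψ :=
  Finsupp.lhom_ext' fun S => (MvPolynomial.basisMonomials σ k).ext fun a => by
    simpa [koszulVec] using h a S

variable {σ : Type*} [LinearOrder σ] {k : Type*} [CommRing k]

/-- The sign of `d` in the boundary of the simplex `S`. -/
def koszulSign (d : σ) (S : Finset σ) : ℤ := (-1) ^ (S.filter (· < d)).card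

theorem koszulSign_eq_one {d : σ} {S : Finset σ} (h : ∀ e ∈ S, d ≤ e) : koszulSign d S = 1 := by
  rw [koszulSign, Finset.filter_false_of_mem fun e he => not_lt.2 (h e he)]
  simp

theorem koszulSign_insert_of_lt {d e : σ} {S : Finset σ} (h : e < d) (he : e ∉ S) :
    koszulSign d (insert e S) = -koszulSign d S := by
  rw [koszulSign, Finset.filter_insert, if_pos h, Finset.card_insert_of_notMem (by simp [he]),
    pow_succ, koszulSign]
  ring

theorem koszulSign_erase_of_lt {d e : σ} {S : Finset σ} (h : e < d) (he : e ∈ S) :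
    koszulSign d (S.erase e) = -koszulSign d S := by
  have := koszulSign_insert_of_lt h (Finset.notMem_erase e S)
  rw [Finset.insert_erase he] at this
  rw [this, neg_neg]

theorem koszulSign_erase_of_le {d e : σ} {S : Finset σ} (h : d ≤ e) :
    koszulSign d (S.erase e) = koszulSign d S := by
  rw [koszulSign, koszulSign, Finset.filter_erase, Finset.erase_eq_of_notMem]
  simp [h]

/-- Removing the smaller element first flips the sign of the larger one; in the other order nothing
changes. -/
theorem koszulSign_mul_swap {d e : σ} {S : Finset σ} (hd : d ∈ S) (he : e ∈ S) (hde : d ≠ e) :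
    koszulSign d S * koszulSign e (S.erase d) + koszulSign e S * koszulSign d (S.erase e) = 0 := by
  rcases lt_or_gt_of_ne hde with h | h
  · rw [koszulSign_erase_of_lt h hd, koszulSign_erase_of_le h.le]
    ring
  · rw [koszulSign_erase_of_lt h he, koszulSign_erase_of_le h.le]
    ring

variable (σ k) in
/-- The differential of the total Koszul complex of the variables of a polynomial ring. -/
def koszulDiff : (Finset σ →₀ MvPolynomial σ k) →ₗ[MvPolynomial σ k]
    (Finset σ →₀ MvPolynomial σ k) :=
  Finsupp.linearCombination _ fun S =>
    ∑ d ∈ S, koszulSign d S • Finsupp.single (S.erase d) (MvPolynomial.X d)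

theorem koszulDiff_vec (a : σ →₀ ℕ) (S : Finset σ) : koszulDiff σ k (koszulVec k a S) =
    ∑ d ∈ S, koszulSign d S • koszulVec k (a + Finsupp.single d 1) (S.erase d) := by
  rw [koszulDiff, koszulVec, Finsupp.linearCombination_single, Finset.smul_sum]
  refine Finset.sum_congr rfl fun d _ => ?_
  rw [smul_comm, Finsupp.smul_single, smul_eq_mul, MvPolynomial.X, MvPolynomial.monomial_mul,
    one_mul, koszulVec]

theorem koszulDiff_koszulDiff (x : Finset σ →₀ MvPolynomial σ k) :
    koszulDiff σ k (koszulDiff σ k x) = 0 := by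
  have : ((koszulDiff σ k).restrictScalars k).comp ((koszulDiff σ k).restrictScalars k) = 0 := by
    refine koszul_hom_ext fun a S => ?_
    simp only [LinearMap.comp_apply, LinearMap.restrictScalars_apply, LinearMap.zero_apply,
      koszulDiff_vec, map_sum, map_zsmul, Finset.smul_sum, smul_smul]
    rw [Finset.sum_sigma']
    refine Finset.sum_involution (fun p _ => ⟨p.2, p.1⟩) ?_ ?_ ?_ ?_
    · rintro ⟨d, e⟩ h
      simp only [Finset.mem_sigma, Finset.mem_erase] at h
      dsimp only
      rw [add_right_comm, Finset.erase_right_comm (a := e), ← add_smul,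
        koszulSign_mul_swap h.1 h.2.2 (Ne.symm h.2.1), zero_smul]
    · rintro ⟨d, e⟩ h - heq
      simp only [Finset.mem_sigma, Finset.mem_erase] at h
      exact h.2.1 (congrArg Sigma.fst heq)
    · rintro ⟨d, e⟩ h
      simp only [Finset.mem_sigma, Finset.mem_erase] at h ⊢
      exact ⟨h.2.2, Ne.symm h.2.1, h.1⟩
    · rintro ⟨d, e⟩ h
      rfl
  exact congrArg (fun ψ => ψ x) this

/-- `d` is the smallest variable that occurs in `x^a e_S`. -/
def IsFirstVar (a : σ →₀ ℕ) (S : Finset σ) (d : σ) : Prop :=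
  IsLeast ((a.support ∪ S : Finset σ) : Set σ) d

open Classical in
variable (k) in
/-- The value of the contracting homotopy of the Koszul complex at `x^a e_S`. -/
def koszulHomotopyVec (a : σ →₀ ℕ) (S : Finset σ) : Finset σ →₀ MvPolynomial σ k :=
  if h : ∃ d, IsFirstVar a S d ∧ d ∉ S then
    koszulVec k (a - Finsupp.single h.choose 1) (insert h.choose S)
  else 0

variable (σ k) in
/-- A contracting homotopy of the Koszul complex. -/
def koszulHomotopy : (Finset σ →₀ MvPolynomial σ k) →ₗ[k] (Finset σ →₀ MvPolynomial σ k) :=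
  Finsupp.lsum k fun S => (MvPolynomial.basisMonomials σ k).constr k fun a =>
    koszulHomotopyVec k a S

theorem koszulHomotopy_vec (a : σ →₀ ℕ) (S : Finset σ) :
    koszulHomotopy σ k (koszulVec k a S) = koszulHomotopyVec k a S := by
  rw [koszulHomotopy, koszulVec, Finsupp.lsum_single]
  exact Module.Basis.constr_basis _ _ _ a

theorem koszulHomotopyVec_of_notMem {a : σ →₀ ℕ} {S : Finset σ} {d : σ} (h : IsFirstVar a S d)
    (hd : d ∉ S) :
    koszulHomotopyVec k a S = koszulVec k (a - Finsupp.single d 1) (insert d S) := by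
  have hex : ∃ d, IsFirstVar a S d ∧ d ∉ S := ⟨d, h, hd⟩
  rw [koszulHomotopyVec, dif_pos hex, hex.choose_spec.1.unique h]

theorem koszulHomotopyVec_of_mem {a : σ →₀ ℕ} {S : Finset σ} {d : σ} (h : IsFirstVar a S d)
    (hd : d ∈ S) : koszulHomotopyVec k a S = 0 :=
  dif_neg fun ⟨_, he, heS⟩ => heS (he.unique h ▸ hd)

theorem koszulHomotopyVec_zero_empty : koszulHomotopyVec k (0 : σ →₀ ℕ) ∅ = 0 :=
  dif_neg fun ⟨_, he, _⟩ => by simpa using he.1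

theorem koszulHomotopyVec_card {a : σ →₀ ℕ} {S : Finset σ} {i : ℕ} (hS : S.card = i) :
    koszulHomotopyVec k a S ∈ Finsupp.supported (MvPolynomial σ k) (MvPolynomial σ k)
      {T : Finset σ | T.card = i + 1} := by
  by_cases h : ∃ d, IsFirstVar a S d ∧ d ∉ S
  · obtain ⟨d, h1, h2⟩ := h
    rw [koszulHomotopyVec_of_notMem h1 h2]
    exact Finsupp.single_mem_supported _ _ (by simp [Finset.card_insert_of_notMem h2, hS])
  · rw [koszulHomotopyVec, dif_neg h]
    exact zero_mem _

/-- A term of the differential moves a variable from the exterior part to the monomial, so the set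
of occurring variables is unchanged. -/
theorem IsFirstVar.erase {a : σ →₀ ℕ} {S : Finset σ} {d e : σ} (h : IsFirstVar a S d)
    (he : e ∈ S) : IsFirstVar (a + Finsupp.single e 1) (S.erase e) d := by
  classical
  have heq : (a + Finsupp.single e 1).support ∪ S.erase e = a.support ∪ S := by
    ext s
    by_cases hs : s = e
    · subst hs
      simp [he]
    · simp [hs]
  rw [IsFirstVar, heq]
  exact h

/-- The homotopy moves the first variable `d` from the monomial to the exterior part. If `d ∈ S`,
only the `d`-term of the differential survives. If not, the `d`-term of the other composite returns
the vector, with sign 1 since `d` is smallest, and the remaining terms cancel because inserting `d`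
flips every other sign. -/
theorem koszul_homotopy_vec {a : σ →₀ ℕ} {S : Finset σ} {d : σ} (h : IsFirstVar a S d) :
    koszulDiff σ k (koszulHomotopyVec k a S) + koszulHomotopy σ k (koszulDiff σ k (koszulVec k a S)) =
      koszulVec k a S := by
  have hmin : ∀ e ∈ S, d ≤ e := fun e he => h.2 (by simp [he])
  rw [koszulDiff_vec, map_sum]
  simp only [map_zsmul, koszulHomotopy_vec]
  by_cases hd : d ∈ S
  · rw [koszulHomotopyVec_of_mem h hd, map_zero, zero_add, Finset.sum_eq_single_of_mem d hd,
      koszulSign_eq_one hmin, one_smul,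
      koszulHomotopyVec_of_notMem (h.erase hd) (Finset.notMem_erase d S), Finset.insert_erase hd,
      add_tsub_cancel_right]
    intro e he hed
    rw [koszulHomotopyVec_of_mem (h.erase he) (Finset.mem_erase.2 ⟨Ne.symm hed, hd⟩), smul_zero]
  · have hda : Finsupp.single d 1 ≤ a := by
      rw [Finsupp.single_le_iff]
      have : d ∈ a.support ∪ S := h.1
      rw [Finset.mem_union, or_iff_left hd, Finsupp.mem_support_iff] at this
      omega
    rw [koszulHomotopyVec_of_notMem h hd, koszulDiff_vec, Finset.sum_insert hd,
      Finset.erase_insert hd, tsub_add_cancel_of_le hda, koszulSign_eq_one, one_smul, add_assoc,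
      ← Finset.sum_add_distrib, Finset.sum_eq_zero, add_zero]
    · intro e he
      have hde : d ≠ e := fun h' => hd (h' ▸ he)
      have hdS : d ∉ S.erase e := fun h' => hd (Finset.mem_of_mem_erase h')
      rw [koszulHomotopyVec_of_notMem (h.erase he) hdS, koszulSign_insert_of_lt
        (lt_of_le_of_ne (hmin e he) hde) hd, Finset.erase_insert_of_ne hde,
        tsub_add_eq_add_tsub hda, neg_smul, neg_add_cancel]
    · intro e he
      rcases Finset.mem_insert.1 he with rfl | he
      · exact le_rfl
      · exact hmin e he

/-- The terms of the Koszul complex: the chains supported on the subsets with `i` elements. -/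
def koszulModule (σ k : Type*) [CommRing k] (i : ℕ) :
    Submodule (MvPolynomial σ k) (Finset σ →₀ MvPolynomial σ k) :=
  Finsupp.supported _ _ {S : Finset σ | S.card = i}

theorem koszulDiff_mem {i : ℕ} {x : Finset σ →₀ MvPolynomial σ k}
    (hx : x ∈ koszulModule σ k (i + 1)) : koszulDiff σ k x ∈ koszulModule σ k i := by
  rw [koszulModule, Finsupp.supported_eq_span_single] at hx
  refine (Submodule.span_le (p := (koszulModule σ k i).comap (koszulDiff σ k))).2 ?_ hx
  rintro _ ⟨S, hS : S.card = i + 1, rfl⟩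
  rw [SetLike.mem_coe, Submodule.mem_comap, koszulDiff, Finsupp.linearCombination_single, one_smul]
  refine sum_mem fun d hd => zsmul_mem (Finsupp.single_mem_supported _ _ ?_) _
  change (S.erase d).card = i
  rw [Finset.card_erase_of_mem hd, hS, Nat.add_sub_cancel]

theorem koszulDiff_eq_zero {x : Finset σ →₀ MvPolynomial σ k} (hx : x ∈ koszulModule σ k 0) :
    koszulDiff σ k x = 0 := by
  rw [koszulModule, Finsupp.supported_eq_span_single] at hx
  refine (Submodule.span_le (p := LinearMap.ker (koszulDiff σ k))).2 ?_ hx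
  rintro _ ⟨S, hS : S.card = 0, rfl⟩
  rw [Finset.card_eq_zero.1 hS, SetLike.mem_coe, LinearMap.mem_ker, koszulDiff,
    Finsupp.linearCombination_single, Finset.sum_empty, smul_zero]

variable (σ k) in
/-- The differentials of the Koszul complex. -/
def koszulD (i : ℕ) : koszulModule σ k (i + 1) →ₗ[MvPolynomial σ k] koszulModule σ k i :=
  (koszulDiff σ k).restrict fun _ hx => koszulDiff_mem hx

theorem coe_koszulD (i : ℕ) (x : koszulModule σ k (i + 1)) :
    (koszulD σ k i x : Finset σ →₀ MvPolynomial σ k) = koszulDiff σ k x := rfl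

theorem koszulD_koszulD (i : ℕ) (x : koszulModule σ k (i + 1 + 1)) :
    koszulD σ k i (koszulD σ k (i + 1) x) = 0 :=
  Subtype.ext (koszulDiff_koszulDiff x.1)

theorem koszulHomotopy_mem {i : ℕ} {x : Finset σ →₀ MvPolynomial σ k}
    (hx : x ∈ koszulModule σ k i) : koszulHomotopy σ k x ∈ koszulModule σ k (i + 1) := by
  rw [← Finsupp.sum_single x, Finsupp.sum, map_sum]
  refine sum_mem fun S hS => ?_
  have hcard : S.card = i := (Finsupp.mem_supported _ _).1 hx hS
  rw [(x S).as_sum, Finsupp.single_finsetSum, map_sum]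
  refine sum_mem fun a _ => ?_
  have : Finsupp.single S (MvPolynomial.monomial a ((x S).coeff a)) =
      (x S).coeff a • koszulVec k a S := by
    rw [koszulVec, Finsupp.smul_single, MvPolynomial.smul_monomial, smul_eq_mul, mul_one]
  rw [this, map_smul, koszulHomotopy_vec]
  exact ((koszulModule σ k (i + 1)).restrictScalars k).smul_mem _ (koszulHomotopyVec_card hcard)

/-- The basis of a term of the Koszul complex. -/
def koszulBasis (σ k : Type*) [CommRing k] (i : ℕ) :
    Module.Basis {S : Finset σ // S.card = i} (MvPolynomial σ k) (koszulModule σ k i) :=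
  Module.Basis.ofRepr (Finsupp.supportedEquivFinsupp {S : Finset σ | S.card = i})

theorem coe_koszulBasis (σ k : Type*) [CommRing k] (i : ℕ) (S : {S : Finset σ // S.card = i}) :
    (koszulBasis σ k i S : Finset σ →₀ MvPolynomial σ k) = Finsupp.single S.1 1 := by
  exact Finsupp.supportedEquivFinsupp_symm_single (R := MvPolynomial σ k)
    {S : Finset σ | S.card = i} S (1 : MvPolynomial σ k)

/-- The homotopy formula: the Koszul complex is contractible up to its constants. -/
theorem koszul_homotopy (x : Finset σ →₀ MvPolynomial σ k) :
    koszulDiff σ k (koszulHomotopy σ k x) + koszulHomotopy σ k (koszulDiff σ k x) =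
      x - Finsupp.single ∅ (MvPolynomial.C (MvPolynomial.constantCoeff (x ∅))) := by
  classical
  let ε : (Finset σ →₀ MvPolynomial σ k) →ₗ[k] (Finset σ →₀ MvPolynomial σ k) :=
    (Finsupp.lsingle ∅).comp ((Algebra.linearMap k (MvPolynomial σ k)).comp
      ((MvPolynomial.lcoeff k 0).comp (Finsupp.lapply ∅)))
  have : ((koszulDiff σ k).restrictScalars k).comp (koszulHomotopy σ k) +
      (koszulHomotopy σ k).comp ((koszulDiff σ k).restrictScalars k) =
      LinearMap.id - ε := by
    refine koszul_hom_ext fun a S => ?_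
    simp only [LinearMap.comp_apply, LinearMap.restrictScalars_apply, LinearMap.add_apply,
      LinearMap.sub_apply, LinearMap.id_apply]
    by_cases h : (a.support ∪ S).Nonempty
    · obtain ⟨d, hd⟩ : ∃ d, IsFirstVar a S d := ⟨_, Finset.isLeast_min' _ h⟩
      have hε : ε (koszulVec k a S) = 0 := by
        have : MvPolynomial.coeff 0 ((koszulVec k a S) ∅) = 0 := by
          rw [koszulVec, Finsupp.single_apply]
          split_ifs with hS
          · rw [MvPolynomial.coeff_monomial, if_neg]
            rintro rfl
            simp [hS] at h
          · simp
        simp [ε, this]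
      rw [hε, koszulHomotopy_vec, koszul_homotopy_vec hd, sub_zero]
    · rw [Finset.not_nonempty_iff_eq_empty, Finset.union_eq_empty, Finsupp.support_eq_empty] at h
      obtain ⟨rfl, rfl⟩ := h
      rw [koszulHomotopy_vec, koszulDiff_vec, koszulHomotopyVec_zero_empty]
      simp [ε, koszulVec]
  exact congrArg (fun ψ => ψ x) this

theorem constantCoeff_koszulDiff (x : Finset σ →₀ MvPolynomial σ k) :
    MvPolynomial.constantCoeff (koszulDiff σ k x ∅) = 0 := by
  have : ((MvPolynomial.lcoeff k 0).comp (Finsupp.lapply ∅)).comp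
      ((koszulDiff σ k).restrictScalars k) = 0 := by
    refine koszul_hom_ext fun a S => ?_
    simp only [LinearMap.comp_apply, LinearMap.restrictScalars_apply, koszulDiff_vec, map_sum,
      map_zsmul, LinearMap.zero_apply]
    refine Finset.sum_eq_zero fun d _ => ?_
    have : MvPolynomial.coeff 0 (koszulVec k (a + Finsupp.single d 1) (S.erase d) ∅) = 0 := by
      rw [koszulVec, Finsupp.single_apply]
      split_ifs
      · rw [MvPolynomial.coeff_monomial, if_neg]
        intro h
        simpa using DFunLike.congr_fun h d
      · simp
    simp [this]
  exact congrArg (fun ψ => ψ x) this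

theorem exists_koszulDiff_eq {i : ℕ} {x : Finset σ →₀ MvPolynomial σ k}
    (hx : x ∈ koszulModule σ k i) (hd : koszulDiff σ k x = 0)
    (h0 : MvPolynomial.constantCoeff (x ∅) = 0) :
    ∃ w ∈ koszulModule σ k (i + 1), koszulDiff σ k w = x := by
  refine ⟨_, koszulHomotopy_mem hx, ?_⟩
  have h := koszul_homotopy x
  rwa [hd, h0, map_zero, map_zero, Finsupp.single_zero, add_zero, sub_zero] at h

end Koszul

/-! ### The Koszul complex as a projective resolution of ℂ. -/

namespace CompleteFan

variable {V : Type u} [NormedAddCommGroup V] [NormedSpace ℝ V]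
variable {N : Submodule ℤ V} (F : CompleteFan N) (deg : N → ℂ)

open Classical in
/-- An order of the rays, to fix the signs in the Koszul complex. -/
instance rayGensLinearOrder : LinearOrder F.rayGens := linearOrderOfSTO WellOrderingRel

/-- The Koszul complex of the variables of `R`. -/
def koszulComplex : ChainComplex (ModuleCat.{u} F.PolyRing) ℕ :=
  ChainComplex.of (fun i => ModuleCat.of F.PolyRing (koszulModule F.rayGens ℂ i))
    (fun i => ModuleCat.ofHom (koszulD F.rayGens ℂ i))
    fun i => ModuleCat.hom_ext (LinearMap.ext (koszulD_koszulD i))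

theorem koszulComplex_d (i : ℕ) :
    F.koszulComplex.d (i + 1) i = ModuleCat.ofHom (koszulD F.rayGens ℂ i) :=
  ChainComplex.of_d (fun i => ModuleCat.of F.PolyRing (koszulModule F.rayGens ℂ i))
    (fun i => ModuleCat.ofHom (koszulD F.rayGens ℂ i)) i

theorem koszulComplex_d_apply (i : ℕ) (x : koszulModule F.rayGens ℂ (i + 1)) :
    (F.koszulComplex.d (i + 1) i).hom x = koszulD F.rayGens ℂ i x :=
  congrArg (fun ψ => ψ.hom x) (F.koszulComplex_d i)

/-- The augmentation of the Koszul complex. -/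
def koszulAugmentation : koszulModule F.rayGens ℂ 0 →ₗ[F.PolyRing] F.trivialModule where
  toFun x := ULift.up (MvPolynomial.constantCoeff (x.1 ∅))
  map_add' _ _ := congrArg ULift.up (map_add MvPolynomial.constantCoeff _ _)
  map_smul' r _ := congrArg ULift.up (map_mul MvPolynomial.constantCoeff r _)

/-- The augmentation of the Koszul complex as a morphism. -/
def koszulε : F.koszulComplex.X 0 ⟶ F.trivialModule :=
  (ModuleCat.ofHom (R := F.PolyRing) (X := koszulModule F.rayGens ℂ 0) (Y := F.trivialModule)
    F.koszulAugmentation :)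

theorem koszulComplex_d_ε : F.koszulComplex.d 1 0 ≫ F.koszulε = 0 := by
  refine (congrArg (· ≫ F.koszulε) (F.koszulComplex_d 0)).trans ?_
  exact ModuleCat.hom_ext (LinearMap.ext fun x => congrArg ULift.up (constantCoeff_koszulDiff x.1))

theorem koszulComplex_exactAt (i : ℕ) : F.koszulComplex.ExactAt (i + 1) := by
  rw [HomologicalComplex.exactAt_iff' _ (i + 2) (i + 1) i (by simp) (by simp),
    ShortComplex.moduleCat_exact_iff]
  intro (x : koszulModule F.rayGens ℂ (i + 1)) hx
  have hx' : koszulD F.rayGens ℂ i x = 0 :=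
    (F.koszulComplex_d_apply i x).symm.trans hx
  have h0 : x.1 ∅ = 0 := by
    by_contra h
    have : (∅ : Finset F.rayGens).card = i + 1 :=
      (Finsupp.mem_supported _ _).1 x.2 (Finsupp.mem_support_iff.2 h)
    simp at this
  obtain ⟨w, hw, hwx⟩ := exists_koszulDiff_eq x.2 (congrArg Subtype.val hx') (by rw [h0, map_zero])
  have h2 : koszulD F.rayGens ℂ (i + 1) ⟨w, hw⟩ = x := Subtype.ext hwx
  exact ⟨(⟨w, hw⟩ : koszulModule F.rayGens ℂ (i + 1 + 1)),
    (F.koszulComplex_d_apply (i + 1) ⟨w, hw⟩).trans h2⟩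

/-- The augmentation of the Koszul complex as a map of complexes. -/
def koszulπ : F.koszulComplex ⟶ (ChainComplex.single₀ _).obj F.trivialModule :=
  (ChainComplex.toSingle₀Equiv _ _).symm ⟨F.koszulε, F.koszulComplex_d_ε⟩

theorem koszulπ_f_zero : F.koszulπ.f 0 = F.koszulε :=
  ChainComplex.toSingle₀Equiv_symm_apply_f_zero F.koszulε F.koszulComplex_d_ε

instance koszulπ_quasiIso : QuasiIso F.koszulπ where
  quasiIsoAt n := by
    cases n with
    | zero =>
      rw [ChainComplex.quasiIsoAt₀_iff, ShortComplex.quasiIso_iff_of_zeros' _ rfl rfl rfl]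
      constructor
      · rw [ShortComplex.moduleCat_exact_iff]
        intro (x : koszulModule F.rayGens ℂ 0) hx
        have hx0 : F.koszulAugmentation x = 0 :=
          (congrArg (fun ψ => ψ.hom x) F.koszulπ_f_zero).symm.trans hx
        obtain ⟨w, hw, hwx⟩ := exists_koszulDiff_eq x.2 (koszulDiff_eq_zero x.2)
          (congrArg ULift.down hx0)
        have h2 : koszulD F.rayGens ℂ 0 ⟨w, hw⟩ = x := Subtype.ext hwx
        exact ⟨(⟨w, hw⟩ : koszulModule F.rayGens ℂ (0 + 1)),
          (F.koszulComplex_d_apply 0 ⟨w, hw⟩).trans h2⟩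
      · refine (ModuleCat.epi_iff_surjective _).2 fun c => ?_
        let x : koszulModule F.rayGens ℂ 0 := ⟨Finsupp.single ∅ (MvPolynomial.C c.down),
          Finsupp.single_mem_supported _ _ rfl⟩
        have h1 : F.koszulAugmentation x = c := by
          refine congrArg ULift.up ?_
          simp [x]
        exact ⟨x, (congrArg (fun ψ => ψ.hom x) F.koszulπ_f_zero).trans h1⟩
    | succ n =>
      rw [quasiIsoAt_iff_exactAt']
      · exact F.koszulComplex_exactAt n
      · exact ChainComplex.exactAt_succ_single_obj _ _

/-- The Koszul resolution of `ℂ`. -/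
def koszulResolution : ProjectiveResolution F.trivialModule where
  complex := F.koszulComplex
  projective i := ModuleCat.projective_of_free (koszulBasis F.rayGens ℂ i)
  π := F.koszulπ

end CompleteFan

/-! ### Graded free modules and their tensor products with the deformed ring. -/

namespace CompleteFan

variable {V : Type u} [NormedAddCommGroup V] [NormedSpace ℝ V]
variable {N : Submodule ℤ V} (F : CompleteFan N) (deg : N → ℂ)

instance isScalarTower_deformedRing : IsScalarTower ℂ F.PolyRing F.DeformedRing :=
  IsScalarTower.of_algebraMap_smul fun c x => by
    change F.polyMap (algebraMap ℂ F.PolyRing c) * x = c • x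
    rw [AlgHom.commutes, ← Algebra.smul_def]

/-- The degree of the variable `y^d`. -/
def rayDegree (d : F.rayGens) : N × ℂ := (d.1, deg d.1)

/-- The degree of the monomial with exponents `a`. -/
def monomialDegree (a : F.rayGens →₀ ℕ) : N × ℂ := a.sum fun d k => k • F.rayDegree deg d

theorem monomialDegree_add (a b : F.rayGens →₀ ℕ) :
    F.monomialDegree deg (a + b) = F.monomialDegree deg a + F.monomialDegree deg b :=
  Finsupp.sum_add_index' (fun _ => zero_smul _ _) fun _ _ _ => add_smul _ _ _

theorem monomialDegree_zero : F.monomialDegree deg 0 = 0 := Finsupp.sum_zero_index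

theorem monomialDegree_single (d : F.rayGens) :
    F.monomialDegree deg (Finsupp.single d 1) = F.rayDegree deg d := by
  simp [monomialDegree]

variable {F deg}

theorem monomial_smul_mem {X : Type*} [AddCommGroup X] [Module F.PolyRing X] {𝒢 : N × ℂ → Set X}
    (h : ∀ d g, ∀ x ∈ 𝒢 g, (MvPolynomial.X d : F.PolyRing) • x ∈ 𝒢 (F.rayDegree deg d + g))
    (a : F.rayGens →₀ ℕ) {g : N × ℂ} {x : X} (hx : x ∈ 𝒢 g) :
    (MvPolynomial.monomial a 1 : F.PolyRing) • x ∈ 𝒢 (F.monomialDegree deg a + g) := by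
  induction a using Finsupp.induction_linear generalizing g x with
  | zero => rwa [monomialDegree_zero, zero_add, ← MvPolynomial.one_def, one_smul]
  | add a b ha hb =>
    rw [monomialDegree_add, add_assoc, ← one_mul (1 : ℂ), ← MvPolynomial.monomial_mul, mul_smul]
    exact ha (hb hx)
  | single d n =>
    induction n generalizing g x with
    | zero =>
      rwa [Finsupp.single_zero, monomialDegree_zero, zero_add, ← MvPolynomial.one_def, one_smul]
    | succ n ih =>
      rw [add_comm n 1, Finsupp.single_add, monomialDegree_add, add_assoc, ← one_mul (1 : ℂ),
        ← MvPolynomial.monomial_mul, mul_smul, monomialDegree_single]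
      exact h d _ _ (ih hx)

/-- The product of y^d and y^n is nonzero only if d and n lie in a common cone, and there `deg` is
additive. -/
theorem X_smul_mem_deformedGrading (hdeg : F.IsDegreeFunction deg) (d : F.rayGens) (g : N × ℂ)
    (x : F.DeformedRing) (hx : x ∈ F.deformedGrading deg g) :
    (MvPolynomial.X d : F.PolyRing) • x ∈ F.deformedGrading deg (F.rayDegree deg d + g) := by
  let μ : F.DeformedRing →ₗ[ℂ] F.DeformedRing :=
    Algebra.lsmul ℂ ℂ F.DeformedRing (MvPolynomial.X d : F.PolyRing)
  refine (Submodule.span_le (p := (F.deformedGrading deg (F.rayDegree deg d + g)).comap μ)).2 ?_ hx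
  rintro _ ⟨n, rfl, rfl⟩
  change (MvPolynomial.X d : F.PolyRing) • DeformedRing.y F n ∈ F.deformedGrading deg _
  rw [X_smul_y, DeformedRing.yMul]
  split_ifs with h
  · obtain ⟨C, hC, h1, h2⟩ := h
    refine Submodule.subset_span ⟨d.1 + n, ?_, rfl⟩
    rw [hdeg.deg_add hC h1 h2]
    rfl
  · exact zero_mem _

section Free

variable {ι : Type u} {X : ModuleCat.{u} F.PolyRing} (B : Module.Basis ι F.PolyRing X)
  (w : ι → N × ℂ)

/-- The basis over `ℂ` of a free `R`-module. -/
def monomialBasis : Module.Basis ((F.rayGens →₀ ℕ) × ι) ℂ X :=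
  (MvPolynomial.basisMonomials F.rayGens ℂ).smulTower B

theorem monomialBasis_apply (a : F.rayGens →₀ ℕ) (i : ι) :
    monomialBasis B (a, i) = (MvPolynomial.monomial a 1 : F.PolyRing) • B i := by
  rw [monomialBasis, Module.Basis.smulTower_apply, MvPolynomial.coe_basisMonomials]

variable (deg) in
/-- The grading of a free `R`-module in which the basis vectors have prescribed degrees. -/
def freeGrading : N × ℂ → Submodule ℂ X :=
  basisGrading (monomialBasis B) fun p => F.monomialDegree deg p.1 + w p.2

theorem basis_mem_freeGrading (i : ι) : B i ∈ freeGrading deg B w (w i) := by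
  refine Submodule.subset_span ⟨(0, i), ?_, ?_⟩
  · simp [monomialDegree_zero]
  · rw [monomialBasis_apply, ← MvPolynomial.one_def, one_smul]

theorem isGrading_freeGrading : F.IsGrading deg X (freeGrading deg B w) where
  iSupIndep := basisGrading_iSupIndep _ _
  iSup_eq_top := basisGrading_iSup _ _
  smul_mem d g x hx := by
    let μ : X →ₗ[ℂ] X := Algebra.lsmul ℂ ℂ X (MvPolynomial.X d : F.PolyRing)
    refine (Submodule.span_le (p := (freeGrading deg B w ((d.1, deg d.1) + g)).comap μ)).2 ?_ hx
    rintro _ ⟨⟨a, i⟩, rfl, rfl⟩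
    refine Submodule.subset_span ⟨(Finsupp.single d 1 + a, i), ?_, ?_⟩
    · change F.monomialDegree deg (Finsupp.single d 1 + a) + w i = _
      rw [monomialDegree_add, monomialDegree_single, add_assoc]
      rfl
    · change _ = (MvPolynomial.X d : F.PolyRing) • monomialBasis B (a, i)
      rw [monomialBasis_apply, monomialBasis_apply, smul_smul, MvPolynomial.X,
        MvPolynomial.monomial_mul, one_mul]

/-- The tensor product of `ℂ[N]^Σ` with a free `R`-module. -/
def tensorEquiv : (F.deformedModule ⊗ X : ModuleCat.{u} F.PolyRing) ≃ₗ[F.PolyRing]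
    (ι →₀ F.DeformedRing) := by
  classical
  exact (TensorProduct.congr (LinearEquiv.refl F.PolyRing F.DeformedRing) B.repr).trans
    (TensorProduct.finsuppScalarRight F.PolyRing F.PolyRing F.DeformedRing ι)

theorem tensorEquiv_tmul (a : F.DeformedRing) (i : ι) :
    tensorEquiv B (a ⊗ₜ[F.PolyRing] B i) = Finsupp.single i a := by
  classical
  have h : tensorEquiv B (a ⊗ₜ[F.PolyRing] B i) =
    TensorProduct.finsuppScalarRight F.PolyRing F.PolyRing F.DeformedRing ι
      (a ⊗ₜ[F.PolyRing] B.repr (B i)) := rfl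
  rw [h, Module.Basis.repr_self, TensorProduct.finsuppScalarRight_apply_tmul]
  simp

/-- The basis over `ℂ` of the tensor product of `ℂ[N]^Σ` with a free `R`-module. -/
def tensorBasis : Module.Basis (Σ _ : ι, N) ℂ (F.deformedModule ⊗ X : ModuleCat.{u} F.PolyRing) :=
  (Finsupp.basis fun _ : ι => DeformedRing.y F).map ((tensorEquiv B).symm.restrictScalars ℂ)

theorem tensorBasis_apply (n : N) (i : ι) :
    tensorBasis B ⟨i, n⟩ = DeformedRing.y F n ⊗ₜ[F.PolyRing] B i := by
  have h : tensorBasis B ⟨i, n⟩ =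
      (tensorEquiv B).symm ((Finsupp.basis fun _ : ι => DeformedRing.y F) ⟨i, n⟩) := rfl
  rw [h, LinearEquiv.symm_apply_eq, tensorEquiv_tmul, Finsupp.coe_basis]

/-- Monomial coefficients in the free factor pass through the tensor sign to ℂ[N]^Σ, where they act
homogeneously; only the tensors y^n ⊗ B_i remain. -/
theorem tensorGrading_freeGrading (hdeg : F.IsDegreeFunction deg) :
    F.tensorGrading deg (freeGrading deg B w) =
      basisGrading (tensorBasis B) fun p => (p.2, deg p.2) + w p.1 := by
  funext g
  refine le_antisymm (Submodule.span_le.2 ?_) (Submodule.span_le.2 ?_)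
  · rintro _ ⟨g₁, g₂, rfl, a, ha, x, hx, rfl⟩
    let G := basisGrading (tensorBasis B) fun p => (p.2, deg p.2) + w p.1
    let ψ' : X →ₗ[F.PolyRing] (F.deformedModule ⊗ X : ModuleCat.{u} F.PolyRing) :=
      TensorProduct.mk F.PolyRing F.DeformedRing X a
    let ψ : X →ₗ[ℂ] (F.deformedModule ⊗ X : ModuleCat.{u} F.PolyRing) := ψ'.restrictScalars ℂ
    let φ' (x : X) : F.DeformedRing →ₗ[F.PolyRing]
        (F.deformedModule ⊗ X : ModuleCat.{u} F.PolyRing) :=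
      (TensorProduct.mk F.PolyRing F.DeformedRing X).flip x
    let φ (x : X) : F.DeformedRing →ₗ[ℂ] (F.deformedModule ⊗ X : ModuleCat.{u} F.PolyRing) :=
      (φ' x).restrictScalars ℂ
    have h1 : ∀ (i : ι) (g : N × ℂ) (a : F.DeformedRing), a ∈ F.deformedGrading deg g →
        φ (B i) a ∈ G (g + w i) := by
      intro i g a ha
      refine (Submodule.span_le (p := (G (g + w i)).comap (φ (B i)))).2 ?_ ha
      rintro _ ⟨n, rfl, rfl⟩
      exact Submodule.subset_span ⟨⟨i, n⟩, rfl, (tensorBasis_apply B n i).trans rfl⟩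
    refine (Submodule.span_le (p := (G (g₁ + g₂)).comap ψ)).2 ?_ hx
    rintro _ ⟨⟨b, i⟩, rfl, rfl⟩
    have h2 := monomial_smul_mem (𝒢 := fun g => (F.deformedGrading deg g : Set F.DeformedRing))
      (X_smul_mem_deformedGrading hdeg) b ha
    have h3 := h1 i _ _ h2
    have h4 : ψ (monomialBasis B (b, i)) =
        φ (B i) ((MvPolynomial.monomial b 1 : F.PolyRing) • a) := by
      rw [monomialBasis_apply]
      exact (TensorProduct.smul_tmul (MvPolynomial.monomial b 1 : F.PolyRing) a (B i)).symm
    rw [SetLike.mem_coe, Submodule.mem_comap, h4]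
    convert h3 using 2
    dsimp only
    abel
  · rintro _ ⟨⟨i, n⟩, rfl, rfl⟩
    exact Submodule.subset_span ⟨(n, deg n), w i, rfl, _, Submodule.subset_span ⟨n, rfl, rfl⟩, _,
      basis_mem_freeGrading B w i, tensorBasis_apply B n i⟩

end Free

end CompleteFan

/-! ### The grading of the Koszul resolution. -/

namespace CompleteFan

variable {V : Type u} [NormedAddCommGroup V] [NormedSpace ℝ V]
variable {N : Submodule ℤ V} (F : CompleteFan N) (deg : N → ℂ)

/-- The degree of the basis vector `e_S` of the Koszul complex. -/
def subsetDegree (S : Finset F.rayGens) : N × ℂ := ∑ d ∈ S, F.rayDegree deg d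

/-- The basis of a term of the Koszul complex. -/
def koszulComplexBasis (i : ℕ) : Module.Basis {S : Finset F.rayGens // S.card = i} F.PolyRing
    (F.koszulComplex.X i) :=
  koszulBasis F.rayGens ℂ i

/-- The grading of the Koszul complex. -/
def koszulGrading (i : ℕ) : N × ℂ → Submodule ℂ (F.koszulComplex.X i) :=
  freeGrading deg (F.koszulComplexBasis i) fun S => F.subsetDegree deg S.1

theorem isGrading_koszulGrading (i : ℕ) :
    F.IsGrading deg (F.koszulComplex.X i) (F.koszulGrading deg i) :=
  isGrading_freeGrading _ _

theorem koszulComplexBasis_mem (i : ℕ) (S : {S : Finset F.rayGens // S.card = i}) :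
    F.koszulComplexBasis i S ∈ F.koszulGrading deg i (F.subsetDegree deg S.1) :=
  basis_mem_freeGrading _ _ S

theorem koszulD_koszulBasis (i : ℕ) (S : {S : Finset F.rayGens // S.card = i + 1}) :
    koszulD F.rayGens ℂ i (koszulBasis F.rayGens ℂ (i + 1) S) =
      ∑ d : S.1, (MvPolynomial.X d.1 : F.PolyRing) • koszulSign d.1 S.1 •
        koszulBasis F.rayGens ℂ i ⟨S.1.erase d.1, by
          rw [Finset.card_erase_of_mem d.2, S.2, Nat.add_sub_cancel]⟩ := by
  refine Subtype.ext ?_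
  rw [coe_koszulD, coe_koszulBasis, koszulDiff, Finsupp.linearCombination_single, one_smul,
    ← Finset.sum_coe_sort, AddSubmonoidClass.coe_finsetSum]
  refine Finset.sum_congr rfl fun d _ => ?_
  rw [Submodule.coe_smul, AddSubgroupClass.coe_zsmul, coe_koszulBasis, smul_comm,
    Finsupp.smul_single (MvPolynomial.X d.1 : F.PolyRing), smul_eq_mul, mul_one]

theorem koszulComplex_d_basis (i : ℕ) (S : {S : Finset F.rayGens // S.card = i + 1}) :
    (F.koszulComplex.d (i + 1) i).hom (F.koszulComplexBasis (i + 1) S) =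
      ∑ d : S.1, (MvPolynomial.X d.1 : F.PolyRing) • koszulSign d.1 S.1 •
        F.koszulComplexBasis i ⟨S.1.erase d.1, by
          rw [Finset.card_erase_of_mem d.2, S.2, Nat.add_sub_cancel]⟩ :=
  (F.koszulComplex_d_apply i _).trans (F.koszulD_koszulBasis i S)

theorem koszulComplex_d_mem (i : ℕ) (g : N × ℂ) (x : F.koszulComplex.X (i + 1))
    (hx : x ∈ F.koszulGrading deg (i + 1) g) :
    (F.koszulComplex.d (i + 1) i).hom x ∈ F.koszulGrading deg i g := by
  have hgr := F.isGrading_koszulGrading deg i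
  refine (Submodule.span_le (p := (F.koszulGrading deg i g).comap
    ((F.koszulComplex.d (i + 1) i).hom.restrictScalars ℂ))).2 ?_ hx
  rintro _ ⟨⟨a, S⟩, rfl, rfl⟩
  rw [SetLike.mem_coe, Submodule.mem_comap, monomialBasis_apply, LinearMap.restrictScalars_apply,
    map_smul, koszulComplex_d_basis]
  have h4 : ∑ d : S.1, (MvPolynomial.X d.1 : F.PolyRing) • koszulSign d.1 S.1 •
      F.koszulComplexBasis i ⟨S.1.erase d.1, by
        rw [Finset.card_erase_of_mem d.2, S.2, Nat.add_sub_cancel]⟩ ∈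
      F.koszulGrading deg i (F.subsetDegree deg S.1) := by
    refine sum_mem fun d _ => ?_
    have h3 : F.subsetDegree deg S.1 =
        (d.1.1, deg d.1.1) + F.subsetDegree deg (S.1.erase d.1) :=
      (Finset.add_sum_erase _ _ d.2).symm
    rw [h3]
    exact hgr.smul_mem d.1 _ _ (zsmul_mem (F.koszulComplexBasis_mem deg i ⟨S.1.erase d.1, _⟩) _)
  exact monomial_smul_mem (𝒢 := fun g => (F.koszulGrading deg i g : Set (F.koszulComplex.X i)))
    hgr.smul_mem a h4

theorem koszulπ_basis (a : F.rayGens →₀ ℕ) (ha : a ≠ 0) (S : {S : Finset F.rayGens // S.card = 0}) :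
    (F.koszulπ.f 0).hom ((MvPolynomial.monomial a 1 : F.PolyRing) • F.koszulComplexBasis 0 S) =
      0 := by
  refine (congrArg (fun ψ => ψ.hom _) F.koszulπ_f_zero).trans ?_
  obtain ⟨S, hS⟩ := S
  obtain rfl := Finset.card_eq_zero.1 hS
  refine congrArg ULift.up ?_
  have h1 : ((MvPolynomial.monomial a 1 : F.PolyRing) • koszulBasis F.rayGens ℂ 0 ⟨∅, hS⟩).1 ∅ =
      MvPolynomial.monomial a 1 := by
    rw [Submodule.coe_smul, coe_koszulBasis]
    simp
  refine (congrArg MvPolynomial.constantCoeff h1).trans ?_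
  rw [MvPolynomial.constantCoeff_monomial, if_neg ha]

/-- The Koszul resolution is a graded resolution. -/
def koszulGradedResolution : F.GradedResolution deg where
  res := F.koszulResolution
  gr := F.koszulGrading deg
  isGrading := F.isGrading_koszulGrading deg
  d_mem i j g x hx := by
    by_cases hij : j + 1 = i
    · subst hij
      exact F.koszulComplex_d_mem deg j g x hx
    · have h0 : F.koszulComplex.d i j = 0 := F.koszulComplex.shape i j hij
      have h1 : (F.koszulComplex.d i j).hom x = 0 := congrArg (fun ψ => ψ.hom x) h0
      have h2 : (F.koszulComplex.d i j).hom x ∈ F.koszulGrading deg j g := h1 ▸ zero_mem _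
      exact h2
  π_eq_zero g hg x hx := by
    refine (Submodule.span_le
      (p := LinearMap.ker ((F.koszulπ.f 0).hom.restrictScalars ℂ))).2 ?_ hx
    rintro _ ⟨⟨a, S⟩, rfl, rfl⟩
    rw [SetLike.mem_coe, LinearMap.mem_ker, monomialBasis_apply]
    refine F.koszulπ_basis a (fun ha => hg ?_) S
    obtain ⟨S, hS⟩ := S
    obtain rfl := Finset.card_eq_zero.1 hS
    simp [ha, monomialDegree_zero, subsetDegree]

/-- The basis of a term of `ℂ[N]^Σ ⊗ K`, where `K` is the Koszul complex. -/
def koszulTorBasis (i : ℕ) : Module.Basis (Σ _ : {S : Finset F.rayGens // S.card = i}, N) ℂ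
    ((F.koszulGradedResolution deg).torComplex.X i) :=
  tensorBasis (F.koszulComplexBasis i)

theorem koszul_torComplexGrading (hdeg : F.IsDegreeFunction deg) (i : ℕ) :
    (F.koszulGradedResolution deg).torComplexGrading i =
      basisGrading (F.koszulTorBasis deg i) fun p => (p.2, deg p.2) + F.subsetDegree deg p.1.1 :=
  tensorGrading_freeGrading (F.koszulComplexBasis i) (fun S => F.subsetDegree deg S.1) hdeg

end CompleteFan

/-! ### Homology of graded complexes of vector spaces. -/

section GradedHomology

variable {Γ : Type*} {M C H : ℕ → Type*} [∀ i, AddCommGroup (M i)] [∀ i, Module ℂ (M i)]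
  [∀ i, AddCommGroup (C i)] [∀ i, Module ℂ (C i)] [∀ i, AddCommGroup (H i)] [∀ i, Module ℂ (H i)]
  {D : ∀ i, M (i + 1) →ₗ[ℂ] M i} {ι : ∀ i, C i →ₗ[ℂ] M i} {cl : ∀ i, C i →ₗ[ℂ] H i}
  {𝒢 : ∀ i, Γ → Submodule ℂ (M i)} {p : ∀ i, Γ → M i →ₗ[ℂ] M i}

/-- The grading of homology, for a graded complex with cycles `ι i : C i → M i` and classes
`cl i : C i → H i`. -/
def homologyGrading {M C H : Type*} [AddCommGroup M] [Module ℂ M]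
    [AddCommGroup C] [Module ℂ C] [AddCommGroup H] [Module ℂ H] (ι : C →ₗ[ℂ] M) (cl : C →ₗ[ℂ] H)
    (𝒢 : Γ → Submodule ℂ M) (g : Γ) : Submodule ℂ H :=
  ((𝒢 g).comap ι).map cl

/-- If a cycle of degree `g` is homologous to one without component in degree `g`, projecting the
bounding relation to degree `g` shows that it is itself a boundary. -/
theorem homologyGrading_iSupIndep {i : ℕ} (hcl : ∀ z, cl i z = 0 ↔ ∃ w, D i w = ι i z)
    (hpD : ∀ g w, p i g (D i w) = D i (p (i + 1) g w))
    (h1 : ∀ g, ∀ x ∈ 𝒢 i g, p i g x = x) (h2 : ∀ g h, g ≠ h → ∀ x ∈ 𝒢 i h, p i g x = 0) :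
    iSupIndep (homologyGrading (ι i) (cl i) (𝒢 i)) := by
  intro g
  rw [Submodule.disjoint_def]
  rintro _ ⟨z, hz, rfl⟩ hx
  have hle : ⨆ h, ⨆ (_ : h ≠ g), homologyGrading (ι i) (cl i) (𝒢 i) h ≤
      (LinearMap.ker ((p i g).comp (ι i))).map (cl i) :=
    iSup₂_le fun h hh => Submodule.map_mono fun z hz => h2 g h (Ne.symm hh) _ hz
  obtain ⟨z', hz', hzz⟩ := hle hx
  obtain ⟨w, hw⟩ := (hcl (z - z')).1 (by rw [map_sub, hzz, sub_self])
  refine (hcl z).2 ⟨p (i + 1) g w, ?_⟩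
  have hz'' : p i g (ι i z') = 0 := hz'
  rw [← hpD, hw, map_sub, map_sub, hz'', sub_zero, h1 g _ hz]

/-- The homogeneous components of a cycle are cycles (`hpι`), and their classes add up to its class.
-/
theorem homologyGrading_iSup {i : ℕ} (hι : Function.Injective (ι i))
    (hsurj : Function.Surjective (cl i)) (htop : ⨆ g, 𝒢 i g = ⊤)
    (hpι : ∀ g z, ∃ z', ι i z' = p i g (ι i z))
    (h1 : ∀ g, ∀ x ∈ 𝒢 i g, p i g x = x) (h2 : ∀ g h, g ≠ h → ∀ x ∈ 𝒢 i h, p i g x = 0) :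
    ⨆ g, homologyGrading (ι i) (cl i) (𝒢 i) g = ⊤ := by
  classical
  rw [eq_top_iff]
  rintro x -
  obtain ⟨z, rfl⟩ := hsurj x
  obtain ⟨f, hf, hsum⟩ := (Submodule.mem_iSup_iff_exists_finsupp _ _).1
    (htop ▸ Submodule.mem_top : ι i z ∈ ⨆ g, 𝒢 i g)
  have hpf : ∀ g, p i g (ι i z) = f g := by
    intro g
    rw [← hsum, Finsupp.sum, map_sum]
    rw [Finset.sum_eq_single g]
    · exact h1 g _ (hf g)
    · exact fun h _ hh => h2 g h (Ne.symm hh) _ (hf h)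
    · intro hg
      rw [Finsupp.notMem_support_iff.1 hg, map_zero]
  choose z' hz' using fun g => hpι g z
  have hz : z = ∑ g ∈ f.support, z' g := by
    refine hι ?_
    rw [map_sum, ← hsum, Finsupp.sum]
    exact Finset.sum_congr rfl fun g _ => by rw [hz', hpf]
  rw [hz, map_sum]
  refine sum_mem fun g _ => Submodule.mem_iSup_of_mem g ⟨z' g, ?_, rfl⟩
  rw [SetLike.mem_coe, Submodule.mem_comap, hz', hpf]
  exact hf g

/-- Rank-nullity for the class map on cycles of degree `g`; a boundary of degree `g` is the boundary
of an element of degree `g`, by projection. -/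
theorem finrank_homologyGrading {i : ℕ} [∀ i g, Module.Finite ℂ (𝒢 i g)]
    (hι : Function.Injective (ι i)) (hcl : ∀ z, cl i z = 0 ↔ ∃ w, D i w = ι i z)
    (hcyc : ∀ w, ∃ z, ι i z = D i w)
    (hD : ∀ g, ∀ x ∈ 𝒢 (i + 1) g, D i x ∈ 𝒢 i g)
    (hpD : ∀ g w, p i g (D i w) = D i (p (i + 1) g w)) (hp : ∀ g x, p (i + 1) g x ∈ 𝒢 (i + 1) g)
    (h1 : ∀ g, ∀ x ∈ 𝒢 i g, p i g x = x) (g : Γ) :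
    Module.finrank ℂ (homologyGrading (ι i) (cl i) (𝒢 i) g) +
        Module.finrank ℂ ((𝒢 (i + 1) g).map (D i)) =
      Module.finrank ℂ ((𝒢 i g).comap (ι i)) := by
  let Z := (𝒢 i g).comap (ι i)
  have : Module.Finite ℂ Z := by
    have hr : ∀ z : Z, ι i z ∈ 𝒢 i g := fun z => z.2
    refine Module.Finite.of_injective ((ι i).restrict (p := Z) (q := 𝒢 i g) fun z hz => hz) ?_
    intro a b hab
    exact Subtype.ext (hι (congrArg Subtype.val hab))
  have h := LinearMap.finrank_range_add_finrank_ker ((cl i).domRestrict Z)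
  have hrange : LinearMap.range ((cl i).domRestrict Z) = homologyGrading (ι i) (cl i) (𝒢 i) g := by
    rw [LinearMap.range_domRestrict]
    rfl
  rw [hrange] at h
  rw [← h]
  congr 1
  have hinj : Function.Injective ((ι i).comp Z.subtype) := hι.comp Subtype.val_injective
  rw [LinearEquiv.finrank_eq (Submodule.equivMapOfInjective _ hinj
    (LinearMap.ker ((cl i).domRestrict Z)))]
  refine congrArg (fun W : Submodule ℂ (M i) => Module.finrank ℂ W) (Submodule.ext fun x => ?_)
  constructor
  · rintro ⟨w, hw, rfl⟩
    obtain ⟨z, hz⟩ := hcyc w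
    refine ⟨⟨z, ?_⟩, ?_, hz⟩
    · rw [Submodule.mem_comap, hz]
      exact hD g w hw
    · exact (hcl z).2 ⟨w, hz.symm⟩
  · rintro ⟨z, hz, rfl⟩
    obtain ⟨w, hw⟩ := (hcl z.1).1 hz
    refine ⟨p (i + 1) g w, hp g w, ?_⟩
    rw [← hpD, hw]
    exact h1 g _ z.2

theorem finrank_map_add_finrank_comap {i : ℕ} [∀ i g, Module.Finite ℂ (𝒢 i g)]
    (hι : Function.Injective (ι (i + 1)))
    (hcyc : ∀ x, D i x = 0 ↔ ∃ z, ι (i + 1) z = x) (g : Γ) :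
    Module.finrank ℂ ((𝒢 (i + 1) g).map (D i)) +
      Module.finrank ℂ ((𝒢 (i + 1) g).comap (ι (i + 1))) = Module.finrank ℂ (𝒢 (i + 1) g) := by
  rw [← LinearMap.finrank_range_add_finrank_ker ((D i).domRestrict (𝒢 (i + 1) g)),
    LinearMap.range_domRestrict]
  congr 1
  rw [LinearEquiv.finrank_eq (Submodule.equivMapOfInjective _ hι ((𝒢 (i + 1) g).comap (ι (i + 1)))),
    LinearEquiv.finrank_eq (Submodule.equivMapOfInjective _ (𝒢 (i + 1) g).injective_subtype
      (LinearMap.ker ((D i).domRestrict (𝒢 (i + 1) g))))]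
  refine congrArg (fun W : Submodule ℂ (M (i + 1)) => Module.finrank ℂ W)
    (Submodule.ext fun x => ?_)
  constructor
  · rintro ⟨z, hz, rfl⟩
    exact ⟨⟨_, hz⟩, (hcyc _).2 ⟨z, rfl⟩, rfl⟩
  · rintro ⟨y, hy, rfl⟩
    obtain ⟨z, hz⟩ := (hcyc y.1).1 hy
    refine ⟨z, ?_, hz⟩
    rw [SetLike.mem_coe, Submodule.mem_comap, hz]
    exact y.2

/-- The Euler characteristic of homology, up to the rank of the last boundary map. -/
theorem sum_neg_one_pow_telescope (a z r h : ℕ → ℕ) (h0 : z 0 = a 0)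
    (h1 : ∀ i, h i + r i = z i) (h2 : ∀ i, r i + z (i + 1) = a (i + 1)) (n : ℕ) :
    ∑ i ∈ Finset.range (n + 1), (-1 : ℤ) ^ i * h i =
      ∑ i ∈ Finset.range (n + 1), (-1 : ℤ) ^ i * a i - (-1) ^ n * r n := by
  induction n with
  | zero =>
    have := h1 0
    simp
    omega
  | succ n ih =>
    rw [Finset.sum_range_succ, ih, Finset.sum_range_succ _ (n + 1)]
    have e1 := h1 (n + 1)
    have e2 := h2 n
    have e3 : (h (n + 1) : ℤ) = a (n + 1) - r n - r (n + 1) := by omega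
    rw [e3, pow_succ]
    ring

end GradedHomology

/-! ### Cycles of a chain complex in terms of its differentials. -/

section Cycles

variable {R : Type u} [Ring R] (K : ChainComplex (ModuleCat.{u} R) ℕ)

theorem exists_iCycles_zero_eq (x : K.X 0) : ∃ z, K.iCycles 0 z = x := by
  refine exists_iCycles_eq K ?_
  rw [K.shape 0 _ (by simp)]
  rfl

theorem d_eq_zero_iff {i : ℕ} {x : K.X (i + 1)} :
    K.d (i + 1) i x = 0 ↔ ∃ z, K.iCycles (i + 1) z = x := by
  constructor
  · intro h
    refine exists_iCycles_eq K ?_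
    rwa [ChainComplex.next_nat_succ]
  · rintro ⟨z, rfl⟩
    exact d_iCycles K (i + 1) i z

theorem exists_iCycles_eq_d {i : ℕ} (w : K.X (i + 1)) : ∃ z, K.iCycles i z = K.d (i + 1) i w :=
  ⟨K.toCycles (i + 1) i w, by rw [← ConcreteCategory.comp_apply, K.toCycles_i]⟩

end Cycles

theorem basisGrading_finite {Γ X ι : Type*} [AddCommGroup X] [Module ℂ X]
    (b : Module.Basis ι ℂ X) (δ : ι → Γ) {g : Γ} (h : {i | δ i = g}.Finite) :
    Module.Finite ℂ (basisGrading b δ g) :=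
  FiniteDimensional.span_of_finite ℂ (h.image b)

/-! ### Grading, Euler characteristic and finiteness of Tor. -/

namespace CompleteFan

variable {V : Type u} [NormedAddCommGroup V] [NormedSpace ℝ V]
variable {N : Submodule ℤ V} {F : CompleteFan N} {deg : N → ℂ}

instance finite_rayGens : Finite F.rayGens := F.rayGens_finite

namespace GradedResolution

variable (P : F.GradedResolution deg)

theorem torComplex_d_mem (i j : ℕ) (g : N × ℂ) (t : P.torComplex.X i)
    (ht : t ∈ P.torComplexGrading i g) :
    (P.torComplex.d i j).hom t ∈ P.torComplexGrading j g := by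
  refine (Submodule.span_le (p := (P.torComplexGrading j g).comap
    ((P.torComplex.d i j).hom.restrictScalars ℂ))).2 ?_ ht
  rintro _ ⟨g₁, g₂, hg, a, ha, x, hx, rfl⟩
  exact Submodule.subset_span ⟨g₁, g₂, hg, a, ha, _, P.d_mem i j g₂ x hx, rfl⟩

variable {P}

/-- Homogeneous projections commute with the differentials. -/
theorem projection_torComplex_d (htop : ∀ i, ⨆ g, P.torComplexGrading i g = ⊤)
    {p : ∀ i, N × ℂ → P.torComplex.X i →ₗ[ℂ] P.torComplex.X i}
    (h1 : ∀ i g, ∀ x ∈ P.torComplexGrading i g, p i g x = x)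
    (h2 : ∀ i g h, g ≠ h → ∀ x ∈ P.torComplexGrading i h, p i g x = 0) (i j : ℕ) (g : N × ℂ)
    (x : P.torComplex.X i) :
    p j g ((P.torComplex.d i j).hom x) = (P.torComplex.d i j).hom (p i g x) := by
  have : (p j g).comp ((P.torComplex.d i j).hom.restrictScalars ℂ) =
      ((P.torComplex.d i j).hom.restrictScalars ℂ).comp (p i g) := by
    refine linearMap_ext_of_iSup (htop i) fun h y hy => ?_
    have hm := P.torComplex_d_mem i j h y hy
    simp only [LinearMap.comp_apply, LinearMap.restrictScalars_apply]
    by_cases hgh : g = h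
    · subst hgh
      rw [h1 i _ y hy]
      exact h1 j _ _ hm
    · rw [h2 i _ _ hgh y hy, map_zero]
      exact h2 j _ _ hgh _ hm
  exact congrArg (fun ψ => ψ x) this

theorem isGrading_torGrading (hind : ∀ i, iSupIndep (P.torComplexGrading i))
    (htop : ∀ i, ⨆ g, P.torComplexGrading i g = ⊤) (i : ℕ) :
    F.IsGrading deg (F.tor i) (P.torGrading i) := by
  choose p hp h1 h2 using fun i => exists_grading_projections (hind i) (htop i)
  have hpD := projection_torComplex_d htop h1 h2
  refine ⟨?_, ?_, fun d g x hx => ?_⟩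
  · exact homologyGrading_iSupIndep (p := p) (𝒢 := P.torComplexGrading)
      (D := fun i => (P.torComplex.d (i + 1) i).hom.restrictScalars ℂ)
      (ι := fun i => (P.torComplex.iCycles i).hom.restrictScalars ℂ)
      (cl := fun i => (P.torClass i).hom.restrictScalars ℂ)
      (fun z => P.torClass_eq_zero_iff) (hpD (i + 1) i) (h1 i) (h2 i)
  · refine homologyGrading_iSup (p := p) (𝒢 := P.torComplexGrading)
      (ι := fun i => (P.torComplex.iCycles i).hom.restrictScalars ℂ)
      (cl := fun i => (P.torClass i).hom.restrictScalars ℂ)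
      (iCycles_injective _ i) (P.torClass_surjective i) (htop i) (fun g z => ?_) (h1 i) (h2 i)
    cases i with
    | zero => exact exists_iCycles_zero_eq _ _
    | succ i =>
      refine (d_eq_zero_iff _).1 ?_
      have hz := d_iCycles P.torComplex (i + 1) i z
      have h := hpD (i + 1) i g (P.torComplex.iCycles (i + 1) z)
      exact h.symm.trans ((congrArg (p i g) hz).trans (map_zero _))
  -- Compatibility with the variables is automatic, since they act as zero on Tor.
  · have h0 : (MvPolynomial.X d : F.PolyRing) • x = 0 := P.X_smul_tor i d x
    rw [h0]
    exact zero_mem _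

/-- The Euler characteristic of a homogeneous part of `Tor`. -/
theorem sum_finrank_torGrading (hind : ∀ i, iSupIndep (P.torComplexGrading i))
    (htop : ∀ i, ⨆ g, P.torComplexGrading i g = ⊤)
    (hfin : ∀ i g, Module.Finite ℂ (P.torComplexGrading i g)) {n : ℕ}
    (hn : Subsingleton (P.torComplex.X (n + 1))) (g : N × ℂ) :
    ∑ i ∈ Finset.range (n + 1), (-1 : ℤ) ^ i * Module.finrank ℂ (P.torGrading i g) =
      ∑ i ∈ Finset.range (n + 1), (-1 : ℤ) ^ i * Module.finrank ℂ (P.torComplexGrading i g) := by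
  choose p hp h1 h2 using fun i => exists_grading_projections (hind i) (htop i)
  have hpD := projection_torComplex_d htop h1 h2
  let D := fun i => (P.torComplex.d (i + 1) i).hom.restrictScalars ℂ
  let ι := fun i => (P.torComplex.iCycles i).hom.restrictScalars ℂ
  have key := sum_neg_one_pow_telescope
    (fun i => Module.finrank ℂ (P.torComplexGrading i g))
    (fun i => Module.finrank ℂ ((P.torComplexGrading i g).comap (ι i)))
    (fun i => Module.finrank ℂ ((P.torComplexGrading (i + 1) g).map (D i)))
    (fun i => Module.finrank ℂ (P.torGrading i g)) ?_ ?_ ?_ n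
  · have h0 : Module.finrank ℂ ((P.torComplexGrading (n + 1) g).map (D n)) = 0 := by
      have : (P.torComplexGrading (n + 1) g).map (D n) = ⊥ := by
        refine (Submodule.eq_bot_iff _).2 ?_
        rintro _ ⟨w, -, rfl⟩
        rw [Subsingleton.elim w 0, map_zero]
      rw [this, finrank_bot]
    rw [key, h0, Nat.cast_zero, mul_zero, sub_zero]
  · rw [LinearEquiv.finrank_eq (Submodule.equivMapOfInjective (ι 0)
      (iCycles_injective P.torComplex 0) _), Submodule.map_comap_eq_of_surjective]
    exact exists_iCycles_zero_eq P.torComplex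
  · intro i
    exact finrank_homologyGrading (p := p) (𝒢 := P.torComplexGrading) (D := D) (ι := ι)
      (cl := fun i => (P.torClass i).hom.restrictScalars ℂ) (iCycles_injective _ i)
      (fun z => P.torClass_eq_zero_iff) (exists_iCycles_eq_d P.torComplex)
      (P.torComplex_d_mem (i + 1) i) (hpD (i + 1) i) (hp (i + 1)) (h1 i) g
  · intro i
    exact finrank_map_add_finrank_comap (𝒢 := P.torComplexGrading) (D := D) (ι := ι)
      (iCycles_injective _ (i + 1)) (fun x => d_eq_zero_iff P.torComplex) g

theorem subsingleton_tor {i : ℕ} (h : Subsingleton (P.torComplex.X i)) :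
    Subsingleton (F.tor i) := by
  have h1 : Subsingleton (P.torComplex.cycles i) := (iCycles_injective P.torComplex i).subsingleton
  exact (P.torClass_surjective i).subsingleton

end GradedResolution

theorem smul_tor (P : F.GradedResolution deg) (i : ℕ) (r : F.PolyRing) (t : F.tor i) :
    r • t = (MvPolynomial.constantCoeff r) • t := by
  induction r using MvPolynomial.induction_on with
  | C c => rw [MvPolynomial.constantCoeff_C]; rfl
  | add p q hp hq => rw [add_smul, map_add, hp, hq, add_smul]
  | mul_X p d hp => rw [mul_smul, P.X_smul_tor, smul_zero, map_mul,
      MvPolynomial.constantCoeff_X, mul_zero, zero_smul]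

/-- Inside one cone no product of basis elements vanishes, so y^b reaches all translates of b by
rays of that cone. -/
theorem y_mem_of_mem_cone {W : Submodule F.PolyRing F.DeformedRing} {C : PointedCone ℝ V}
    (hC : C ∈ F.cones) {b : N} (hb : (b : V) ∈ C) (hbW : DeformedRing.y F b ∈ W) (a : N → ℕ)
    (s : Finset N) (hs : ∀ d ∈ s, d ∈ F.rayGens ∧ (d : V) ∈ C) :
    ((b + ∑ d ∈ s, a d • d : N) : V) ∈ C ∧ DeformedRing.y F (b + ∑ d ∈ s, a d • d) ∈ W := by
  classical
  have step : ∀ (k : ℕ) (d n : N), d ∈ F.rayGens → (d : V) ∈ C → (n : V) ∈ C →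
      DeformedRing.y F n ∈ W → ((n + k • d : N) : V) ∈ C ∧ DeformedRing.y F (n + k • d) ∈ W := by
    intro k d n hd hdC hn hnW
    induction k with
    | zero => simpa using ⟨hn, hnW⟩
    | succ k ih =>
      rw [succ_nsmul, ← add_assoc]
      refine ⟨C.add_mem ih.1 hdC, ?_⟩
      have h1 := W.smul_mem (MvPolynomial.X ⟨d, hd⟩ : F.PolyRing) ih.2
      rwa [X_smul_y, DeformedRing.yMul, if_pos ⟨C, hC, hdC, ih.1⟩, add_comm d] at h1
  induction s using Finset.induction_on with
  | empty => simpa using ⟨hb, hbW⟩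
  | insert d s hds ih =>
    obtain ⟨h1, h2⟩ := ih fun e he => hs e (Finset.mem_insert_of_mem he)
    obtain ⟨h3, h4⟩ := hs d (Finset.mem_insert_self d s)
    rw [Finset.sum_insert hds, add_comm (a d • d), ← add_assoc]
    exact step (a d) d _ h3 h4 h1 h2

variable (F) in
/-- The ring `ℂ[N]^Σ` is a finite `R`-module. -/
theorem finite_deformedRing [FiniteDimensional ℝ V] [DiscreteTopology N] :
    Module.Finite F.PolyRing F.DeformedRing := by
  classical
  choose! B hB1 hB2 using fun (C : PointedCone ℝ V) (hC : C ∈ F.cones) =>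
    F.exists_finite_remainders hC
  refine ⟨(F.cones.biUnion B).image (DeformedRing.y F), ?_⟩
  set W := Submodule.span F.PolyRing
    (((F.cones.biUnion B).image (DeformedRing.y F) : Finset F.DeformedRing) : Set F.DeformedRing)
  have hy : ∀ n : N, DeformedRing.y F n ∈ W := by
    intro n
    obtain ⟨C, hC, hn⟩ := F.complete n
    obtain ⟨b, hb, a, rfl⟩ := hB2 C hC n hn
    refine (y_mem_of_mem_cone hC (hB1 C hC b hb) (Submodule.subset_span ?_) a _ fun d hd =>
      (F.mem_raysIn).1 hd).2
    exact Finset.mem_coe.2 (Finset.mem_image_of_mem _ (Finset.mem_biUnion.2 ⟨C, hC, hb⟩))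
  rw [eq_top_iff]
  intro x _
  have hx : x ∈ Submodule.span ℂ (Set.range (DeformedRing.y F)) := by
    rw [(DeformedRing.y F).span_eq]
    trivial
  refine (Submodule.span_le (p := W.restrictScalars ℂ)).2 ?_ hx
  rintro _ ⟨n, rfl⟩
  exact hy n

/-- Tor is a quotient of a submodule of a finite module over a Noetherian ring, hence finite over R.
As R acts on it through constants, generators over R span it over ℂ. -/
theorem finite_tor [FiniteDimensional ℝ V] [DiscreteTopology N] (i : ℕ) :
    Module.Finite ℂ (F.tor i) := by
  have hA := F.finite_deformedRing
  -- The statement does not involve the grading, so the degree function can be taken to be zero.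
  let P := F.koszulGradedResolution (0 : N → ℂ)
  let e : P.torComplex.X i ≃ₗ[F.PolyRing] ({S : Finset F.rayGens // S.card = i} →₀ F.DeformedRing) :=
    tensorEquiv (F.koszulComplexBasis i)
  have h1 : Module.Finite F.PolyRing (P.torComplex.X i) := Module.Finite.equiv e.symm
  have h2 : Module.Finite F.PolyRing (P.torComplex.cycles i) :=
    Module.Finite.of_injective (P.torComplex.iCycles i).hom (iCycles_injective _ i)
  have h3 : Module.Finite F.PolyRing (F.tor i) :=
    Module.Finite.of_surjective (P.torClass i).hom (P.torClass_surjective i)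
  obtain ⟨s, hs⟩ := h3.fg_top
  refine ⟨s, eq_top_iff.2 fun x _ => ?_⟩
  have hx : x ∈ Submodule.span F.PolyRing (s : Set (F.tor i)) := hs ▸ trivial
  induction hx using Submodule.span_induction with
  | mem x hx => exact Submodule.subset_span hx
  | zero => exact zero_mem _
  | add x y _ _ hx hy => exact add_mem (hx trivial) (hy trivial)
  | smul r x _ hx =>
    rw [smul_tor P]
    exact Submodule.smul_mem _ _ (hx trivial)

end CompleteFan

/-! ### Euler characteristics of the graded parts and the alternating trace. -/

namespace CompleteFan

variable {V : Type u} [NormedAddCommGroup V] [NormedSpace ℝ V]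
variable {N : Submodule ℤ V} {F : CompleteFan N} {deg : N → ℂ}

instance fintype_rayGens : Fintype F.rayGens := Fintype.ofFinite _

section Euler

variable (F deg)

/-- The second component of the degree of `y^(n - ∑ S) ⊗ e_S`. -/
def tensorDegree (n : N) (S : Finset F.rayGens) : ℂ :=
  deg (n - (F.subsetDegree deg S).1) + (F.subsetDegree deg S).2

open Classical in
/-- The Euler characteristic of the degree `g` part of the tensor product of `ℂ[N]^Σ` with the
Koszul complex. -/
def eulerChar (g : N × ℂ) : ℤ :=
  ∑ S : Finset F.rayGens, (-1) ^ S.card * if F.tensorDegree deg g.1 S = g.2 then 1 else 0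

theorem degree_eq_iff (n : N) (S : Finset F.rayGens) (g : N × ℂ) :
    (n, deg n) + F.subsetDegree deg S = g ↔
      n = g.1 - (F.subsetDegree deg S).1 ∧ F.tensorDegree deg g.1 S = g.2 := by
  rw [Prod.ext_iff, Prod.fst_add, Prod.snd_add, eq_sub_iff_add_eq]
  refine and_congr_right fun h => ?_
  rw [tensorDegree, ← h, add_sub_cancel_right]

open Classical in
-- The lattice component of the degree and the subset `S` determine n in y^n ⊗ e_S, so the basis
-- vectors of degree `g` are counted by subsets.
theorem finrank_koszul_torComplexGrading (hdeg : F.IsDegreeFunction deg) (i : ℕ) (g : N × ℂ) :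
    Module.finrank ℂ ((F.koszulGradedResolution deg).torComplexGrading i g) =
      ((Finset.univ.powersetCard i).filter fun S => F.tensorDegree deg g.1 S = g.2).card := by
  rw [koszul_torComplexGrading F deg hdeg, finrank_basisGrading, ← Set.ncard_coe_finset]
  refine Set.ncard_congr (fun p _ => p.1.1) ?_ ?_ ?_
  · rintro ⟨⟨S, hS⟩, n⟩ h
    simp only [Finset.coe_filter, Finset.mem_powersetCard, Finset.subset_univ, true_and]
    exact ⟨hS, ((F.degree_eq_iff deg n S g).1 h).2⟩
  · rintro ⟨⟨S, hS⟩, n⟩ ⟨⟨S', hS'⟩, n'⟩ h h' heq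
    obtain rfl : S = S' := heq
    obtain rfl : n = n' := ((F.degree_eq_iff deg n S g).1 h).1.trans
      ((F.degree_eq_iff deg n' S g).1 h').1.symm
    rfl
  · intro S hS
    simp only [Finset.coe_filter, Finset.mem_powersetCard, Finset.subset_univ, true_and] at hS
    exact ⟨⟨⟨S, hS.1⟩, g.1 - (F.subsetDegree deg S).1⟩,
      (F.degree_eq_iff deg _ S g).2 ⟨rfl, hS.2⟩, rfl⟩

theorem finite_koszul_torComplexGrading (hdeg : F.IsDegreeFunction deg) (i : ℕ) (g : N × ℂ) :
    Module.Finite ℂ ((F.koszulGradedResolution deg).torComplexGrading i g) := by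
  rw [koszul_torComplexGrading F deg hdeg]
  refine basisGrading_finite _ _ (Set.Finite.of_finite_image (f := Sigma.fst) (Set.toFinite _) ?_)
  rintro ⟨S, n⟩ h ⟨S', n'⟩ h' heq
  obtain rfl : S = S' := heq
  obtain rfl : n = n' := ((F.degree_eq_iff deg n S.1 g).1 h).1.trans
    ((F.degree_eq_iff deg n' S.1 g).1 h').1.symm
  rfl

theorem sum_finrank_koszul (hdeg : F.IsDegreeFunction deg) (g : N × ℂ) :
    ∑ i ∈ Finset.range (Fintype.card F.rayGens + 1), (-1 : ℤ) ^ i *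
      Module.finrank ℂ ((F.koszulGradedResolution deg).torComplexGrading i g) =
      F.eulerChar deg g := by
  classical
  rw [eulerChar, ← Finset.powerset_univ, Finset.sum_powerset, Finset.card_univ]
  refine Finset.sum_congr rfl fun i _ => ?_
  rw [finrank_koszul_torComplexGrading F deg hdeg, Finset.card_filter, Nat.cast_sum,
    Finset.mul_sum]
  refine Finset.sum_congr rfl fun S hS => ?_
  rw [(Finset.mem_powersetCard.1 hS).2]
  push_cast
  rfl

theorem subsingleton_koszul_torComplex {i : ℕ} (hi : Fintype.card F.rayGens < i) :
    Subsingleton ((F.koszulGradedResolution deg).torComplex.X i) := by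
  have : IsEmpty (Σ _ : {S : Finset F.rayGens // S.card = i}, N) :=
    ⟨fun p => absurd (p.1.1.card_le_univ) (by rw [p.1.2]; omega)⟩
  exact (F.koszulTorBasis deg i).repr.injective.subsingleton

theorem isGrading_torGrading (hdeg : F.IsDegreeFunction deg) (P : F.GradedResolution deg) (i : ℕ) :
    F.IsGrading deg (F.tor i) (P.torGrading i) := by
  rw [GradedResolution.torGrading_eq P (F.koszulGradedResolution deg)]
  refine GradedResolution.isGrading_torGrading (fun j => ?_) (fun j => ?_) i
  · rw [koszul_torComplexGrading F deg hdeg]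
    exact basisGrading_iSupIndep _ _
  · rw [koszul_torComplexGrading F deg hdeg]
    exact basisGrading_iSup _ _

theorem subsingleton_tor {i : ℕ} (hi : Fintype.card F.rayGens < i) : Subsingleton (F.tor i) :=
  GradedResolution.subsingleton_tor (F.subsingleton_koszul_torComplex 0 hi)

theorem sum_finrank_torGrading (hdeg : F.IsDegreeFunction deg) (P : F.GradedResolution deg)
    (g : N × ℂ) :
    ∑ i ∈ Finset.range (Fintype.card F.rayGens + 1), (-1 : ℤ) ^ i *
      Module.finrank ℂ (P.torGrading i g) = F.eulerChar deg g := by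
  rw [← sum_finrank_koszul F deg hdeg]
  have h := GradedResolution.sum_finrank_torGrading (P := F.koszulGradedResolution deg)
    (fun j => by
      rw [koszul_torComplexGrading F deg hdeg]
      exact basisGrading_iSupIndep _ _)
    (fun j => by
      rw [koszul_torComplexGrading F deg hdeg]
      exact basisGrading_iSup _ _)
    (F.finite_koszul_torComplexGrading deg hdeg)
    (F.subsingleton_koszul_torComplex deg (Nat.lt_succ_self _)) g
  rw [← h]
  refine Finset.sum_congr rfl fun i _ => ?_
  rw [GradedResolution.torGrading_eq P (F.koszulGradedResolution deg)]

theorem rayFactor_act_eq_sum (n : N) :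
    seriesAct (rayFactor deg F.rays) (fun n => expTwoPiI (deg n)) n =
      ∑ S : Finset F.rayGens, (-1) ^ S.card * expTwoPiI (F.tensorDegree deg n S) := by
  classical
  rw [rayFactor, seriesAct_koszulFactor]
  symm
  refine Finset.sum_bij' (fun S _ => S.map (Function.Embedding.subtype _))
    (fun T _ => T.subtype (· ∈ F.rayGens)) ?_ ?_ ?_ ?_ ?_
  · intro S _
    rw [Finset.mem_powerset]
    intro d hd
    obtain ⟨e, -, rfl⟩ := Finset.mem_map.1 hd
    exact F.mem_rays.2 e.2
  · intros
    exact Finset.mem_univ _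
  · intro S _
    ext d
    simp
  · intro T hT
    refine Finset.subtype_map_of_mem fun d hd => F.mem_rays.1 (Finset.mem_powerset.1 hT hd)
  · intro S _
    have h1 : (F.subsetDegree deg S).1 = ∑ d ∈ S, (d : N) := by
      rw [subsetDegree, Prod.fst_sum]
      rfl
    have h2 : (F.subsetDegree deg S).2 = ∑ d ∈ S, deg d := by
      rw [subsetDegree, Prod.snd_sum]
      rfl
    rw [tensorDegree, h1, h2, expTwoPiI_add, expTwoPiI_sum, Finset.card_map, Finset.prod_map,
      Finset.sum_map, mul_assoc, mul_comm (expTwoPiI _)]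
    rfl

/-- The expanded product is sorted by the ℂ-component of the degree. The set `s` is left free so
that one set can serve many n. -/
theorem rayFactor_act_eq_sum_eulerChar (n : N) (s : Finset ℂ)
    (hs : ∀ S, F.tensorDegree deg n S ∈ s) :
    seriesAct (rayFactor deg F.rays) (fun n => expTwoPiI (deg n)) n =
      ∑ c ∈ s, (F.eulerChar deg (n, c) : ℂ) * expTwoPiI c := by
  classical
  rw [rayFactor_act_eq_sum]
  simp only [eulerChar, Int.cast_sum, Finset.sum_mul]
  rw [Finset.sum_comm]
  refine Finset.sum_congr rfl fun S _ => ?_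
  rw [Finset.sum_eq_single_of_mem _ (hs S)]
  · simp
  · intro c _ hc
    simp [Ne.symm hc]

end Euler

theorem torTrace_eq (P : F.GradedResolution deg) (i : ℕ) (τ : ℂ) (m : V →L[ℝ] ℂ)
    (s : Finset (N × ℂ)) (hs : ∀ g, P.torGrading i g ≠ ⊥ → g ∈ s) :
    P.torTrace i τ m = ∑ g ∈ s, (Module.finrank ℂ (P.torGrading i g) : ℂ) *
      (latticeChar N (τ • m) (Multiplicative.ofAdd g.1) * expTwoPiI g.2) := by
  have h : ∀ g : N × ℂ, (Module.finrank ℂ (P.torGrading i g) : ℂ) *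
      (Complex.exp (2 * Real.pi * Complex.I * τ * m (g.1 : V)) *
        Complex.exp (2 * Real.pi * Complex.I * g.2)) =
      (Module.finrank ℂ (P.torGrading i g) : ℂ) *
        (latticeChar N (τ • m) (Multiplicative.ofAdd g.1) * expTwoPiI g.2) := by
    intro g
    rw [latticeChar_apply, expTwoPiI, expTwoPiI, smul_apply, smul_eq_mul,
      ← mul_assoc (2 * Real.pi * Complex.I) τ]
  rw [GradedResolution.torTrace, finsum_congr h]
  refine finsum_eq_sum_of_support_subset _ fun g hg => hs g fun h0 => hg ?_
  dsimp only
  rw [h0, finrank_bot, Nat.cast_zero, zero_mul]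

/-- Both sides equal the sum over degrees (n, c) of the Euler characteristic times the character at
n times e^(2πic). -/
theorem finsum_torTrace [FiniteDimensional ℝ V] [DiscreteTopology N]
    (hdeg : F.IsDegreeFunction deg) (P : F.GradedResolution deg) (τ : ℂ) (m : V →L[ℝ] ℂ)
    {T : AddMonoidAlgebra ℂ N} (hT : seriesAct (rayFactor deg F.rays)
      (fun n => expTwoPiI (deg n)) = fun n => T.coeff n) :
    ∑ᶠ i : ℕ, (-1 : ℂ) ^ i * P.torTrace i τ m = evalChar (latticeChar N (τ • m)) T := by
  classical
  set k := Fintype.card F.rayGens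
  have hfin : ∀ i, {g | P.torGrading i g ≠ ⊥}.Finite := fun i => by
    have := F.finite_tor i
    exact WellFoundedGT.finite_ne_bot_of_iSupIndep (F.isGrading_torGrading deg hdeg P i).iSupIndep
  let s : Finset (N × ℂ) := (Finset.range (k + 1)).biUnion fun i => (hfin i).toFinset
  have hs : ∀ i ∈ Finset.range (k + 1), ∀ g, P.torGrading i g ≠ ⊥ → g ∈ s := fun i hi g hg =>
    Finset.mem_biUnion.2 ⟨i, hi, (hfin i).mem_toFinset.2 hg⟩
  -- The complex may be nonzero in infinitely many degrees; it is finite-dimensionality of Tor that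
  -- confines the nonzero Euler characteristics to a finite set.
  have hE : ∀ g ∉ s, F.eulerChar deg g = 0 := by
    intro g hg
    rw [← F.sum_finrank_torGrading deg hdeg P]
    refine Finset.sum_eq_zero fun i hi => ?_
    have : P.torGrading i g = ⊥ := by
      by_contra h
      exact hg (hs i hi g h)
    rw [this, finrank_bot, Nat.cast_zero, mul_zero]
  let χ := latticeChar N (τ • m)
  have h1 : ∑ᶠ i : ℕ, (-1 : ℂ) ^ i * P.torTrace i τ m =
      ∑ g ∈ s, (F.eulerChar deg g : ℂ) * (χ (Multiplicative.ofAdd g.1) * expTwoPiI g.2) := by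
    rw [finsum_eq_sum_of_support_subset (s := Finset.range (k + 1))]
    · rw [Finset.sum_congr rfl fun i hi => by rw [torTrace_eq P i τ m s (hs i hi), Finset.mul_sum],
        Finset.sum_comm]
      refine Finset.sum_congr rfl fun g _ => ?_
      rw [← F.sum_finrank_torGrading deg hdeg P g, Int.cast_sum, Finset.sum_mul]
      refine Finset.sum_congr rfl fun i _ => ?_
      push_cast
      ring
    · intro i hi
      by_contra h
      rw [Finset.mem_coe, Finset.mem_range, not_lt] at h
      have := F.subsingleton_tor (i := i) (by omega)
      refine hi ?_
      dsimp only
      rw [torTrace_eq P i τ m ∅ fun g hg => absurd (Subsingleton.elim _ _) hg, Finset.sum_empty,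
        mul_zero]
  -- Large enough for the degrees in `s` and for every ℂ-degree occurring over their lattice
  -- components, so that both sums extend to one product set.
  let c : Finset ℂ := s.image Prod.snd ∪
    (s.image Prod.fst).biUnion fun n => Finset.univ.image (F.tensorDegree deg n)
  have hcoeff : ∀ n, ∀ r : Finset ℂ, (∀ S, F.tensorDegree deg n S ∈ r) →
      T.coeff n = ∑ c ∈ r, (F.eulerChar deg (n, c) : ℂ) * expTwoPiI c := fun n r hr =>
    (congrFun hT n).symm.trans (F.rayFactor_act_eq_sum_eulerChar deg n r hr)
  rw [h1, evalChar_eq_sum _ T (s.image Prod.fst)]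
  · have h2 : ∀ n ∈ s.image Prod.fst, T.coeff n * χ (Multiplicative.ofAdd n) =
        ∑ z ∈ c, (F.eulerChar deg (n, z) : ℂ) * (χ (Multiplicative.ofAdd n) * expTwoPiI z) := by
      intro n hn
      rw [hcoeff n c fun S => Finset.mem_union_right _ (Finset.mem_biUnion.2
        ⟨n, hn, Finset.mem_image_of_mem _ (Finset.mem_univ S)⟩), Finset.sum_mul]
      exact Finset.sum_congr rfl fun z _ => by ring
    rw [Finset.sum_congr rfl h2, ← Finset.sum_product']
    refine Finset.sum_subset (fun g hg => Finset.mem_product.2 ⟨Finset.mem_image_of_mem _ hg,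
      Finset.mem_union_left _ (Finset.mem_image_of_mem _ hg)⟩) fun g _ hg => ?_
    rw [hE g hg, Int.cast_zero, zero_mul]
  · intro n hn
    rw [hcoeff n (Finset.univ.image (F.tensorDegree deg n)) fun S =>
      Finset.mem_image_of_mem _ (Finset.mem_univ S)]
    refine Finset.sum_eq_zero fun z _ => ?_
    rw [hE (n, z) fun h => hn (Finset.mem_image_of_mem _ h), Int.cast_zero, zero_mul]

end CompleteFan

end ToricForms

end

/-! ### The trace formula. -/

theorem mainTheorem11 {V : Type u} [NormedAddCommGroup V] [NormedSpace ℝ V]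
    [FiniteDimensional ℝ V] (N : Submodule ℤ V) [DiscreteTopology N] [IsZLattice ℝ N]
    (F : ToricForms.CompleteFan N) (deg : N → ℂ) (hdeg : F.IsDegreeFunction deg) :
    Nonempty (F.GradedResolution deg) ∧
    ∀ P : F.GradedResolution deg,
      (∀ i : ℕ, Module.Finite ℂ (F.tor i) ∧ F.IsGrading deg (F.tor i) (P.torGrading i)) ∧
      (∃ b : ℕ, ∀ i : ℕ, b ≤ i → Subsingleton (F.tor i)) ∧
      ∀ (τ : ℂ) (m : V →L[ℝ] ℂ), 0 < τ.im →
        (∀ d ∈ F.rayGens, Complex.exp (2 * Real.pi * Complex.I * deg d) *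
          Complex.exp (2 * Real.pi * Complex.I * τ * m (d : V)) ≠ 1) →
        (∀ C ∈ F.cones, ∃! a : ℂ, ToricForms.HasConeValue deg C (τ, m) a) ∧
        ToricForms.alternatingConeSum F deg (τ, m) =
          (∑ᶠ i : ℕ, (-1 : ℂ) ^ i * P.torTrace i τ m) /
            ∏ᶠ d ∈ F.rayGens, (1 - Complex.exp (2 * Real.pi * Complex.I * deg d) *
              Complex.exp (2 * Real.pi * Complex.I * τ * m (d : V))) := by
  refine ⟨⟨F.koszulGradedResolution deg⟩, fun P => ⟨fun i => ⟨F.finite_tor i,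
    F.isGrading_torGrading deg hdeg P i⟩, ⟨Fintype.card F.rayGens + 1, fun i hi =>
    F.subsingleton_tor (by omega)⟩, fun τ m hτ hne => ?_⟩⟩
  have hexp : ∀ d : N, Complex.exp (2 * Real.pi * Complex.I * τ * m (d : V)) =
      ToricForms.expTwoPiI ((τ • m) (d : V)) := fun d => by
    rw [ToricForms.expTwoPiI, smul_apply, smul_eq_mul, mul_assoc _ τ]
  have hne' : ∀ d ∈ F.rayGens, ToricForms.expTwoPiI ((τ • m) (d : V) + deg d) ≠ 1 := by
    intro d hd
    rw [add_comm, ToricForms.expTwoPiI_add, ← hexp]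
    exact hne d hd
  refine ⟨fun C hC => F.existsUnique_hasConeValue hdeg hC hτ fun d hd =>
    hne' d (F.mem_raysIn.1 hd).1, ?_⟩
  obtain ⟨T, hT, hsum⟩ := F.exists_alternatingConeSum_eq hdeg
  rw [hsum (τ, m) hτ fun d hd => hne' d (F.mem_rays.1 hd), F.finsum_torTrace hdeg P τ m hT]
  congr 1
  rw [ToricForms.CompleteFan.rayFactor, ToricForms.evalChar_koszulFactor,
    finprod_mem_eq_finite_toFinset_prod _ F.rayGens_finite]
  refine Finset.prod_congr rfl fun d _ => ?_
  rw [hexp]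
  rfl
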